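/- Stability of optimal strategies. Setting. Let $X,Y\subset\mathbf R^n$ be open and bounded, with closures $\bar X,\bar Y$, and let $y_\emptyset\in\bar Y$ (the null product). A triple $(b,c,\mu)$ consists of a preference function $b:\bar X\times\bar Y\to\mathbf R$, a manufacturing cost $c:\bar Y\to\mathbf R$ and a Borel probability measure $\mu$ on $X$. Write $$v^b(x)=\sup_{y\in\bar Y}b(x,y)-v(y),\qquad u^{b^*}(y)=\sup_{x\in\bar X}b(x,y)-u(x).$$ A function $u:\bar X\to\mathbf R$ is $b$-convex if $u=(u^{b^*})^b$, and $v:\bar Y\to\mathbf R$ is $b^*$-convex if $v=(v^b)^{b^*}$. The best responses of $x\in\bar X$ to $v$ are the points $y\in\bar Y$ maximizing $b(x,y)-v(y)$; $v$ is strictly $b^*$-convex if it is $b^*$-convex and each $x\in\bar X$ has exactly one best response to $v$, depending continuously on $x$. The triple $(b,c,\mu)$ satisfies the uniqueness hypotheses if $c$ is $b^*$-convex and the following hold for all $x_0\in\bar X$, $y_0\in\bar Y$. (B0) $b\in C^4(\bar X\times\bar Y)$, i.e. $b$ extends to a $C^4$ function near $\bar X\times\bar Y$. (B1) $y\in\bar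 Y\mapsto D_xb(x_0,y)$ and $x\in\bar X\mapsto D_yb(x,y_0)$ are diffeomorphisms onto their ranges. (B2) $D_yb(X,y_0)$ and $D_xb(x_0,Y)$ are convex. (B3) $\frac{\partial^4}{\partial s^2\partial t^2}\big|_{(0,0)}b(x(s),y(t))\ge0$ whenever $x(\cdot)\in\bar X$ and $y(\cdot)\in\bar Y$ are such that $t\in[-1,1]\mapsto(D_yb(x(t),y(0)),D_xb(x(0),y(t)))$ is an affinely parameterized line segment. Moreover at least one of the following holds: $c$ is strictly $b^*$-convex; or the inequality in (B3) is strict whenever $x'(0)\ne0$ and $y'(0)\ne0$; or for all distinct $x,x_0\in\bar X$ the function $q\mapsto b(x_0,y_b(x,q))-b(x,y_b(x,q))$ is strictly convex on $D_xb(x,\bar Y)$. Here $y_b(x,q)\in\bar Y$ denotes the unique solution of $D_xb(x,y_b(x,q))=q$, for $q\in D_xb(x,\bar Y)$. A strategy is a $b$-convex $u$ with $u\ge b(\cdot,y_\emptyset)-c(y_\emptyset)$ on $\bar X$. The principal's net losses are $$L(u)=\int_X\big[u(x)+c(y_b(x,Du(x)))-b(x,y_b(x,Du(x)))\big]\,d\mu(x),$$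 and $u$ is optimal if it minimizes $L$ among all strategies. Here, where $u$ is differentiable, $Du(x)$ is its gradient; unless $\mu$ vanishes on all Lipschitz hypersurfaces, $Du$ is extended to all of $X$ by a measurable selection $Du(x)\in\partial u(x)=\{q: u(z)\ge u(x)+q\cdot(z-x)+o(|z-x|)\ \forall z\in X\}$ obeying the tie-breaking rule: $Du(x)=D_xb(x,y)$ for a $y$ that maximizes $u^{b^*}(y)-c(y)$ among the best responses of $x$ to $u^{b^*}$. (The value $L(u)$ does not depend on the selection.) Statement. For each $i\in\mathbf N\cup\{\infty\}$ let $(b_i,c_i,\mu_i)$ satisfy the uniqueness hypotheses (with the same $X,Y,y_\emptyset$), let $u_i$ be an optimal strategy for $(b_i,c_i,\mu_i)$, let $Du_i$ be as above, and set $G_i(x)=y_{b_i}(x,Du_i(x))$. Suppose that $b_i\to b_\infty$ in $C^2(\bar X\times\bar Y)$, $c_i\to c_\infty$ uniformly on $\bar Y$, and $\mu_i\rightharpoonup\mu_\infty$ weakly-$*$, i.e. $\int_{\bar X} g\,d\mu_i\to\int_{\bar X} g\,d\mu_\infty$ for each continuous $g:\bar X\to\mathbf R$. Assume finally that $\mu_\infty$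 vanishes on all Lipschitz hypersurfaces (graphs of Lipschitz functions over hyperplanes). Then: (i) $G_i(x)\to G_\infty(x)$ for $\mu_\infty$-a.e. $x\in X$; (ii) each $G_i$ is $\mu_i$-measurable, and the optimal measures $\nu_i:=(G_i)_\#\mu_i$ converge weakly-$*$ on $\bar Y$ to $\nu_\infty$ as $i\to\infty$; (iii) $\lim_{i\to\infty}\|u_i-u_\infty\|_{L^\infty(X,d\mu_\infty)}=0$. -/

import Mathlib

open Set Filter Topology MeasureTheory
open scoped NNReal ENNReal

namespace PrincipalAgent

noncomputable section

/-- Euclidean space `ℝⁿ`. -/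
abbrev Euc (n : ℕ) : Type := EuclideanSpace ℝ (Fin n)

/-- `D_x b(x, y)`. -/
def gradX {n : ℕ} (b : Euc n → Euc n → ℝ) (x y : Euc n) : Euc n :=
  gradient (fun x' => b x' y) x

/-- `D_y b(x, y)`. -/
def gradY {n : ℕ} (b : Euc n → Euc n → ℝ) (x y : Euc n) : Euc n :=
  gradient (fun y' => b x y') y

/-- `f` restricts to a (`C¹`) diffeomorphism from `K` onto its range `f(K)`: both `f` and an inverse of
`f|_K` are `C¹` near each point of their domains (for functions on a subset of `ℝⁿ` that is not open,
smoothness means, as usual, existence of a smooth extension). -/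
def IsDiffeoOntoRange {n : ℕ} (f : Euc n → Euc n) (K : Set (Euc n)) : Prop :=
  (∀ z ∈ K, ContDiffAt ℝ 1 f z) ∧
    ∃ g : Euc n → Euc n, ∀ z ∈ K, ContDiffAt ℝ 1 g (f z) ∧ g (f z) = z

/-- (B0): `b ∈ C⁴(cl X × cl Y)`. Functions on `cl X × cl Y` are represented by functions on the whole
space, of which only the values on `cl X × cl Y` matter, and which extend `b` smoothly. -/
def B0 {n : ℕ} (X Y : Set (Euc n)) (b : Euc n → Euc n → ℝ) : Prop :=
  ∀ x ∈ closure X, ∀ y ∈ closure Y, ContDiffAt ℝ 4 (Function.uncurry b) (x, y)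

/-- (B1), bi-twist. -/
def B1 {n : ℕ} (X Y : Set (Euc n)) (b : Euc n → Euc n → ℝ) : Prop :=
  (∀ x₀ ∈ closure X, IsDiffeoOntoRange (fun y => gradX b x₀ y) (closure Y)) ∧
    ∀ y₀ ∈ closure Y, IsDiffeoOntoRange (fun x => gradY b x y₀) (closure X)

/-- (B2), bi-convexity. -/
def B2 {n : ℕ} (X Y : Set (Euc n)) (b : Euc n → Euc n → ℝ) : Prop :=
  (∀ y₀ ∈ closure Y, Convex ℝ ((fun x => gradY b x y₀) '' X)) ∧
    ∀ x₀ ∈ closure X, Convex ℝ ((fun y => gradX b x₀ y) '' Y)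

/-- `t ∈ [-1, 1] ↦ (D_y b(x(t), y(0)), D_x b(x(0), y(t)))` is an affinely parameterized line segment, where
`x(t) ∈ cl X` and `y(t) ∈ cl Y`. -/
def IsSegmentPair {n : ℕ} (X Y : Set (Euc n)) (b : Euc n → Euc n → ℝ) (x y : ℝ → Euc n) : Prop :=
  (∀ t ∈ Icc (-1 : ℝ) 1, x t ∈ closure X ∧ y t ∈ closure Y) ∧
    ∃ p w q z : Euc n, ∀ t ∈ Icc (-1 : ℝ) 1,
      gradY b (x t) (y 0) = p + t • w ∧ gradX b (x 0) (y t) = q + t • z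

/-- `∂⁴/∂s²∂t² b(x(s), y(t))` at `(s, t) = (0, 0)`. -/
def crossCurvature {n : ℕ} (b : Euc n → Euc n → ℝ) (x y : ℝ → Euc n) : ℝ :=
  iteratedDeriv 2 (fun s => iteratedDeriv 2 (fun t => b (x s) (y t)) 0) 0

/-- (B3), non-negative cross-curvature. -/
def B3 {n : ℕ} (X Y : Set (Euc n)) (b : Euc n → Euc n → ℝ) : Prop :=
  ∀ x y : ℝ → Euc n, IsSegmentPair X Y b x y → 0 ≤ crossCurvature b x y

/-- (B3u), positive cross-curvature (used together with `B3`). -/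
def B3u {n : ℕ} (X Y : Set (Euc n)) (b : Euc n → Euc n → ℝ) : Prop :=
  ∀ x y : ℝ → Euc n, IsSegmentPair X Y b x y → deriv x 0 ≠ 0 → deriv y 0 ≠ 0 →
    0 < crossCurvature b x y

/-- The `b`-exponential map `y_b(x, q)`: the solution `y ∈ cl Y` of `D_x b(x, y) = q`, which under (B1) is
unique whenever `q ∈ D_x b(x, cl Y)`. -/
def bExp {n : ℕ} (Y : Set (Euc n)) (b : Euc n → Euc n → ℝ) (x q : Euc n) : Euc n :=
  Classical.epsilon fun y => y ∈ closure Y ∧ gradX b x y = q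

/-- (B3s): `q ↦ b(x₀, y_b(x, q)) - b(x, y_b(x, q))` is strictly convex on `D_x b(x, cl Y)`, for all distinct
`x, x₀ ∈ cl X` (for `x₀ = x` the function vanishes identically). -/
def B3s {n : ℕ} (X Y : Set (Euc n)) (b : Euc n → Euc n → ℝ) : Prop :=
  ∀ x ∈ closure X, ∀ x₀ ∈ closure X, x₀ ≠ x →
    StrictConvexOn ℝ ((fun y => gradX b x y) '' closure Y)
      (fun q => b x₀ (bExp Y b x q) - b x (bExp Y b x q))

/-- `v^b(x) = sup_{y ∈ cl Y} b(x, y) - v(y)`. -/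
def bTransform {n : ℕ} (Y : Set (Euc n)) (b : Euc n → Euc n → ℝ) (v : Euc n → ℝ) (x : Euc n) : ℝ :=
  ⨆ y : closure Y, (b x y - v y)

/-- `u^{b*}(y) = sup_{x ∈ cl X} b(x, y) - u(x)`. -/
def bStarTransform {n : ℕ} (X : Set (Euc n)) (b : Euc n → Euc n → ℝ) (u : Euc n → ℝ) (y : Euc n) : ℝ :=
  ⨆ x : closure X, (b x y - u x)

/-- `u : cl X → ℝ` is `b`-convex: `u = (u^{b*})^b`. The real suprema involved are finite, as `b` is bounded
and `u` has to be bounded below. -/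
def IsBConvex {n : ℕ} (X Y : Set (Euc n)) (b : Euc n → Euc n → ℝ) (u : Euc n → ℝ) : Prop :=
  BddBelow (u '' closure X) ∧
    ∀ x ∈ closure X, u x = bTransform Y b (bStarTransform X b u) x

/-- `v : cl Y → ℝ` is `b*`-convex: `v = (v^b)^{b*}`. -/
def IsBStarConvex {n : ℕ} (X Y : Set (Euc n)) (b : Euc n → Euc n → ℝ) (v : Euc n → ℝ) : Prop :=
  BddBelow (v '' closure Y) ∧
    ∀ y ∈ closure Y, v y = bStarTransform X b (bTransform Y b v) y

/-- The products `y ∈ cl Y` maximizing `b(x, y) - v(y)`: best responses of agent `x` to the price menu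
`v`. -/
def bestResponses {n : ℕ} (Y : Set (Euc n)) (b : Euc n → Euc n → ℝ) (v : Euc n → ℝ) (x : Euc n) :
    Set (Euc n) :=
  {y | y ∈ closure Y ∧ ∀ y' ∈ closure Y, b x y' - v y' ≤ b x y - v y}

/-- `v` is strictly `b*`-convex: it is `b*`-convex, and the response `y_{b,v} : cl X → cl Y` of the agents to
the price menu `v` is a well-defined continuous map. -/
def IsStrictlyBStarConvex {n : ℕ} (X Y : Set (Euc n)) (b : Euc n → Euc n → ℝ) (v : Euc n → ℝ) : Prop :=
  IsBStarConvex X Y b v ∧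
    ∃ r : Euc n → Euc n, ContinuousOn r (closure X) ∧ ∀ x ∈ closure X, bestResponses Y b v x = {r x}

/-- The hypotheses on the data `(b, c, μ)` that guarantee uniqueness of optimal strategies. -/
structure UniquenessHypotheses {n : ℕ} (X Y : Set (Euc n)) (b : Euc n → Euc n → ℝ) (c : Euc n → ℝ)
    (μ : Measure (Euc n)) : Prop where
  b0 : B0 X Y b
  b1 : B1 X Y b
  b2 : B2 X Y b
  b3 : B3 X Y b
  cost : IsBStarConvex X Y b c
  strict : IsStrictlyBStarConvex X Y b c ∨ B3u X Y b ∨ B3s X Y b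
  prob : IsProbabilityMeasure μ
  supp : μ Xᶜ = 0

/-- Lipschitz hypersurfaces of `ℝⁿ`: graphs `{w + f(w) e : w ∈ e^⊥}` of Lipschitz functions `f` over
hyperplanes `e^⊥`. -/
def IsLipschitzHypersurface {n : ℕ} (S : Set (Euc n)) : Prop :=
  ∃ (e : Euc n) (K : ℝ≥0) (f : (Submodule.span ℝ {e})ᗮ → ℝ), ‖e‖ = 1 ∧ LipschitzWith K f ∧
    S = range fun w : (Submodule.span ℝ {e})ᗮ => (w : Euc n) + f w • e

/-- `μ` vanishes on all Lipschitz hypersurfaces. -/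
def VanishesOnLipschitzHypersurfaces {n : ℕ} (μ : Measure (Euc n)) : Prop :=
  ∀ S : Set (Euc n), IsLipschitzHypersurface S → μ S = 0

/-- The subdifferential `∂u(x)`: all `q` with `u(z) ≥ u(x) + q · (z - x) + o(|z - x|)` for `z ∈ X`. -/
def subdifferential {n : ℕ} (X : Set (Euc n)) (u : Euc n → ℝ) (x : Euc n) : Set (Euc n) :=
  {q | ∀ ε : ℝ, 0 < ε → ∀ᶠ z in 𝓝[X] x, u x + inner ℝ q (z - x) - ε * ‖z - x‖ ≤ u z}

/-- The best responses of `x` to the menu `v` that yield the largest profit `v(y) - c(y)` to the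
principal. -/
def favorableResponses {n : ℕ} (Y : Set (Euc n)) (b : Euc n → Euc n → ℝ) (c v : Euc n → ℝ) (x : Euc n) :
    Set (Euc n) :=
  {y | y ∈ bestResponses Y b v x ∧ ∀ y' ∈ bestResponses Y b v x, v y' - c y' ≤ v y - c y}

/-- `q ∈ ∂u(x)` respects the tie-breaking rule: it is the marginal utility `D_x b(x, y)` of a best response
`y` of `x` to the menu `u^{b*}` that is most profitable to the principal. If `u` is `b`-convex and
differentiable at `x ∈ X`, this says `q = Du(x)`. -/
def IsTieBrokenGradient {n : ℕ} (X Y : Set (Euc n)) (b : Euc n → Euc n → ℝ) (c u : Euc n → ℝ)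
    (x q : Euc n) : Prop :=
  q ∈ subdifferential X u x ∧
    ∃ y ∈ favorableResponses Y b c (bStarTransform X b u) x, q = gradX b x y

/-- `D` is an admissible version of the gradient `Du` of a utility `u` for the data `(b, c, μ)`: it is `Du(x)`
wherever `u` is differentiable and, unless `μ` vanishes on Lipschitz hypersurfaces (so that this already
determines `D` up to a null set), it is a measurable selection of the subdifferential on `X` that
respects the tie-breaking rule. -/
structure IsGradientSelection {n : ℕ} (X Y : Set (Euc n)) (b : Euc n → Euc n → ℝ) (c : Euc n → ℝ)
    (μ : Measure (Euc n)) (u : Euc n → ℝ) (D : Euc n → Euc n) : Prop where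
  aemeasurable : AEMeasurable D μ
  eq_gradient : ∀ x ∈ X, DifferentiableAt ℝ u x → D x = gradient u x
  tie_breaking : ¬ VanishesOnLipschitzHypersurfaces μ → ∀ x ∈ X, IsTieBrokenGradient X Y b c u x (D x)

/-- The feasible strategies: `b`-convex utilities `u` above the reservation utility
`b(·, y₀) - c(y₀)` of the null product `y₀`. -/
def feasible {n : ℕ} (X Y : Set (Euc n)) (y₀ : Euc n) (b : Euc n → Euc n → ℝ) (c : Euc n → ℝ) :
    Set (Euc n → ℝ) :=
  {u | IsBConvex X Y b u ∧ ∀ x ∈ closure X, b x y₀ - c y₀ ≤ u x}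

/-- Some tie-broken gradient of `u` at `x`. -/
def tieBrokenGradient {n : ℕ} (X Y : Set (Euc n)) (b : Euc n → Euc n → ℝ) (c u : Euc n → ℝ)
    (x : Euc n) : Euc n :=
  Classical.epsilon (IsTieBrokenGradient X Y b c u x)

/-- The principal's net losses
`L(u) = ∫_X [u(x) + c(y_b(x, Du(x))) - b(x, y_b(x, Du(x)))] dμ(x)`.
The integrand does not depend on the choice of a tie-broken gradient: it is
`u(x) + c(y) - b(x, y) = c(y) - u^{b*}(y)` for every most profitable best response `y`. -/
def netLoss {n : ℕ} (X Y : Set (Euc n)) (b : Euc n → Euc n → ℝ) (c : Euc n → ℝ) (μ : Measure (Euc n))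
    (u : Euc n → ℝ) : ℝ :=
  ∫ x in X, (u x + c (bExp Y b x (tieBrokenGradient X Y b c u x))
    - b x (bExp Y b x (tieBrokenGradient X Y b c u x))) ∂μ

/-- `u` minimizes the net losses of the principal among all feasible strategies. -/
def IsOptimal {n : ℕ} (X Y : Set (Euc n)) (y₀ : Euc n) (b : Euc n → Euc n → ℝ) (c : Euc n → ℝ)
    (μ : Measure (Euc n)) (u : Euc n → ℝ) : Prop :=
  u ∈ feasible X Y y₀ b c ∧ IsMinOn (netLoss X Y b c μ) (feasible X Y y₀ b c) u

/-- `b_i → b` in `C²(cl X × cl Y)`. -/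
def TendstoC2 {n : ℕ} (X Y : Set (Euc n)) (b : ℕ → Euc n → Euc n → ℝ) (b' : Euc n → Euc n → ℝ) : Prop :=
  ∀ k : ℕ, k ≤ 2 →
    TendstoUniformlyOn (fun i => iteratedFDeriv ℝ k (Function.uncurry (b i)))
      (iteratedFDeriv ℝ k (Function.uncurry b')) atTop (closure X ×ˢ closure Y)

/-- Weak-`*` convergence of Borel measures on the compact set `K`. -/
def WeakStarTendsto {n : ℕ} (K : Set (Euc n)) (μ : ℕ → Measure (Euc n)) (μ' : Measure (Euc n)) : Prop :=
  ∀ g : Euc n → ℝ, ContinuousOn g K →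
    Tendsto (fun i => ∫ x in K, g x ∂(μ i)) atTop (𝓝 (∫ x in K, g x ∂μ'))

end

end PrincipalAgent

/-!
Stability follows from compactness together with uniqueness in the limit: optimal strategies for
`(b_i, c_i, μ_i)` converge uniformly along a subsequence to an optimal strategy for the limit data
(`ConvergentData.exists_subseq`), which is determined `μ_∞`-almost everywhere.

*Uniqueness.* Non-negative cross-curvature (B3) makes valuation differences `b(x₀, ·) - b(x, ·)`
convex as functions of the marginal utility `D_x b(x, ·)` (`valuation_diff_midpoint_le`): the second
`y`-derivatives `D²_{yy} b` are convex functions of `D_y b` (`hessY_le`), and if `t ↦ y(t)` is a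
segment as seen from `x`, then the first-order variation of `∂_t² b(·, y(t))` vanishes at `x`.
So averages of `b`-convex functions are `b`-convex, and the strictness hypothesis makes production cost minus valuation strictly convex
in the marginal utility. The average of two optimal strategies would therefore be strictly better
unless they induce the same choices (`UniquenessHypotheses.ae_agentChoice_eq`). Equal choices force
equal prices, since the principal could charge the maximum of the two prices and would still sell
the same products (`UniquenessHypotheses.ae_price_le`). Strict convexity is needed only for agents
with a single best response to the cost `c`, and this is the case almost everywhere. The reason is
`measure_nonunique_eq_zero`: in a `b`-monotone relation, the agents related to several products lie
on countably many Lipschitz hypersurfaces.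

*Limits.* The choices of the agents are neither continuous nor convergent a priori. For a conjugate
pair `(u, v)`, the function `x ↦ max_y (f(y) - k (u(x) + v(y) - b(x, y)))` is continuous, bounds
`f` at the best responses of `x` from above, and tends to the largest such value as `k → ∞`.
Weak convergence of the `μ_i` applies to it, which gives convergence of
`∫ f(G_i) dμ_i` whenever best responses are almost everywhere unique in the limit
(`IsConjugatePair.tendsto_integral`). This yields the continuity of the net losses, hence the
optimality of limits, and also the convergence of the measures `(G_i)_# μ_i`.

*Pointwise convergence of the choices.* Different subsequences of the `u_i` could converge to
different optimal strategies, all of which agree almost everywhere. As they are continuous, one null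
set works for all of them (`UniquenessHypotheses.ae_forall_eq`). Off this null set the best
responses to all optimal strategies form one `b`-monotone relation, so that the limit points of
`G_i(x)`, being such best responses, almost everywhere coincide with `G_∞(x)`.
-/

namespace PrincipalAgent

/-! ### Transforms and conjugate pairs -/

section Transforms

variable {n : ℕ} {X Y : Set (Euc n)} {b : Euc n → Euc n → ℝ} {u v : Euc n → ℝ}

theorem continuousOn_uncurry_flip {A B : Set (Euc n)}
    (hb : ContinuousOn (Function.uncurry b) (A ×ˢ B)) :
    ContinuousOn (Function.uncurry fun y x => b x y) (B ×ˢ A) := by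
  have : (Function.uncurry fun y x => b x y) = Function.uncurry b ∘ Prod.swap := by
    ext ⟨y, x⟩; rfl
  rw [this]
  exact hb.comp continuous_swap.continuousOn fun p hp => ⟨hp.2, hp.1⟩

theorem continuousOn_section_right {A B : Set (Euc n)}
    (hb : ContinuousOn (Function.uncurry b) (A ×ˢ B)) {x : Euc n} (hx : x ∈ A) :
    ContinuousOn (b x) B :=
  hb.comp (f := fun y => (x, y)) (by fun_prop) fun _ hy => ⟨hx, hy⟩

theorem continuousOn_section_left {A B : Set (Euc n)}
    (hb : ContinuousOn (Function.uncurry b) (A ×ˢ B)) {y : Euc n} (hy : y ∈ B) :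
    ContinuousOn (fun x => b x y) A :=
  hb.comp (f := fun x => (x, y)) (by fun_prop) fun _ hx => ⟨hx, hy⟩

theorem exists_abs_le {A B : Set (Euc n)} (hA : IsCompact A) (hB : IsCompact B)
    (hb : ContinuousOn (Function.uncurry b) (A ×ˢ B)) :
    ∃ M, 0 ≤ M ∧ ∀ x ∈ A, ∀ y ∈ B, |b x y| ≤ M := by
  obtain ⟨M, hM⟩ := (hA.prod hB).exists_bound_of_continuousOn hb
  exact ⟨max M 0, le_max_right _ _, fun x hx y hy => (hM (x, y) ⟨hx, hy⟩).trans (le_max_left _ _)⟩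

theorem exists_modulus {A B : Set (Euc n)} (hA : IsCompact A) (hB : IsCompact B)
    (hb : ContinuousOn (Function.uncurry b) (A ×ˢ B)) {ε : ℝ} (hε : 0 < ε) :
    ∃ δ > 0, ∀ x ∈ A, ∀ x' ∈ A, dist x x' < δ → ∀ y ∈ B, |b x y - b x' y| < ε := by
  obtain ⟨δ, hδ, h⟩ := Metric.uniformContinuousOn_iff.1
    ((hA.prod hB).uniformContinuousOn_of_continuous hb) ε hε
  refine ⟨δ, hδ, fun x hx x' hx' hd y hy => ?_⟩
  have := h (x, y) ⟨hx, hy⟩ (x', y) ⟨hx', hy⟩ (by simp [Prod.dist_eq, hd])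
  simpa [Real.dist_eq] using this

/-- A function whose increments are controlled by those of a continuous kernel on a compact set
is continuous. -/
theorem continuousOn_of_modulus {A B : Set (Euc n)} (hA : IsCompact A) (hB : IsCompact B)
    (hb : ContinuousOn (Function.uncurry b) (A ×ˢ B)) {f : Euc n → ℝ}
    (h : ∀ ε, ∀ x ∈ A, ∀ x' ∈ A, (∀ y ∈ B, |b x y - b x' y| ≤ ε) → f x ≤ f x' + ε) :
    ContinuousOn f A := by
  intro x hx
  rw [ContinuousWithinAt, Metric.tendsto_nhds]
  intro ε hε
  obtain ⟨δ, hδ, hd⟩ := exists_modulus hA hB hb (half_pos hε)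
  filter_upwards [self_mem_nhdsWithin, mem_nhdsWithin_of_mem_nhds (Metric.ball_mem_nhds x hδ)]
    with z hz hzx
  have h1 := h (ε / 2) z hz x hx fun y hy => (hd z hz x hx hzx y hy).le
  have h2 := h (ε / 2) x hx z hz fun y hy => (hd x hx z hz (by rwa [dist_comm]) y hy).le
  rw [Real.dist_eq, abs_lt]
  constructor <;> linarith

theorem bddAbove_range_sub (hbv : ∃ M, ∀ y ∈ closure Y, ∀ x ∈ closure X, |b x y| ≤ M)
    (hv : BddBelow (v '' closure Y)) {x : Euc n} (hx : x ∈ closure X) :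
    BddAbove (range fun y : closure Y => b x y - v y) := by
  obtain ⟨M, hM⟩ := hbv
  obtain ⟨m, hm⟩ := hv
  refine ⟨M - m, ?_⟩
  rintro _ ⟨⟨y, hy⟩, rfl⟩
  have h1 := (abs_le.1 (hM y hy x hx)).2
  have h2 := hm ⟨y, hy, rfl⟩
  simp only
  linarith

variable (hX : IsCompact (closure X)) (hY : IsCompact (closure Y))
  (hb : ContinuousOn (Function.uncurry b) (closure X ×ˢ closure Y))

include hX hY hb in
theorem sub_le_bTransform (hv : BddBelow (v '' closure Y)) {x y : Euc n} (hx : x ∈ closure X)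
    (hy : y ∈ closure Y) : b x y - v y ≤ bTransform Y b v x := by
  obtain ⟨M, -, hM⟩ := exists_abs_le hX hY hb
  exact le_ciSup (bddAbove_range_sub ⟨M, fun y hy x hx => hM x hx y hy⟩ hv hx) ⟨y, hy⟩

theorem bTransform_le (hYn : (closure Y).Nonempty) {x : Euc n} {a : ℝ}
    (h : ∀ y ∈ closure Y, b x y - v y ≤ a) : bTransform Y b v x ≤ a := by
  have : Nonempty (closure Y) := hYn.to_subtype
  exact ciSup_le fun y => h y y.2

include hX hY hb in
/-- A uniform error between two kernels, price menus or agents carries over to the transforms. -/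
theorem bTransform_le_add (hYn : (closure Y).Nonempty) (hv : BddBelow (v '' closure Y))
    {b' : Euc n → Euc n → ℝ} {v' : Euc n → ℝ} {x x' : Euc n} (hx : x ∈ closure X) {ε : ℝ}
    (h : ∀ y ∈ closure Y, b' x' y - v' y ≤ b x y - v y + ε) :
    bTransform Y b' v' x' ≤ bTransform Y b v x + ε :=
  bTransform_le hYn fun y hy => (h y hy).trans
    (by have := sub_le_bTransform hX hY hb hv hx hy; linarith)

include hX hY hb in
theorem continuousOn_bTransform (hYn : (closure Y).Nonempty) (hv : BddBelow (v '' closure Y)) :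
    ContinuousOn (bTransform Y b v) (closure X) :=
  continuousOn_of_modulus hX hY hb fun ε x _ x' hx' h =>
    bTransform_le_add hX hY hb hYn hv hx' fun y hy => by
      have := (abs_le.1 (h y hy)).2
      linarith

include hX hY hb in
theorem exists_eq_bTransform (hYn : (closure Y).Nonempty) (hv : ContinuousOn v (closure Y))
    {x : Euc n} (hx : x ∈ closure X) :
    ∃ y ∈ closure Y, bTransform Y b v x + v y = b x y := by
  obtain ⟨y, hy, hmax⟩ := hY.exists_isMaxOn hYn ((continuousOn_section_right hb hx).sub hv)
  refine ⟨y, hy, ?_⟩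
  have h1 := sub_le_bTransform hX hY hb (hY.bddBelow_image hv) hx hy
  have h2 : bTransform Y b v x ≤ b x y - v y := bTransform_le hYn fun y' hy' => hmax hy'
  linarith

/-- `u` and `v` are conjugate for the kernel `b`: each is the transform of the other, all suprema
being attained. -/
structure IsConjugatePair {n : ℕ} (X Y : Set (Euc n)) (b : Euc n → Euc n → ℝ) (u v : Euc n → ℝ) :
    Prop where
  le : ∀ x ∈ closure X, ∀ y ∈ closure Y, b x y ≤ u x + v y
  left : ∀ x ∈ closure X, ∃ y ∈ closure Y, u x + v y = b x y
  right : ∀ y ∈ closure Y, ∃ x ∈ closure X, u x + v y = b x y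

theorem IsConjugatePair.flip (h : IsConjugatePair X Y b u v) :
    IsConjugatePair Y X (fun y x => b x y) v u :=
  ⟨fun y hy x hx => by linarith [h.le x hx y hy],
    fun y hy => by obtain ⟨x, hx, e⟩ := h.right y hy; exact ⟨x, hx, by linarith⟩,
    fun x hx => by obtain ⟨y, hy, e⟩ := h.left x hx; exact ⟨y, hy, by linarith⟩⟩

/-- The increments of `u` are controlled by those of the kernel. -/
theorem IsConjugatePair.le_add (h : IsConjugatePair X Y b u v) {ε : ℝ} {x x' : Euc n}
    (hx : x ∈ closure X) (hx' : x' ∈ closure X) (he : ∀ y ∈ closure Y, |b x y - b x' y| ≤ ε) :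
    u x ≤ u x' + ε := by
  obtain ⟨y, hy, e⟩ := h.left x hx
  have := h.le x' hx' y hy
  have := (abs_le.1 (he y hy)).2
  linarith

include hX hY hb in
theorem IsConjugatePair.continuousOn_left (h : IsConjugatePair X Y b u v) :
    ContinuousOn u (closure X) :=
  continuousOn_of_modulus hX hY hb fun _ _ hx _ hx' he => h.le_add hx hx' he

include hX hY hb in
theorem IsConjugatePair.continuousOn_right (h : IsConjugatePair X Y b u v) :
    ContinuousOn v (closure Y) :=
  h.flip.continuousOn_left hY hX (continuousOn_uncurry_flip hb)

include hX hY hb in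
theorem IsConjugatePair.bTransform_eq (h : IsConjugatePair X Y b u v) {x : Euc n}
    (hx : x ∈ closure X) : bTransform Y b v x = u x := by
  obtain ⟨y, hy, e⟩ := h.left x hx
  refine le_antisymm (bTransform_le ⟨y, hy⟩ fun y' hy' => by linarith [h.le x hx y' hy']) ?_
  have := sub_le_bTransform hX hY hb (hY.bddBelow_image (h.continuousOn_right hX hY hb)) hx hy
  linarith

include hX hY hb in
theorem IsConjugatePair.bStarTransform_eq (h : IsConjugatePair X Y b u v) {y : Euc n}
    (hy : y ∈ closure Y) : bStarTransform X b u y = v y :=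
  h.flip.bTransform_eq hY hX (continuousOn_uncurry_flip hb) hy

theorem bTransform_congr {v' : Euc n → ℝ} (h : ∀ y ∈ closure Y, v y = v' y) (x : Euc n) :
    bTransform Y b v x = bTransform Y b v' x := by
  unfold bTransform
  congr 1
  ext y
  rw [h y y.2]

include hX hY hb in
theorem IsConjugatePair.isBConvex (h : IsConjugatePair X Y b u v) : IsBConvex X Y b u := by
  refine ⟨hX.bddBelow_image (h.continuousOn_left hX hY hb), fun x hx => ?_⟩
  rw [bTransform_congr fun y hy => h.bStarTransform_eq hX hY hb hy, h.bTransform_eq hX hY hb hx]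

include hX hY hb in
theorem IsBConvex.isConjugatePair (h : IsBConvex X Y b u) (hXn : (closure X).Nonempty)
    (hYn : (closure Y).Nonempty) : IsConjugatePair X Y b u (bStarTransform X b u) := by
  have hb' := continuousOn_uncurry_flip hb
  have hv : ContinuousOn (bStarTransform X b u) (closure Y) :=
    continuousOn_bTransform hY hX hb' hXn h.1
  have hu : ContinuousOn u (closure X) :=
    (continuousOn_bTransform hX hY hb hYn (hY.bddBelow_image hv)).congr h.2
  refine ⟨fun x hx y hy => ?_, fun x hx => ?_, fun y hy => ?_⟩
  · have : b x y - u x ≤ bStarTransform X b u y := sub_le_bTransform hY hX hb' h.1 hy hx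
    linarith
  · rw [h.2 x hx]
    exact exists_eq_bTransform hX hY hb hYn hv hx
  · obtain ⟨x, hx, e⟩ := exists_eq_bTransform hY hX hb' hXn hu hy
    exact ⟨x, hx, by rw [add_comm]; exact e⟩

include hX hY hb in
theorem IsBStarConvex.isConjugatePair (h : IsBStarConvex X Y b v) (hXn : (closure X).Nonempty)
    (hYn : (closure Y).Nonempty) : IsConjugatePair X Y b (bTransform Y b v) v :=
  (IsBConvex.isConjugatePair (X := Y) (Y := X) (u := v) hY hX (continuousOn_uncurry_flip hb) h
    hYn hXn).flip

include hX hY hb in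
/-- The transform of a continuous price menu `v`, together with its own transform. The latter is
at most `v`, and does not differ from `v` at best responses. -/
theorem isConjugatePair_bTransform (hv : ContinuousOn v (closure Y)) (hXn : (closure X).Nonempty)
    (hYn : (closure Y).Nonempty) :
    IsConjugatePair X Y b (bTransform Y b v) (bStarTransform X b (bTransform Y b v)) ∧
      (∀ y ∈ closure Y, bStarTransform X b (bTransform Y b v) y ≤ v y) ∧
      ∀ x ∈ closure X, ∀ y ∈ closure Y, bTransform Y b v x + v y = b x y →
        bStarTransform X b (bTransform Y b v) y = v y := by
  have hb' := continuousOn_uncurry_flip hb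
  have hvb := hY.bddBelow_image hv
  have hu : ContinuousOn (bTransform Y b v) (closure X) :=
    continuousOn_bTransform hX hY hb hYn hvb
  have hle : ∀ x ∈ closure X, ∀ y ∈ closure Y,
      b x y ≤ bTransform Y b v x + bStarTransform X b (bTransform Y b v) y := by
    intro x hx y hy
    have : b x y - bTransform Y b v x ≤ bStarTransform X b (bTransform Y b v) y :=
      sub_le_bTransform hY hX hb' (hX.bddBelow_image hu) hy hx
    linarith
  have hle' : ∀ y ∈ closure Y, bStarTransform X b (bTransform Y b v) y ≤ v y := fun y hy =>
    bTransform_le (Y := X) (b := fun y x => b x y) hXn fun x hx => by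
      have := sub_le_bTransform hX hY hb hvb hx hy
      linarith
  have heq : ∀ x ∈ closure X, ∀ y ∈ closure Y, bTransform Y b v x + v y = b x y →
      bStarTransform X b (bTransform Y b v) y = v y := fun x hx y hy e =>
    le_antisymm (hle' y hy) (by linarith [hle x hx y hy])
  refine ⟨⟨hle, fun x hx => ?_, fun y hy => ?_⟩, hle', heq⟩
  · obtain ⟨y, hy, e⟩ := exists_eq_bTransform hX hY hb hYn hv hx
    exact ⟨y, hy, by rw [heq x hx y hy e, e]⟩
  · obtain ⟨x, hx, e⟩ := exists_eq_bTransform hY hX hb' hXn hu hy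
    exact ⟨x, hx, by rw [add_comm]; exact e⟩

theorem IsConjugatePair.mem_bestResponses (h : IsConjugatePair X Y b u v) {x y : Euc n}
    (hx : x ∈ closure X) :
    y ∈ bestResponses Y b v x ↔ y ∈ closure Y ∧ u x + v y = b x y := by
  constructor
  · rintro ⟨hy, hm⟩
    obtain ⟨y', hy', e⟩ := h.left x hx
    exact ⟨hy, by linarith [hm y' hy', h.le x hx y hy]⟩
  · rintro ⟨hy, e⟩
    exact ⟨hy, fun y' hy' => by linarith [h.le x hx y' hy']⟩

end Transforms

/-! ### Lipschitz hypersurfaces and uniqueness of best responses -/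

section Hypersurfaces

variable {n : ℕ} {X Y : Set (Euc n)} {b : Euc n → Euc n → ℝ} {u v : Euc n → ℝ}

theorem inner_gradX {x y : Euc n} (h : DifferentiableAt ℝ (Function.uncurry b) (x, y))
    (w : Euc n) : inner ℝ (gradX b x y) w = fderiv ℝ (Function.uncurry b) (x, y) (w, 0) := by
  have h1 : HasFDerivAt (fun x' : Euc n => (x', y))
      (ContinuousLinearMap.inl ℝ (Euc n) (Euc n)) x := hasFDerivAt_prodMk_left x y
  have h2 : HasFDerivAt (fun x' => b x' y)
      ((fderiv ℝ (Function.uncurry b) (x, y)).comp (ContinuousLinearMap.inl ℝ (Euc n) (Euc n))) x :=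
    HasFDerivAt.comp x (g := Function.uncurry b) h.hasFDerivAt h1
  rw [gradX, gradient, InnerProductSpace.toDual_symm_apply, h2.fderiv]
  simp

/-- A set inside which all directions make a large angle with `e` lies on a Lipschitz graph over
the hyperplane orthogonal to `e`. -/
theorem exists_hypersurface_of_cone {A : Set (Euc n)} {e : Euc n} (he : ‖e‖ = 1)
    (hA : ∀ z ∈ A, ∀ ζ ∈ A, |inner ℝ e (z - ζ)| ≤ 1 / 2 * ‖z - ζ‖) :
    ∃ S, IsLipschitzHypersurface S ∧ A ⊆ S := by
  classical
  have hmem : ∀ z : Euc n, z - inner ℝ e z • e ∈ (Submodule.span ℝ {e})ᗮ := by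
    intro z
    rw [Submodule.mem_orthogonal_singleton_iff_inner_right, inner_sub_right, inner_smul_right,
      real_inner_self_eq_norm_sq, he]
    ring
  let P : Euc n → (Submodule.span ℝ {e})ᗮ := fun z => ⟨z - inner ℝ e z • e, hmem z⟩
  have hP : ∀ z ∈ A, ∀ ζ ∈ A, |inner ℝ e z - inner ℝ e ζ| ≤ dist (P z) (P ζ) := by
    intro z hz ζ hζ
    have h1 := hA z hz ζ hζ
    rw [← inner_sub_right]
    have h2 : dist (P z) (P ζ) = ‖(z - ζ) - inner ℝ e (z - ζ) • e‖ := by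
      rw [Subtype.dist_eq, dist_eq_norm, inner_sub_right, sub_smul]
      congr 1
      simp only [P]
      abel
    have h3 : ‖(z - ζ) - inner ℝ e (z - ζ) • e‖ ^ 2 = ‖z - ζ‖ ^ 2 - inner ℝ e (z - ζ) ^ 2 := by
      rw [norm_sub_sq_real, inner_smul_right, real_inner_comm, norm_smul, he, mul_one,
        Real.norm_eq_abs, sq_abs]
      ring
    rw [h2]
    refine abs_le_of_sq_le_sq ?_ (norm_nonneg _)
    rw [h3]
    have h4 : inner ℝ e (z - ζ) ^ 2 ≤ (1 / 2 * ‖z - ζ‖) ^ 2 := by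
      rw [← sq_abs]
      gcongr
    nlinarith [sq_nonneg ‖z - ζ‖]
  have hinv : ∀ w ∈ P '' A, Function.invFunOn P A w ∈ A ∧ P (Function.invFunOn P A w) = w :=
    fun w hw => ⟨Function.invFunOn_mem hw, Function.invFunOn_eq hw⟩
  have hlip : LipschitzOnWith 1 (fun w => inner ℝ e (Function.invFunOn P A w)) (P '' A) := by
    refine LipschitzOnWith.of_dist_le_mul fun w hw w' hw' => ?_
    have := hP _ (hinv w hw).1 _ (hinv w' hw').1
    rw [(hinv w hw).2, (hinv w' hw').2] at this
    simpa [Real.dist_eq] using this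
  obtain ⟨g, hg, hgs⟩ := hlip.extend_real
  refine ⟨_, ⟨e, 1, g, he, hg, rfl⟩, fun z hz => ⟨P z, ?_⟩⟩
  have hPz : P z ∈ P '' A := ⟨z, hz, rfl⟩
  have h1 : g (P z) = inner ℝ e z := by
    rw [← hgs hPz]
    have := hP _ (hinv _ hPz).1 z hz
    rw [(hinv _ hPz).2, dist_self] at this
    have := abs_nonpos_iff.1 this
    simp only
    linarith
  simp only [h1, P]
  abel

/-- `D_x b(x, y)` linearizes `b` in its first argument, locally uniformly in the second one. -/
theorem eventually_linearization {x y : Euc n} (h : ContDiffAt ℝ 1 (Function.uncurry b) (x, y))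
    {ε : ℝ} (hε : 0 < ε) : ∃ U ∈ 𝓝 x, ∃ V ∈ 𝓝 y, ∀ z ∈ U, ∀ ζ ∈ U, ∀ η ∈ V,
      |b z η - b ζ η - inner ℝ (gradX b x y) (z - ζ)| ≤ ε * ‖z - ζ‖ := by
  have h1 := (h.hasStrictFDerivAt one_ne_zero).isLittleO.def hε
  rw [nhds_prod_eq] at h1
  obtain ⟨W, hW, hWW⟩ := (eventually_prod_self_iff
    (r := fun (p q : Euc n × Euc n) => ‖Function.uncurry b p -
    Function.uncurry b q - fderiv ℝ (Function.uncurry b) (x, y) (p - q)‖ ≤ ε * ‖p - q‖)).1 h1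
  rw [nhds_prod_eq] at hW
  obtain ⟨U, hU, V, hV, hUV⟩ := Filter.mem_prod_iff.1 hW
  refine ⟨U, hU, V, hV, fun z hz ζ hζ η hη => ?_⟩
  have := hWW (z, η) (hUV ⟨hz, hη⟩) (ζ, η) (hUV ⟨hζ, hη⟩)
  rw [inner_gradX (h.differentiableAt one_ne_zero)]
  simpa [Function.uncurry, Prod.norm_def] using this

/-- Let `R` relate agents to products in such a way that no two agents gain in total by exchanging
their products. Then the agents related to more than one product lie on countably many
Lipschitz hypersurfaces: near such an agent two distinct marginal utilities `p ≠ p'` confine the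
agents with the same two kinds of products to directions almost orthogonal to `p' - p`. -/
theorem exists_countable_cover_of_monotone
    (hb : ∀ x ∈ X, ∀ y ∈ closure Y, ContDiffAt ℝ 1 (Function.uncurry b) (x, y))
    (hinj : ∀ x ∈ X, InjOn (fun y => gradX b x y) (closure Y)) {R : Set (Euc n × Euc n)}
    (hR : ∀ p ∈ R, p.1 ∈ X ∧ p.2 ∈ closure Y)
    (hmono : ∀ p ∈ R, ∀ p' ∈ R, b p.1 p'.2 + b p'.1 p.2 ≤ b p.1 p.2 + b p'.1 p'.2) :
    ∃ 𝒮 : Set (Set (Euc n)), 𝒮.Countable ∧ (∀ S ∈ 𝒮, IsLipschitzHypersurface S) ∧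
      {x | ∃ y y', (x, y) ∈ R ∧ (x, y') ∈ R ∧ y ≠ y'} ⊆ ⋃₀ 𝒮 := by
  let T : Set (Euc n × Euc n × Euc n) :=
    {t | (t.1, t.2.1) ∈ R ∧ (t.1, t.2.2) ∈ R ∧ t.2.1 ≠ t.2.2}
  have key : ∀ t ∈ T, ∃ W ∈ 𝓝 t, ∃ S, IsLipschitzHypersurface S ∧
      ∀ t' ∈ W, t' ∈ T → t'.1 ∈ S := by
    rintro ⟨x, y, y'⟩ ⟨hy, hy', hne⟩
    have hx := (hR _ hy).1
    have hyY := (hR _ hy).2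
    have hyY' := (hR _ hy').2
    simp only at hx hyY hyY' hne hy hy'
    set p := gradX b x y
    set p' := gradX b x y'
    have hpp : p' - p ≠ 0 := fun h => hne (hinj x hx hyY hyY' (sub_eq_zero.1 h).symm)
    have hpos : 0 < ‖p' - p‖ := norm_pos_iff.2 hpp
    obtain ⟨U, hU, V, hV, h1⟩ := eventually_linearization (hb x hx y hyY)
      (ε := ‖p' - p‖ / 4) (by positivity)
    obtain ⟨U', hU', V', hV', h2⟩ := eventually_linearization (hb x hx y' hyY')
      (ε := ‖p' - p‖ / 4) (by positivity)
    let A : Set (Euc n) :=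
      {z | z ∈ U ∩ U' ∧ ∃ η ∈ V, ∃ η' ∈ V', (z, η) ∈ R ∧ (z, η') ∈ R}
    -- add the linearizations at `y` and `y'` to the inequality of monotonicity between the pairs
    -- `(z, η)` and `(ζ, η')`
    have hone : ∀ z ∈ A, ∀ ζ ∈ A, inner ℝ (p' - p) (z - ζ) ≤ ‖p' - p‖ / 2 * ‖z - ζ‖ := by
      rintro z ⟨⟨hzU, hzU'⟩, η, hη, -, -, hzη, -⟩ ζ ⟨⟨hζU, hζU'⟩, -, -, η', hη', -, hζη'⟩
      have e1 := abs_le.1 (h1 z hzU ζ hζU η hη)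
      have e2 := abs_le.1 (h2 z hzU' ζ hζU' η' hη')
      have e3 := hmono _ hzη _ hζη'
      simp only at e3
      rw [inner_sub_left]
      simp only [p, p'] at *
      linarith [e1.1, e1.2, e2.1, e2.2]
    have habs : ∀ z ∈ A, ∀ ζ ∈ A, |inner ℝ (‖p' - p‖⁻¹ • (p' - p)) (z - ζ)| ≤
        1 / 2 * ‖z - ζ‖ := by
      intro z hz ζ hζ
      have e1 := hone z hz ζ hζ
      have e2 := hone ζ hζ z hz
      rw [← neg_sub z ζ, inner_neg_right, norm_neg] at e2
      rw [real_inner_smul_left, abs_mul, abs_of_pos (inv_pos.2 hpos)]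
      have e3 : |inner ℝ (p' - p) (z - ζ)| ≤ ‖p' - p‖ / 2 * ‖z - ζ‖ :=
        abs_le.2 ⟨by linarith, e1⟩
      calc ‖p' - p‖⁻¹ * |inner ℝ (p' - p) (z - ζ)|
          ≤ ‖p' - p‖⁻¹ * (‖p' - p‖ / 2 * ‖z - ζ‖) := by gcongr
        _ = 1 / 2 * ‖z - ζ‖ := by field_simp
    obtain ⟨S, hS, hAS⟩ := exists_hypersurface_of_cone (by
      rw [norm_smul, norm_inv, norm_norm, inv_mul_cancel₀ hpos.ne']) habs
    refine ⟨(U ∩ U') ×ˢ (V ×ˢ V'), prod_mem_nhds (inter_mem hU hU') (prod_mem_nhds hV hV'),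
      S, hS, ?_⟩
    rintro ⟨z, η, η'⟩ ⟨hz, hη, hη'⟩ ⟨g1, g2, -⟩
    exact hAS ⟨hz, η, hη, η', hη', g1, g2⟩
  choose! W hW S hS hWS using key
  obtain ⟨t, htT, htc, hcov⟩ := TopologicalSpace.countable_cover_nhdsWithin
    (f := W) (s := T) fun t ht => mem_nhdsWithin_of_mem_nhds (hW t ht)
  refine ⟨S '' t, htc.image S, ?_, ?_⟩
  · rintro _ ⟨s, hs, rfl⟩
    exact hS s (htT hs)
  · rintro x ⟨y, y', hy, hy', hne⟩
    have hx : (x, y, y') ∈ T := ⟨hy, hy', hne⟩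
    obtain ⟨s, hs, hxs⟩ := mem_iUnion₂.1 (hcov hx)
    exact ⟨S s, ⟨s, hs, rfl⟩, hWS s (htT hs) _ hxs hx⟩

/-- A `b`-monotone relation assigns at most one product to almost every agent. Besides the best
responses to one menu, this covers the best responses to several menus whose utilities agree. -/
theorem measure_nonunique_eq_zero
    (hb : ∀ x ∈ X, ∀ y ∈ closure Y, ContDiffAt ℝ 1 (Function.uncurry b) (x, y))
    (hinj : ∀ x ∈ X, InjOn (fun y => gradX b x y) (closure Y)) {R : Set (Euc n × Euc n)}
    (hR : ∀ p ∈ R, p.1 ∈ X ∧ p.2 ∈ closure Y)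
    (hmono : ∀ p ∈ R, ∀ p' ∈ R, b p.1 p'.2 + b p'.1 p.2 ≤ b p.1 p.2 + b p'.1 p'.2)
    {μ : Measure (Euc n)} (hμ : VanishesOnLipschitzHypersurfaces μ) :
    ∀ᵐ x ∂μ, ∀ y y', (x, y) ∈ R → (x, y') ∈ R → y = y' := by
  obtain ⟨𝒮, hc, h𝒮, hcov⟩ := exists_countable_cover_of_monotone hb hinj hR hmono
  have h0 : μ (⋃₀ 𝒮) = 0 := (measure_sUnion_null_iff hc).2 fun S hS => hμ S (h𝒮 S hS)
  refine measure_mono_null (fun x hx => hcov ?_) h0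
  simp only [mem_compl_iff, mem_ofPred_eq, not_forall] at hx
  obtain ⟨y, y', h1, h2, h3⟩ := hx
  exact ⟨y, y', h1, h2, h3⟩

/-- The utilities of a conjugate pair give almost every agent only one best response. -/
theorem IsConjugatePair.ae_unique (h : IsConjugatePair X Y b u v)
    (hb : ∀ x ∈ X, ∀ y ∈ closure Y, ContDiffAt ℝ 1 (Function.uncurry b) (x, y))
    (hinj : ∀ x ∈ X, InjOn (fun y => gradX b x y) (closure Y))
    {μ : Measure (Euc n)} (hμ : VanishesOnLipschitzHypersurfaces μ) :
    ∀ᵐ x ∂μ, x ∈ X → ∀ y ∈ closure Y, ∀ y' ∈ closure Y,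
      u x + v y = b x y → u x + v y' = b x y' → y = y' := by
  have := measure_nonunique_eq_zero hb hinj
    (R := {p | p.1 ∈ X ∧ p.2 ∈ closure Y ∧ u p.1 + v p.2 = b p.1 p.2})
    (fun p hp => ⟨hp.1, hp.2.1⟩) (fun p hp p' hp' => by
      have h1 := h.le p.1 (subset_closure hp.1) p'.2 hp'.2.1
      have h2 := h.le p'.1 (subset_closure hp'.1) p.2 hp.2.1
      linarith [hp.2.2, hp'.2.2]) hμ
  filter_upwards [this] with x hx hxX y hy y' hy' e e'
  exact hx y y' ⟨hxX, hy, e⟩ ⟨hxX, hy', e'⟩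

/-- A unique best response makes the utility differentiable, with gradient `D_x b(x, y)`. -/
theorem IsConjugatePair.hasGradientAt (h : IsConjugatePair X Y b u v) (hXo : IsOpen X)
    (hX : IsCompact (closure X)) (hY : IsCompact (closure Y))
    (hbc : ContinuousOn (Function.uncurry b) (closure X ×ˢ closure Y)) {x y : Euc n} (hx : x ∈ X)
    (hb : ContDiffAt ℝ 1 (Function.uncurry b) (x, y)) (hy : y ∈ closure Y)
    (he : u x + v y = b x y)
    (huniq : ∀ y' ∈ closure Y, u x + v y' = b x y' → y' = y) :
    HasGradientAt u (gradX b x y) x := by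
  rw [hasGradientAt_iff_hasFDerivAt, hasFDerivAt_iff_isLittleO, Asymptotics.isLittleO_iff]
  intro ε hε
  obtain ⟨U, hU, V, hV, hlin⟩ := eventually_linearization hb hε
  have huc := h.continuousOn_left hX hY hbc
  have hvc := h.continuousOn_right hX hY hbc
  have hVx : ∀ᶠ z in 𝓝 x, ∀ η ∈ closure Y, u z + v η = b z η → η ∈ V := by
    -- away from `V` the slack `u x + v η - b x η` is bounded below
    have hK : IsCompact (closure Y \ interior V) := hY.diff isOpen_interior
    rcases (closure Y \ interior V).eq_empty_or_nonempty with hemp | hne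
    · refine Eventually.of_forall fun z η hη _ => interior_subset ?_
      by_contra hcon
      exact (hemp ▸ (⟨hη, hcon⟩ : η ∈ closure Y \ interior V) : η ∈ (∅ : Set (Euc n)))
    have hsl : ContinuousOn (fun η => u x + v η - b x η) (closure Y \ interior V) :=
      ((continuousOn_const.add hvc).sub (continuousOn_section_right hbc (subset_closure hx))).mono
        sdiff_subset
    obtain ⟨η₀, hη₀, hmin⟩ := hK.exists_isMinOn hne hsl
    have hpos : 0 < u x + v η₀ - b x η₀ := by
      rcases (sub_nonneg.2 (h.le x (subset_closure hx) η₀ hη₀.1)).lt_or_eq with hlt | heq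
      · exact hlt
      · exact absurd (by rw [huniq η₀ hη₀.1 (by linarith)]; exact mem_interior_iff_mem_nhds.2 hV)
          hη₀.2
    set m := u x + v η₀ - b x η₀
    obtain ⟨δ, hδ, hmod⟩ := exists_modulus hX hY hbc (half_pos hpos)
    have hu' : ∀ᶠ z in 𝓝 x, |u z - u x| < m / 2 := by
      have := (huc.continuousAt (mem_of_superset (hXo.mem_nhds hx) subset_closure)).eventually
        (Metric.ball_mem_nhds (u x) (half_pos hpos))
      exact this
    filter_upwards [hu', hXo.mem_nhds hx, Metric.ball_mem_nhds x hδ] with z hz hzX hzx η hη e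
    by_contra hcon
    have h1 : m ≤ u x + v η - b x η := hmin ⟨hη, fun hi => hcon (interior_subset hi)⟩
    have h2 := abs_lt.1 (hmod z (subset_closure hzX) x (subset_closure hx) hzx η hη)
    have h3 := abs_lt.1 hz
    linarith
  filter_upwards [hU, hXo.mem_nhds hx, hVx] with z hzU hzX hz
  have hxU := mem_of_mem_nhds hU
  obtain ⟨η, hη, e⟩ := h.left z (subset_closure hzX)
  have h1 := abs_le.1 (hlin z hzU x hxU η (hz η hη e))
  have h2 := abs_le.1 (hlin z hzU x hxU y (mem_of_mem_nhds hV))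
  have h3 := h.le x (subset_closure hx) η hη
  have h4 := h.le z (subset_closure hzX) y hy
  rw [InnerProductSpace.toDual_apply_apply, Real.norm_eq_abs, abs_le]
  constructor <;> linarith

/-- A best response to a utility provides a subgradient. -/
theorem IsConjugatePair.gradX_mem_subdifferential (h : IsConjugatePair X Y b u v) {x y : Euc n}
    (hb : ContDiffAt ℝ 1 (Function.uncurry b) (x, y)) (hy : y ∈ closure Y)
    (he : u x + v y = b x y) : gradX b x y ∈ subdifferential X u x := by
  intro ε hε
  obtain ⟨U, hU, V, hV, hlin⟩ := eventually_linearization hb hε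
  filter_upwards [mem_nhdsWithin_of_mem_nhds hU, self_mem_nhdsWithin] with z hzU hzX
  have h1 := abs_le.1 (hlin z hzU x (mem_of_mem_nhds hU) y (mem_of_mem_nhds hV))
  have h2 := h.le z (subset_closure hzX) y hy
  linarith

end Hypersurfaces

/-! ### Net losses and their continuity -/

section NetLoss

variable {n : ℕ} {X Y : Set (Euc n)} {b : Euc n → Euc n → ℝ} {c u v f : Euc n → ℝ}

theorem B0.contDiffAt_one (h : B0 X Y b) {x y : Euc n} (hx : x ∈ closure X) (hy : y ∈ closure Y) :
    ContDiffAt ℝ 1 (Function.uncurry b) (x, y) :=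
  (h x hx y hy).of_le (by norm_num)

theorem B0.continuousOn (h : B0 X Y b) :
    ContinuousOn (Function.uncurry b) (closure X ×ˢ closure Y) :=
  fun p hp => (h p.1 hp.1 p.2 hp.2).continuousAt.continuousWithinAt

theorem IsDiffeoOntoRange.injOn {g : Euc n → Euc n} {K : Set (Euc n)}
    (h : IsDiffeoOntoRange g K) : InjOn g K := by
  obtain ⟨-, k, hk⟩ := h
  intro z hz w hw e
  rw [← (hk z hz).2, ← (hk w hw).2, e]

theorem bExp_gradX {x y : Euc n} (hinj : InjOn (fun y => gradX b x y) (closure Y))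
    (hy : y ∈ closure Y) : bExp Y b x (gradX b x y) = y := by
  have h : ∃ z, z ∈ closure Y ∧ gradX b x z = gradX b x y := ⟨y, hy, rfl⟩
  have := Classical.epsilon_spec h
  exact hinj this.1 hy this.2

theorem IsConjugatePair.exists_favorable (h : IsConjugatePair X Y b u v)
    (hX : IsCompact (closure X)) (hY : IsCompact (closure Y))
    (hb : ContinuousOn (Function.uncurry b) (closure X ×ˢ closure Y))
    (hc : ContinuousOn c (closure Y)) {x : Euc n} (hx : x ∈ closure X) :
    ∃ y, y ∈ favorableResponses Y b c v x := by
  have hv := h.continuousOn_right hX hY hb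
  have hcl : IsCompact (closure Y ∩ (fun y => u x + v y - b x y) ⁻¹' {0}) :=
    hY.of_isClosed_subset (((continuousOn_const.add hv).sub
      (continuousOn_section_right hb hx)).preimage_isClosed_of_isClosed isClosed_closure
        isClosed_singleton) inter_subset_left
  have hne : (closure Y ∩ (fun y => u x + v y - b x y) ⁻¹' {0}).Nonempty := by
    obtain ⟨y, hy, e⟩ := h.left x hx
    exact ⟨y, hy, sub_eq_zero.2 e⟩
  obtain ⟨y, hy, hmax⟩ := hcl.exists_isMaxOn hne ((hv.sub hc).mono inter_subset_left)
  refine ⟨y, (h.mem_bestResponses hx).2 ⟨hy.1, sub_eq_zero.1 hy.2⟩, fun y' hy' => ?_⟩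
  have := (h.mem_bestResponses hx).1 hy'
  exact hmax ⟨this.1, sub_eq_zero.2 this.2⟩

/-- The product that the tie-breaking rule assigns to the agent `x`. -/
noncomputable def agentChoice (X Y : Set (Euc n)) (b : Euc n → Euc n → ℝ) (c u : Euc n → ℝ)
    (x : Euc n) : Euc n :=
  bExp Y b x (tieBrokenGradient X Y b c u x)

theorem IsTieBrokenGradient.bExp_mem {x q : Euc n} (h : IsTieBrokenGradient X Y b c u x q)
    (hinj : InjOn (fun y => gradX b x y) (closure Y)) :
    bExp Y b x q ∈ favorableResponses Y b c (bStarTransform X b u) x := by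
  obtain ⟨-, y, hy, rfl⟩ := h
  rwa [bExp_gradX hinj hy.1.1]

theorem IsBConvex.agentChoice_mem (h : IsBConvex X Y b u) (hX : IsCompact (closure X))
    (hY : IsCompact (closure Y)) (hXn : (closure X).Nonempty) (hYn : (closure Y).Nonempty)
    (h0 : B0 X Y b) (h1 : B1 X Y b) (hc : ContinuousOn c (closure Y)) {x : Euc n} (hx : x ∈ X) :
    agentChoice X Y b c u x ∈ favorableResponses Y b c (bStarTransform X b u) x := by
  have hxc := subset_closure hx
  have hcp := h.isConjugatePair hX hY h0.continuousOn hXn hYn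
  obtain ⟨y, hy⟩ := hcp.exists_favorable hX hY h0.continuousOn hc hxc
  have hyb := (hcp.mem_bestResponses hxc).1 hy.1
  have hex : ∃ q, IsTieBrokenGradient X Y b c u x q :=
    ⟨gradX b x y, hcp.gradX_mem_subdifferential (h0.contDiffAt_one hxc hyb.1) hyb.1 hyb.2,
      y, hy, rfl⟩
  exact (Classical.epsilon_spec hex).bExp_mem (h1.1 x hxc).injOn

/-- The largest value of `f` among all products, where a product `y` that is not a best response of
`x` is penalized by `k` times the slack `u(x) + v(y) - b(x, y)`. It is written as a transform, so
that it is continuous in `x`. -/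
noncomputable def penalizedSup (Y : Set (Euc n)) (b : Euc n → Euc n → ℝ) (u v f : Euc n → ℝ)
    (k : ℕ) (x : Euc n) : ℝ :=
  bTransform Y (fun x y => -(k : ℝ) * (u x + v y - b x y)) (fun y => -f y) x

theorem continuousOn_slack (hb : ContinuousOn (Function.uncurry b) (closure X ×ˢ closure Y))
    (hu : ContinuousOn u (closure X)) (hv : ContinuousOn v (closure Y)) (k : ℕ) :
    ContinuousOn (Function.uncurry fun x y => -(k : ℝ) * (u x + v y - b x y))
      (closure X ×ˢ closure Y) := by
  have h1 : ContinuousOn (fun p : Euc n × Euc n => u p.1) (closure X ×ˢ closure Y) :=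
    hu.comp continuous_fst.continuousOn fun p hp => hp.1
  have h2 : ContinuousOn (fun p : Euc n × Euc n => v p.2) (closure X ×ˢ closure Y) :=
    hv.comp continuous_snd.continuousOn fun p hp => hp.2
  exact continuousOn_const.mul ((h1.add h2).sub hb)

section Penalized

variable (hX : IsCompact (closure X)) (hY : IsCompact (closure Y)) (hYn : (closure Y).Nonempty)
  (hb : ContinuousOn (Function.uncurry b) (closure X ×ˢ closure Y))
  (hu : ContinuousOn u (closure X)) (hv : ContinuousOn v (closure Y))
  (hf : ContinuousOn f (closure Y))

include hX hY hYn hb hu hv hf in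
theorem continuousOn_penalizedSup (k : ℕ) :
    ContinuousOn (penalizedSup Y b u v f k) (closure X) :=
  continuousOn_bTransform hX hY (continuousOn_slack hb hu hv k) hYn (hY.bddBelow_image hf.neg)

include hX hY hb hu hv hf in
theorem le_penalizedSup (k : ℕ) {x y : Euc n} (hx : x ∈ closure X) (hy : y ∈ closure Y) :
    f y - k * (u x + v y - b x y) ≤ penalizedSup Y b u v f k x := by
  have : -(k : ℝ) * (u x + v y - b x y) - -f y ≤ penalizedSup Y b u v f k x :=
    sub_le_bTransform hX hY (continuousOn_slack hb hu hv k) (hY.bddBelow_image hf.neg) hx hy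
  linarith

include hYn in
theorem penalizedSup_le (k : ℕ) {x : Euc n} {a : ℝ}
    (h : ∀ y ∈ closure Y, f y - k * (u x + v y - b x y) ≤ a) : penalizedSup Y b u v f k x ≤ a :=
  bTransform_le hYn fun y hy => by
    have := h y hy
    linarith

include hX hY hYn hb hu hv hf in
/-- Large penalties exclude all products but best responses. -/
theorem tendsto_penalizedSup (hle : ∀ x ∈ closure X, ∀ y ∈ closure Y, b x y ≤ u x + v y)
    {x y : Euc n} (hx : x ∈ closure X) (hy : y ∈ closure Y) (he : u x + v y = b x y)
    (hmax : ∀ y' ∈ closure Y, u x + v y' = b x y' → f y' ≤ f y) :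
    Tendsto (fun k => penalizedSup Y b u v f k x) atTop (𝓝 (f y)) := by
  rw [Metric.tendsto_atTop]
  intro ε hε
  have hlow : ∀ k, f y ≤ penalizedSup Y b u v f k x := fun k => by
    have := le_penalizedSup hX hY hb hu hv hf k hx hy
    rwa [he, sub_self, mul_zero, sub_zero] at this
  suffices h : ∃ N : ℕ, ∀ k ≥ N, ∀ y' ∈ closure Y,
      f y' - k * (u x + v y' - b x y') ≤ f y + ε / 2 by
    obtain ⟨N, hN⟩ := h
    refine ⟨N, fun k hk => ?_⟩
    have := penalizedSup_le hYn k (hN k hk)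
    rw [Real.dist_eq, abs_lt]
    constructor <;> linarith [hlow k]
  -- the products with `f y' ≥ f y + ε / 2` form a compact set without best responses
  have hK : IsCompact (closure Y ∩ f ⁻¹' Ici (f y + ε / 2)) :=
    hY.of_isClosed_subset (hf.preimage_isClosed_of_isClosed isClosed_closure isClosed_Ici)
      inter_subset_left
  have hsl : ContinuousOn (fun y' => u x + v y' - b x y') (closure Y) :=
    (continuousOn_const.add hv).sub (continuousOn_section_right hb hx)
  rcases (closure Y ∩ f ⁻¹' Ici (f y + ε / 2)).eq_empty_or_nonempty with hemp | hne
  · refine ⟨0, fun k _ y' hy' => ?_⟩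
    have h1 : f y' < f y + ε / 2 := by
      by_contra! hcon
      exact (hemp ▸ (⟨hy', hcon⟩ : y' ∈ closure Y ∩ f ⁻¹' Ici (f y + ε / 2)) :
        y' ∈ (∅ : Set (Euc n)))
    have h2 : 0 ≤ (k : ℝ) * (u x + v y' - b x y') :=
      mul_nonneg k.cast_nonneg (sub_nonneg.2 (hle x hx y' hy'))
    linarith
  obtain ⟨z, hz, hmin⟩ := hK.exists_isMinOn hne (hsl.mono inter_subset_left)
  have hpos : 0 < u x + v z - b x z := by
    rcases (sub_nonneg.2 (hle x hx z hz.1)).lt_or_eq with h | h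
    · exact h
    · have h1 := hmax z hz.1 (by linarith)
      have h2 : f y + ε / 2 ≤ f z := hz.2
      linarith
  obtain ⟨M, hM⟩ := hY.exists_bound_of_continuousOn hf
  obtain ⟨N, hN⟩ := exists_nat_gt ((M - f y) / (u x + v z - b x z))
  refine ⟨N, fun k hk y' hy' => ?_⟩
  rcases lt_or_ge (f y') (f y + ε / 2) with h | h
  · have h2 : 0 ≤ (k : ℝ) * (u x + v y' - b x y') :=
      mul_nonneg k.cast_nonneg (sub_nonneg.2 (hle x hx y' hy'))
    linarith
  · have h1 : u x + v z - b x z ≤ u x + v y' - b x y' := hmin ⟨hy', h⟩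
    have h2 : M - f y ≤ N * (u x + v z - b x z) := ((div_lt_iff₀ hpos).1 hN).le
    have h3 : (N : ℝ) * (u x + v z - b x z) ≤ k * (u x + v y' - b x y') := by
      have : (N : ℝ) ≤ k := by exact_mod_cast hk
      gcongr
    have h4 := (le_abs_self _).trans (hM y' hy')
    linarith

theorem restrict_closure_eq {μ : Measure (Euc n)} (hμ : μ Xᶜ = 0) :
    μ.restrict (closure X) = μ :=
  Measure.restrict_eq_self_of_ae_mem
    (measure_mono_null (compl_subset_compl.2 subset_closure) hμ)

theorem ae_mem_of_compl {μ : Measure (Euc n)} (hμ : μ Xᶜ = 0) : ∀ᵐ x ∂μ, x ∈ X := hμ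

include hX in
theorem integrable_of_continuousOn {μ : Measure (Euc n)} [IsFiniteMeasure μ] (hμ : μ Xᶜ = 0)
    (hu : ContinuousOn u (closure X)) : Integrable u μ := by
  have := hu.integrableOn_compact (μ := μ) hX
  rwa [IntegrableOn, restrict_closure_eq hμ] at this

include hX hY hb hf in
/-- If `G` selects the most favorable best responses with respect to `f`, then `f ∘ G` is the limit
of continuous functions and hence integrable. -/
theorem IsConjugatePair.tendsto_integral_penalizedSup (h : IsConjugatePair X Y b u v)
    {μ : Measure (Euc n)} [IsFiniteMeasure μ] (hμ : μ Xᶜ = 0) {G : Euc n → Euc n}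
    (hG : ∀ᵐ x ∂μ, G x ∈ closure Y ∧ u x + v (G x) = b x (G x) ∧
      ∀ y' ∈ closure Y, u x + v y' = b x y' → f y' ≤ f (G x)) :
    Integrable (fun x => f (G x)) μ ∧
      Tendsto (fun k => ∫ x, penalizedSup Y b u v f k x ∂μ) atTop (𝓝 (∫ x, f (G x) ∂μ)) := by
  have hu := h.continuousOn_left hX hY hb
  have hv := h.continuousOn_right hX hY hb
  rcases (closure Y).eq_empty_or_nonempty with hemp | hYn
  · have h0 : ∀ᵐ x ∂μ, False := by
      filter_upwards [hG] with x hx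
      rw [hemp] at hx
      exact hx.1
    have : μ = 0 := by simpa using h0
    subst this
    simp
  have hlim : ∀ᵐ x ∂μ, Tendsto (fun k => penalizedSup Y b u v f k x) atTop (𝓝 (f (G x))) := by
    filter_upwards [hG, ae_mem_of_compl hμ] with x hx hxX
    exact tendsto_penalizedSup hX hY hYn hb hu hv hf h.le (subset_closure hxX) hx.1 hx.2.1 hx.2.2
  obtain ⟨M, hM⟩ := hY.exists_bound_of_continuousOn hf
  have hmeas : ∀ k, AEStronglyMeasurable (penalizedSup Y b u v f k) μ := fun k =>
    (integrable_of_continuousOn hX hμ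
      (continuousOn_penalizedSup hX hY hYn hb hu hv hf k)).aestronglyMeasurable
  have hbd : ∀ k, ∀ᵐ x ∂μ, ‖penalizedSup Y b u v f k x‖ ≤ M := fun k => by
    filter_upwards [hG, ae_mem_of_compl hμ] with x hx hxX
    have hxc := subset_closure hxX
    have h1 := le_penalizedSup hX hY hb hu hv hf k hxc hx.1
    rw [hx.2.1, sub_self, mul_zero, sub_zero] at h1
    have h2 := abs_le.1 (hM _ hx.1)
    have h3 : penalizedSup Y b u v f k x ≤ M := penalizedSup_le hYn k fun y hy => by
      have h4 := abs_le.1 (hM _ hy)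
      have h5 : 0 ≤ (k : ℝ) * (u x + v y - b x y) :=
        mul_nonneg k.cast_nonneg (sub_nonneg.2 (h.le x hxc y hy))
      linarith
    rw [Real.norm_eq_abs, abs_le]
    constructor <;> linarith
  constructor
  · refine Integrable.of_bound (aestronglyMeasurable_of_tendsto_ae atTop hmeas hlim) M ?_
    filter_upwards [hG] with x hx using hM _ hx.1
  · exact tendsto_integral_of_dominated_convergence (fun _ => M) hmeas (integrable_const M) hbd hlim

end Penalized

section Continuity

variable {bs : ℕ → Euc n → Euc n → ℝ} {us vs fs : ℕ → Euc n → ℝ} {μs : ℕ → Measure (Euc n)}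
  {μ : Measure (Euc n)} {Gs : ℕ → Euc n → Euc n} {G : Euc n → Euc n}

/-- Upper semicontinuity, jointly in all data, of the integral of a function of the agents'
choices. The integrand `fs i ∘ Gs i` need not converge anywhere, but it is bounded by the fixed
continuous function `penalizedSup` up to a small error, and weak convergence applies to that one. -/
theorem IsConjugatePair.eventually_integral_le (h : IsConjugatePair X Y b u v)
    (hX : IsCompact (closure X)) (hY : IsCompact (closure Y))
    (hb : ContinuousOn (Function.uncurry b) (closure X ×ˢ closure Y))
    (hf : ContinuousOn f (closure Y)) [IsProbabilityMeasure μ] [∀ i, IsProbabilityMeasure (μs i)]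
    (hμ : μ Xᶜ = 0) (hμs : ∀ i, μs i Xᶜ = 0) (hw : WeakStarTendsto (closure X) μs μ)
    (hbs : TendstoUniformlyOn (fun i => Function.uncurry (bs i)) (Function.uncurry b) atTop
      (closure X ×ˢ closure Y))
    (hus : TendstoUniformlyOn us u atTop (closure X))
    (hvs : TendstoUniformlyOn vs v atTop (closure Y))
    (hfs : TendstoUniformlyOn fs f atTop (closure Y))
    (hGs : ∀ i, ∀ᵐ x ∂μs i, Gs i x ∈ closure Y ∧ us i x + vs i (Gs i x) = bs i x (Gs i x))
    (hint : ∀ i, Integrable (fun x => fs i (Gs i x)) (μs i))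
    (hG : ∀ᵐ x ∂μ, G x ∈ closure Y ∧ u x + v (G x) = b x (G x) ∧
      ∀ y' ∈ closure Y, u x + v y' = b x y' → f y' ≤ f (G x))
    {ε : ℝ} (hε : 0 < ε) :
    ∀ᶠ i in atTop, ∫ x, fs i (Gs i x) ∂μs i ≤ ∫ x, f (G x) ∂μ + ε := by
  have hu := h.continuousOn_left hX hY hb
  have hv := h.continuousOn_right hX hY hb
  obtain ⟨x₀, hx₀⟩ := (hG.and (ae_mem_of_compl hμ)).exists
  have hYn : (closure Y).Nonempty := ⟨_, hx₀.1.1⟩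
  obtain ⟨k, hk⟩ := ((h.tendsto_integral_penalizedSup hX hY hb hf hμ hG).2.eventually
    (gt_mem_nhds (by linarith : ∫ x, f (G x) ∂μ < ∫ x, f (G x) ∂μ + ε / 3))).exists
  have hS := continuousOn_penalizedSup hX hY hYn hb hu hv hf k
  have h1 := (hw _ hS).eventually (gt_mem_nhds (by linarith :
    ∫ x in closure X, penalizedSup Y b u v f k x ∂μ <
      ∫ x in closure X, penalizedSup Y b u v f k x ∂μ + ε / 3))
  -- an error `δ` in each of `b`, `u`, `v` costs `3 * k * δ` in the penalty
  set δ : ℝ := ε / 3 / (1 + 3 * k)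
  have hδ : 0 < δ := by positivity
  have hδe : δ + 3 * k * δ = ε / 3 := by
    simp only [δ]
    field_simp
  filter_upwards [h1, Metric.tendstoUniformlyOn_iff.1 hbs δ hδ,
    Metric.tendstoUniformlyOn_iff.1 hus δ hδ, Metric.tendstoUniformlyOn_iff.1 hvs δ hδ,
    Metric.tendstoUniformlyOn_iff.1 hfs δ hδ] with i hi hbi hui hvi hfi
  rw [restrict_closure_eq hμ, restrict_closure_eq (hμs i)] at hi
  have hSi := integrable_of_continuousOn hX (hμs i) hS
  have hle : ∫ x, fs i (Gs i x) ∂μs i ≤ ∫ x, (penalizedSup Y b u v f k x + ε / 3) ∂μs i := by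
    refine integral_mono_ae (hint i) (hSi.add (integrable_const _)) ?_
    filter_upwards [hGs i, ae_mem_of_compl (hμs i)] with x hx hxX
    have hxc := subset_closure hxX
    obtain ⟨hy, e⟩ := hx
    have e1 := le_penalizedSup hX hY hb hu hv hf k hxc hy
    have e2 := abs_lt.1 (by simpa [Real.dist_eq] using hbi (x, Gs i x) ⟨hxc, hy⟩)
    have e3 := abs_lt.1 (by simpa [Real.dist_eq] using hui x hxc)
    have e4 := abs_lt.1 (by simpa [Real.dist_eq] using hvi _ hy)
    have e5 := abs_lt.1 (by simpa [Real.dist_eq] using hfi _ hy)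
    have e6 : (k : ℝ) * (u x + v (Gs i x) - b x (Gs i x)) ≤ k * (3 * δ) := by
      gcongr
      linarith
    linarith
  rw [integral_add hSi (integrable_const _), integral_const] at hle
  simp only [probReal_univ, smul_eq_mul, one_mul] at hle
  linarith

/-- If almost every agent has only one best response in the limit, the distribution of the
choices depends continuously on all data: semicontinuity applies to both `f` and `-f`. -/
theorem IsConjugatePair.tendsto_integral (h : IsConjugatePair X Y b u v)
    (hX : IsCompact (closure X)) (hY : IsCompact (closure Y))
    (hb : ContinuousOn (Function.uncurry b) (closure X ×ˢ closure Y))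
    (hf : ContinuousOn f (closure Y)) [IsProbabilityMeasure μ] [∀ i, IsProbabilityMeasure (μs i)]
    (hμ : μ Xᶜ = 0) (hμs : ∀ i, μs i Xᶜ = 0) (hw : WeakStarTendsto (closure X) μs μ)
    (hbs : TendstoUniformlyOn (fun i => Function.uncurry (bs i)) (Function.uncurry b) atTop
      (closure X ×ˢ closure Y))
    (hus : TendstoUniformlyOn us u atTop (closure X))
    (hvs : TendstoUniformlyOn vs v atTop (closure Y))
    (hfs : TendstoUniformlyOn fs f atTop (closure Y))
    (hGs : ∀ i, ∀ᵐ x ∂μs i, Gs i x ∈ closure Y ∧ us i x + vs i (Gs i x) = bs i x (Gs i x))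
    (hint : ∀ i, Integrable (fun x => fs i (Gs i x)) (μs i))
    (hG : ∀ᵐ x ∂μ, G x ∈ closure Y ∧ u x + v (G x) = b x (G x) ∧
      ∀ y' ∈ closure Y, u x + v y' = b x y' → y' = G x) :
    Tendsto (fun i => ∫ x, fs i (Gs i x) ∂μs i) atTop (𝓝 (∫ x, f (G x) ∂μ)) := by
  rw [Metric.tendsto_nhds]
  intro ε hε
  have hG' : ∀ g : Euc n → ℝ, ∀ᵐ x ∂μ, G x ∈ closure Y ∧ u x + v (G x) = b x (G x) ∧
      ∀ y' ∈ closure Y, u x + v y' = b x y' → g y' ≤ g (G x) := fun g => by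
    filter_upwards [hG] with x hx
    exact ⟨hx.1, hx.2.1, fun y' hy' e => by rw [hx.2.2 y' hy' e]⟩
  have hfs' : TendstoUniformlyOn (fun i y => -fs i y) (fun y => -f y) atTop (closure Y) := by
    rw [Metric.tendstoUniformlyOn_iff] at hfs ⊢
    simpa [dist_neg_neg] using hfs
  have h1 := h.eventually_integral_le hX hY hb hf hμ hμs hw hbs hus hvs hfs hGs hint (hG' f)
    (half_pos hε)
  have h2 := h.eventually_integral_le hX hY hb hf.neg hμ hμs hw hbs hus hvs hfs' hGs
    (fun i => (hint i).neg) (hG' fun y => -f y) (half_pos hε)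
  filter_upwards [h1, h2] with i e1 e2
  simp only [Pi.neg_apply, integral_neg] at e2
  rw [Real.dist_eq, abs_lt]
  constructor <;> linarith

end Continuity

section Feasible

variable {μ : Measure (Euc n)}

/-- The losses from each agent are the production cost minus the price of the chosen product. -/
theorem netLoss_eq [IsFiniteMeasure μ] (hμ : μ Xᶜ = 0) (hu : IsBConvex X Y b u)
    (hX : IsCompact (closure X)) (hY : IsCompact (closure Y)) (hXn : (closure X).Nonempty)
    (hYn : (closure Y).Nonempty) (h0 : B0 X Y b) (h1 : B1 X Y b)
    (hc : ContinuousOn c (closure Y)) :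
    netLoss X Y b c μ u = ∫ x, (c (agentChoice X Y b c u x) -
      bStarTransform X b u (agentChoice X Y b c u x)) ∂μ := by
  rw [netLoss, Measure.restrict_eq_self_of_ae_mem (ae_mem_of_compl hμ)]
  refine integral_congr_ae ?_
  filter_upwards [ae_mem_of_compl hμ] with x hx
  have hcp := hu.isConjugatePair hX hY h0.continuousOn hXn hYn
  have := hu.agentChoice_mem hX hY hXn hYn h0 h1 hc hx
  have := ((hcp.mem_bestResponses (subset_closure hx)).1 this.1).2
  simp only [agentChoice] at *
  linarith

/-- The properties of `agentChoice` for almost every agent, in terms of the conjugate pair. -/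
theorem IsBConvex.ae_agentChoice (hμ : μ Xᶜ = 0) (hu : IsBConvex X Y b u)
    (hX : IsCompact (closure X)) (hY : IsCompact (closure Y)) (hXn : (closure X).Nonempty)
    (hYn : (closure Y).Nonempty) (h0 : B0 X Y b) (h1 : B1 X Y b)
    (hc : ContinuousOn c (closure Y)) :
    ∀ᵐ x ∂μ, agentChoice X Y b c u x ∈ closure Y ∧
      u x + bStarTransform X b u (agentChoice X Y b c u x) = b x (agentChoice X Y b c u x) ∧
      ∀ y' ∈ closure Y, u x + bStarTransform X b u y' = b x y' →
        bStarTransform X b u y' - c y' ≤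
          bStarTransform X b u (agentChoice X Y b c u x) - c (agentChoice X Y b c u x) := by
  filter_upwards [ae_mem_of_compl hμ] with x hx
  have hcp := hu.isConjugatePair hX hY h0.continuousOn hXn hYn
  have hm := hu.agentChoice_mem hX hY hXn hYn h0 h1 hc hx
  have hb := (hcp.mem_bestResponses (subset_closure hx)).1 hm.1
  exact ⟨hb.1, hb.2, fun y' hy' e =>
    hm.2 y' ((hcp.mem_bestResponses (subset_closure hx)).2 ⟨hy', e⟩)⟩

theorem IsBConvex.integrable_profit [IsFiniteMeasure μ] (hμ : μ Xᶜ = 0) (hu : IsBConvex X Y b u)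
    (hX : IsCompact (closure X)) (hY : IsCompact (closure Y)) (hXn : (closure X).Nonempty)
    (hYn : (closure Y).Nonempty) (h0 : B0 X Y b) (h1 : B1 X Y b)
    (hc : ContinuousOn c (closure Y)) :
    Integrable (fun x => bStarTransform X b u (agentChoice X Y b c u x) -
      c (agentChoice X Y b c u x)) μ := by
  have hcp := hu.isConjugatePair hX hY h0.continuousOn hXn hYn
  exact (hcp.tendsto_integral_penalizedSup (f := fun y => bStarTransform X b u y - c y) hX hY
    h0.continuousOn ((hcp.continuousOn_right hX hY h0.continuousOn).sub hc) hμ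
    (hu.ae_agentChoice hμ hX hY hXn hYn h0 h1 hc)).1

end Feasible

end NetLoss

/-! ### Local inverses and second derivatives along curves -/

section Calculus

variable {n : ℕ} {Y : Set (Euc n)} {b : Euc n → Euc n → ℝ}

theorem contDiffAt_gradX {x y : Euc n} (h : ContDiffAt ℝ 4 (Function.uncurry b) (x, y)) :
    ContDiffAt ℝ 3 (fun p : Euc n × Euc n => gradX b p.1 p.2) (x, y) := by
  rw [contDiffAt_euclidean]
  intro i
  have h1 : ContDiffAt ℝ 3 (fun p => fderiv ℝ (Function.uncurry b) p
      (EuclideanSpace.single i (1 : ℝ), 0)) (x, y) :=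
    (h.fderiv_right (m := 3) (by norm_num)).clm_apply contDiffAt_const
  refine h1.congr_of_eventuallyEq ?_
  filter_upwards [h.eventually (by simp)] with p hp
  rw [← inner_gradX (hp.differentiableAt (by simp)), EuclideanSpace.inner_single_right]
  simp

theorem contDiffAt_gradX_right {x y : Euc n} (h : ContDiffAt ℝ 4 (Function.uncurry b) (x, y)) :
    ContDiffAt ℝ 3 (fun y => gradX b x y) y :=
  ContDiffAt.comp y (g := fun p : Euc n × Euc n => gradX b p.1 p.2) (f := fun y => (x, y))
    (contDiffAt_gradX h) (by fun_prop)

theorem contDiffAt_uncurry_flip {m : WithTop ℕ∞} {x y : Euc n}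
    (h : ContDiffAt ℝ m (Function.uncurry b) (x, y)) :
    ContDiffAt ℝ m (Function.uncurry fun y x => b x y) (y, x) :=
  ContDiffAt.comp (y, x) (g := Function.uncurry b) (f := fun q : Euc n × Euc n => (q.2, q.1)) h
    (contDiff_snd.prodMk contDiff_fst).contDiffAt

theorem contDiffAt_gradY_left {x y : Euc n} (h : ContDiffAt ℝ 4 (Function.uncurry b) (x, y)) :
    ContDiffAt ℝ 3 (fun x => gradY b x y) x :=
  contDiffAt_gradX_right (b := fun y x => b x y) (contDiffAt_uncurry_flip h)

theorem contDiffAt_gradY {x y : Euc n} (h : ContDiffAt ℝ 4 (Function.uncurry b) (x, y)) :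
    ContDiffAt ℝ 3 (fun p : Euc n × Euc n => gradY b p.1 p.2) (x, y) :=
  ContDiffAt.comp (x, y) (g := fun p : Euc n × Euc n => gradX (fun y x => b x y)
    p.1 p.2) (f := fun q : Euc n × Euc n => (q.2, q.1))
    (contDiffAt_gradX (contDiffAt_uncurry_flip h)) (contDiff_snd.prodMk contDiff_fst).contDiffAt

theorem inner_gradY {x y : Euc n} (h : DifferentiableAt ℝ (Function.uncurry b) (x, y))
    (w : Euc n) : inner ℝ (gradY b x y) w = fderiv ℝ (Function.uncurry b) (x, y) (0, w) := by
  have h1 : HasFDerivAt (fun y' : Euc n => (x, y'))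
      (ContinuousLinearMap.inr ℝ (Euc n) (Euc n)) y := hasFDerivAt_prodMk_right x y
  have h2 : HasFDerivAt (fun y' => b x y')
      ((fderiv ℝ (Function.uncurry b) (x, y)).comp (ContinuousLinearMap.inr ℝ (Euc n) (Euc n))) y :=
    HasFDerivAt.comp y (g := Function.uncurry b) h.hasFDerivAt h1
  rw [gradY, gradient, InnerProductSpace.toDual_symm_apply, h2.fderiv]
  simp

/-- A diffeomorphism of the closure of an open set onto its range has an invertible derivative
even at boundary points, so it extends to a local diffeomorphism there. -/
theorem IsDiffeoOntoRange.exists_local_inverse (hY : IsOpen Y) {f : Euc n → Euc n}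
    (h : IsDiffeoOntoRange f (closure Y)) {z : Euc n} (hz : z ∈ closure Y)
    (hf : ContDiffAt ℝ 3 f z) :
    ∃ g : Euc n → Euc n, ContDiffAt ℝ 3 g (f z) ∧ g (f z) = z ∧ (∀ᶠ w in 𝓝 z, g (f w) = w) ∧
      ∀ᶠ q in 𝓝 (f z), f (g q) = q := by
  obtain ⟨hf1, k, hk⟩ := h
  have hkf : ContDiffAt ℝ 1 (k ∘ f) z := (hk z hz).1.comp z (hf1 z hz)
  have hid : fderiv ℝ (k ∘ f) z = ContinuousLinearMap.id ℝ (Euc n) := by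
    -- the derivative is the identity on `Y`, and continuous at `z`
    have h1 : Tendsto (fderiv ℝ (k ∘ f)) (𝓝[Y] z) (𝓝 (fderiv ℝ (k ∘ f) z)) :=
      (hkf.continuousAt_fderiv one_ne_zero).continuousWithinAt
    have h2 : ∀ᶠ w in 𝓝[Y] z, fderiv ℝ (k ∘ f) w = ContinuousLinearMap.id ℝ (Euc n) := by
      filter_upwards [self_mem_nhdsWithin] with w hw
      have : k ∘ f =ᶠ[𝓝 w] id := by
        filter_upwards [hY.mem_nhds hw] with w' hw' using (hk w' (subset_closure hw')).2
      rw [this.fderiv_eq, fderiv_id]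
    have : (𝓝[Y] z).NeBot := mem_closure_iff_nhdsWithin_neBot.1 hz
    exact tendsto_nhds_unique (h1.congr' h2) tendsto_const_nhds
  have hcomp : (fderiv ℝ k (f z)).comp (fderiv ℝ f z) = ContinuousLinearMap.id ℝ (Euc n) := by
    rw [← hid, fderiv_comp z ((hk z hz).1.differentiableAt one_ne_zero)
      ((hf1 z hz).differentiableAt one_ne_zero)]
  have hinj : Function.Injective (fderiv ℝ f z : Euc n →ₗ[ℝ] Euc n) := by
    intro a a' e
    have e1 := congrArg (fderiv ℝ k (f z)) e
    have e2 : ∀ a, fderiv ℝ k (f z) (fderiv ℝ f z a) = a := fun a => by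
      rw [← ContinuousLinearMap.comp_apply, hcomp]; rfl
    simpa only [ContinuousLinearMap.coe_coe, e2] using e1
  let f' : Euc n ≃L[ℝ] Euc n :=
    (LinearEquiv.ofInjectiveEndo (fderiv ℝ f z : Euc n →ₗ[ℝ] Euc n) hinj).toContinuousLinearEquiv
  have hf' : HasFDerivAt f (f' : Euc n →L[ℝ] Euc n) z := by
    have : (f' : Euc n →L[ℝ] Euc n) = fderiv ℝ f z := by ext; rfl
    rw [this]
    exact (hf.differentiableAt (by simp)).hasFDerivAt
  have hs := hf.hasStrictFDerivAt' hf' (by simp)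
  exact ⟨hf.localInverse hf' (by simp), hf.to_localInverse hf' (by simp),
    hs.localInverse_apply_image, hs.eventually_left_inverse, hs.eventually_right_inverse⟩

/-- A curve in `closure Y` that a diffeomorphism maps to an affine segment is smooth. -/
theorem IsDiffeoOntoRange.contDiffAt_of_segment (hY : IsOpen Y) {f : Euc n → Euc n}
    (h : IsDiffeoOntoRange f (closure Y)) (hf : ∀ z ∈ closure Y, ContDiffAt ℝ 3 f z)
    {γ : ℝ → Euc n} {q w : Euc n}
    (hγ : ∀ t ∈ Icc (0 : ℝ) 1, γ t ∈ closure Y ∧ f (γ t) = q + t • w) :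
    ContinuousOn γ (Icc 0 1) ∧ ∀ t ∈ Ioo (0 : ℝ) 1, ContDiffAt ℝ 3 γ t := by
  have hcont : ContinuousOn γ (Icc 0 1) := by
    obtain ⟨-, k, hk⟩ := h
    have h1 : ContinuousOn (fun t : ℝ => k (q + t • w)) (Icc 0 1) := by
      intro t ht
      have h2 : ContinuousAt k (q + t • w) := by
        rw [← (hγ t ht).2]
        exact (hk _ (hγ t ht).1).1.continuousAt
      exact ContinuousAt.continuousWithinAt
        (ContinuousAt.comp (f := fun t : ℝ => q + t • w) h2 (by fun_prop))
    refine h1.congr fun t ht => ?_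
    simp only
    rw [← (hγ t ht).2, (hk _ (hγ t ht).1).2]
  refine ⟨hcont, fun t ht => ?_⟩
  have htI := Ioo_subset_Icc_self ht
  obtain ⟨g, hg, -, hgf, -⟩ := h.exists_local_inverse hY (hγ t htI).1 (hf _ (hγ t htI).1)
  have hct : ContinuousAt γ t := hcont.continuousAt (Icc_mem_nhds ht.1 ht.2)
  have h1 : ContDiffAt ℝ 3 (fun s : ℝ => g (q + s • w)) t := by
    refine ContDiffAt.comp t (g := g) (f := fun s : ℝ => q + s • w) ?_ (by fun_prop)
    rwa [← (hγ t htI).2]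
  refine h1.congr_of_eventuallyEq ?_
  filter_upwards [hct.eventually hgf, Icc_mem_nhds ht.1 ht.2] with s hs hsI
  rw [← (hγ s hsI).2, hs]

theorem iteratedDeriv_two (f : ℝ → ℝ) (t : ℝ) : iteratedDeriv 2 f t = deriv (deriv f) t := by
  rw [iteratedDeriv_succ, iteratedDeriv_one]

theorem iteratedDeriv_two_comp_affine (f : ℝ → ℝ) (s ε t : ℝ) :
    iteratedDeriv 2 (fun σ => f (s + ε * σ)) t = ε ^ 2 * iteratedDeriv 2 f (s + ε * t) := by
  have h : ∀ (g : ℝ → ℝ) (t : ℝ), deriv (fun σ => g (s + ε * σ)) t = ε * deriv g (s + ε * t) := by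
    intro g t
    rw [deriv_comp_mul_left ε (fun σ => g (s + σ)) t, deriv_comp_const_add, smul_eq_mul]
  rw [iteratedDeriv_two, iteratedDeriv_two, funext (h f), deriv_const_mul_field, h]
  ring

theorem iteratedDeriv_two_affine (a β t : ℝ) :
    iteratedDeriv 2 (fun σ : ℝ => a + σ * β) t = 0 := by
  have h : deriv (fun σ : ℝ => a + σ * β) = fun _ => β := by
    ext t
    simp
  rw [iteratedDeriv_two, h, deriv_const]

/-- The second derivative of `b(x, ·)` at `y` in the direction `η`. -/
noncomputable def hessY (b : Euc n → Euc n → ℝ) (η x y : Euc n) : ℝ :=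
  fderiv ℝ (fderiv ℝ (Function.uncurry b)) (x, y) (0, η) (0, η)

theorem hessY_smul (η x y : Euc n) (r : ℝ) : hessY b (r • η) x y = r ^ 2 * hessY b η x y := by
  have : ((0 : Euc n), r • η) = r • ((0 : Euc n), η) := by simp
  rw [hessY, hessY, this, map_smul, map_smul, smul_apply, smul_eq_mul, smul_eq_mul]
  ring

theorem contDiffAt_hessY {x y : Euc n} (h : ContDiffAt ℝ 4 (Function.uncurry b) (x, y))
    (η : Euc n) : ContDiffAt ℝ 2 (fun p : Euc n × Euc n => hessY b η p.1 p.2) (x, y) :=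
  ((((h.fderiv_right (m := 3) (by norm_num)).fderiv_right (m := 2) (by norm_num)).clm_apply
    contDiffAt_const).clm_apply contDiffAt_const)

/-- The second derivative of `b(x, ·)` along a curve. The acceleration of the curve enters linearly
in `D_y b`. -/
theorem iteratedDeriv_two_along {x : Euc n} {γ : ℝ → Euc n} {t : ℝ}
    (h : ContDiffAt ℝ 4 (Function.uncurry b) (x, γ t)) (hγ : ContDiffAt ℝ 3 γ t) :
    iteratedDeriv 2 (fun s => b x (γ s)) t =
      hessY b (deriv γ t) x (γ t) + inner ℝ (gradY b x (γ t)) (deriv (deriv γ) t) := by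
  have hd : ∀ᶠ s in 𝓝 t, deriv (fun s => b x (γ s)) s =
      fderiv ℝ (Function.uncurry b) (x, γ s) (0, deriv γ s) := by
    have hc : ContinuousAt (fun s => (x, γ s)) t := continuousAt_const.prodMk hγ.continuousAt
    filter_upwards [hc.eventually (h.eventually (by simp)), hγ.eventually (by simp)] with s h1 h2
    have h3 : HasDerivAt (fun s => (x, γ s)) (0, deriv γ s) s :=
      (hasDerivAt_const s x).prodMk (h2.differentiableAt (by simp)).hasDerivAt
    exact (HasFDerivAt.comp_hasDerivAt s (l := Function.uncurry b)
      (h1.differentiableAt (by simp)).hasFDerivAt h3).deriv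
  have hγ' : DifferentiableAt ℝ (deriv γ) t := by
    have h1 : ContDiffAt ℝ 2 (fun s => fderiv ℝ γ s 1) t :=
      (hγ.fderiv_right (m := 2) (by norm_num)).clm_apply contDiffAt_const
    simpa only [fderiv_apply_one_eq_deriv] using h1.differentiableAt (by simp)
  have h3 : HasDerivAt (fun s => (x, γ s)) (0, deriv γ t) t :=
    (hasDerivAt_const t x).prodMk (hγ.differentiableAt (by simp)).hasDerivAt
  have h4 : HasDerivAt (fun s => fderiv ℝ (Function.uncurry b) (x, γ s))
      (fderiv ℝ (fderiv ℝ (Function.uncurry b)) (x, γ t) (0, deriv γ t)) t :=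
    HasFDerivAt.comp_hasDerivAt t (l := fderiv ℝ (Function.uncurry b))
      ((h.fderiv_right (m := 3) (by norm_num)).differentiableAt (by simp)).hasFDerivAt h3
  have h5 : HasDerivAt (fun s => ((0 : Euc n), deriv γ s)) (0, deriv (deriv γ) t) t :=
    (hasDerivAt_const t 0).prodMk hγ'.hasDerivAt
  rw [iteratedDeriv_two, Filter.EventuallyEq.deriv_eq hd, (h4.clm_apply h5).deriv,
    inner_gradY (h.differentiableAt (by simp)), hessY]

/-- `∂_s ∂_t Φ = ∂_t ∂_s Φ`, with both sides existing as one-dimensional derivatives. -/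
theorem hasDerivAt_fderiv_swap {Φ : ℝ × ℝ → ℝ} {s t : ℝ} (h : ContDiffAt ℝ 2 Φ (s, t)) :
    HasDerivAt (fun s => fderiv ℝ Φ (s, t) (0, 1)) (deriv (fun t => fderiv ℝ Φ (s, t) (1, 0)) t) s ∧
    DifferentiableAt ℝ (fun t => fderiv ℝ Φ (s, t) (1, 0)) t := by
  have hd : HasFDerivAt (fderiv ℝ Φ) (fderiv ℝ (fderiv ℝ Φ) (s, t)) (s, t) :=
    ((h.fderiv_right (m := 1) (by norm_num)).differentiableAt one_ne_zero).hasFDerivAt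
  have h1 : HasDerivAt (fun s => fderiv ℝ Φ (s, t)) (fderiv ℝ (fderiv ℝ Φ) (s, t) (1, 0)) s :=
    hd.comp_hasDerivAt s ((hasDerivAt_id s).prodMk (hasDerivAt_const s t))
  have h2 : HasDerivAt (fun t => fderiv ℝ Φ (s, t)) (fderiv ℝ (fderiv ℝ Φ) (s, t) (0, 1)) t :=
    hd.comp_hasDerivAt t ((hasDerivAt_const t s).prodMk (hasDerivAt_id t))
  have h1' := h1.clm_apply (hasDerivAt_const s ((0 : ℝ), (1 : ℝ)))
  have h2' := h2.clm_apply (hasDerivAt_const t ((1 : ℝ), (0 : ℝ)))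
  refine ⟨?_, h2'.differentiableAt⟩
  rw [h2'.deriv]
  have hsymm : fderiv ℝ (fderiv ℝ Φ) (s, t) (0, 1) (1, 0) =
      fderiv ℝ (fderiv ℝ Φ) (s, t) (1, 0) (0, 1) := (h.isSymmSndFDerivAt (by simp)).eq _ _
  rw [map_zero, add_zero] at h1' ⊢
  rwa [hsymm]

/-- `∂_s ∂_t² Ψ = ∂_t² ∂_s Ψ` for a function `Ψ` of class `C³`. -/
theorem hasDerivAt_iteratedDeriv_two_swap {Ψ : ℝ → ℝ → ℝ} {s t : ℝ}
    (h : ContDiffAt ℝ 3 (Function.uncurry Ψ) (s, t)) :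
    HasDerivAt (fun s => iteratedDeriv 2 (Ψ s) t)
      (iteratedDeriv 2 (fun t => deriv (fun s => Ψ s t) s) t) s := by
  set F := Function.uncurry Ψ
  have hc1 : ContinuousAt (fun s => (s, t)) s := by fun_prop
  have hc2 : ContinuousAt (fun t => (s, t)) t := by fun_prop
  have hF := h.eventually (by simp)
  have hd : ∀ p : ℝ × ℝ, ContDiffAt ℝ 3 F p → deriv (Ψ p.1) p.2 = fderiv ℝ F p (0, 1) := by
    intro p hp
    exact (HasFDerivAt.comp_hasDerivAt p.2 (l := F) (f := fun t => (p.1, t))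
      (hp.differentiableAt (by simp)).hasFDerivAt
      ((hasDerivAt_const p.2 p.1).prodMk (hasDerivAt_id p.2))).deriv
  have hd' : ∀ p : ℝ × ℝ, ContDiffAt ℝ 3 F p →
      deriv (fun s => Ψ s p.2) p.1 = fderiv ℝ F p (1, 0) := by
    intro p hp
    exact (HasFDerivAt.comp_hasDerivAt p.1 (l := F) (f := fun s => (s, p.2))
      (hp.differentiableAt (by simp)).hasFDerivAt
      ((hasDerivAt_id p.1).prodMk (hasDerivAt_const p.1 p.2))).deriv
  have hF2 : ∀ p : ℝ × ℝ, ContDiffAt ℝ 3 F p →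
      ContDiffAt ℝ 2 (fun p => fderiv ℝ F p (0, 1)) p := fun p hp =>
    (hp.fderiv_right (m := 2) (by norm_num)).clm_apply contDiffAt_const
  have hF1 : ∀ p : ℝ × ℝ, ContDiffAt ℝ 3 F p →
      ContDiffAt ℝ 2 (fun p => fderiv ℝ F p (1, 0)) p := fun p hp =>
    (hp.fderiv_right (m := 2) (by norm_num)).clm_apply contDiffAt_const
  -- the left-hand function is `∂_t` of `∂_t Ψ`
  have hL : ∀ᶠ s' in 𝓝 s, iteratedDeriv 2 (Ψ s') t =
      fderiv ℝ (fun p => fderiv ℝ F p (0, 1)) (s', t) (0, 1) := by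
    filter_upwards [hc1.eventually hF.eventually_nhds] with s' hs'
    have hc : ContinuousAt (fun t => (s', t)) t := by fun_prop
    have e : deriv (Ψ s') =ᶠ[𝓝 t] fun t' => fderiv ℝ F (s', t') (0, 1) := by
      filter_upwards [hc.eventually hs'] with t' ht' using hd (s', t') ht'
    rw [iteratedDeriv_two, e.deriv_eq]
    exact (HasFDerivAt.comp_hasDerivAt t (l := fun p => fderiv ℝ F p (0, 1))
      (f := fun t => (s', t)) ((hF2 _ hs'.self_of_nhds).differentiableAt (by simp)).hasFDerivAt
      ((hasDerivAt_const t s').prodMk (hasDerivAt_id t))).deriv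
  have hR : ∀ᶠ t' in 𝓝 t, deriv (fun t => deriv (fun s => Ψ s t) s) t' =
      fderiv ℝ (fun p => fderiv ℝ F p (0, 1)) (s, t') (1, 0) := by
    filter_upwards [hc2.eventually hF.eventually_nhds] with t' ht'
    have hc : ContinuousAt (fun t => (s, t)) t' := by fun_prop
    have e : (fun t => deriv (fun s => Ψ s t) s) =ᶠ[𝓝 t'] fun t => fderiv ℝ F (s, t) (1, 0) := by
      filter_upwards [hc.eventually ht'] with r hr using hd' (s, r) hr
    have h3 : ContDiffAt ℝ 2 F (s, t') := ht'.self_of_nhds.of_le (by norm_num)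
    rw [e.deriv_eq, ← (hasDerivAt_fderiv_swap h3).1.deriv]
    exact (HasFDerivAt.comp_hasDerivAt s (l := fun p => fderiv ℝ F p (0, 1))
      (f := fun s => (s, t')) ((hF2 _ ht'.self_of_nhds).differentiableAt (by simp)).hasFDerivAt
      ((hasDerivAt_id s).prodMk (hasDerivAt_const s t'))).deriv
  have key := (hasDerivAt_fderiv_swap (hF2 _ h)).1
  rw [iteratedDeriv_two, Filter.EventuallyEq.deriv_eq hR]
  exact key.congr_of_eventuallyEq hL

end Calculus

/-! ### Non-negative cross-curvature as convexity -/

section CrossCurvature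

variable {n : ℕ} {X Y : Set (Euc n)} {b : Euc n → Euc n → ℝ}

theorem convex_image_closure {K : Set (Euc n)} {f : Euc n → Euc n} (hK : IsCompact (closure K))
    (hf : ContinuousOn f (closure K)) (h : Convex ℝ (f '' K)) : Convex ℝ (f '' closure K) := by
  have : f '' closure K = closure (f '' K) :=
    Subset.antisymm hf.image_closure
      (closure_minimal (image_mono subset_closure) (hK.image_of_continuousOn hf).isClosed)
  rw [this]
  exact h.closure

theorem IsDiffeoOntoRange.continuousOn {K : Set (Euc n)} {f : Euc n → Euc n}
    (h : IsDiffeoOntoRange f K) : ContinuousOn f K :=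
  fun z hz => (h.1 z hz).continuousAt.continuousWithinAt

/-- Two points are joined by a curve which `f` maps to an affine segment. -/
theorem exists_curve_of_convex_image {K : Set (Euc n)} {f : Euc n → Euc n} (hinj : InjOn f K)
    (h : Convex ℝ (f '' K)) {z₀ z₁ : Euc n} (h₀ : z₀ ∈ K) (h₁ : z₁ ∈ K) :
    ∃ γ : ℝ → Euc n, γ 0 = z₀ ∧ γ 1 = z₁ ∧
      ∀ t ∈ Icc (0 : ℝ) 1, γ t ∈ K ∧ f (γ t) = f z₀ + t • (f z₁ - f z₀) := by
  have hex : ∀ t ∈ Icc (0 : ℝ) 1, ∃ z ∈ K, f z = f z₀ + t • (f z₁ - f z₀) := fun t ht =>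
    h.add_smul_sub_mem ⟨z₀, h₀, rfl⟩ ⟨z₁, h₁, rfl⟩ ht
  choose! γ hγ hfγ using hex
  have m0 : (0 : ℝ) ∈ Icc (0 : ℝ) 1 := by simp
  have m1 : (1 : ℝ) ∈ Icc (0 : ℝ) 1 := by simp
  exact ⟨γ, hinj (hγ 0 m0) h₀ (by simp [hfγ 0 m0]), hinj (hγ 1 m1) h₁ (by simp [hfγ 1 m1]),
    fun t ht => ⟨hγ t ht, hfγ t ht⟩⟩

variable (hXo : IsOpen X) (hYo : IsOpen Y) (h0 : B0 X Y b) (h1 : B1 X Y b) (h2 : B2 X Y b)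
  (h3 : B3 X Y b)

include hXo hYo h0 h1 h3 in
/-- Along curves `x` whose marginal valuations `D_y b(x, y)` form an affine segment, (B3) says that
the second derivatives `D²_{yy} b(x, y)` are convex: only the direction of the curve through `y`
matters, since its acceleration contributes an affine term. -/
theorem iteratedDeriv_two_hessY_nonneg {γ : ℝ → Euc n} {y p w : Euc n} (hy : y ∈ Y)
    (hγ : ∀ t ∈ Icc (0 : ℝ) 1, γ t ∈ X ∧ gradY b (γ t) y = p + t • w) (η : Euc n) {s : ℝ}
    (hs : s ∈ Ioo (0 : ℝ) 1) : 0 ≤ iteratedDeriv 2 (fun t => hessY b η (γ t) y) s := by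
  have hyc := subset_closure hy
  have hγX := fun t ht => subset_closure (hγ t ht).1
  obtain ⟨-, hγd⟩ := (h1.2 y hyc).contDiffAt_of_segment hXo
    (fun z hz => contDiffAt_gradY_left (h0 z hz y hyc)) fun t ht => ⟨hγX t ht, (hγ t ht).2⟩
  have hsI := Ioo_subset_Icc_self hs
  obtain ⟨g, hg, hgy, hgl, hgr⟩ := (h1.1 (γ s) (hγX s hsI)).exists_local_inverse hYo hyc
    (contDiffAt_gradX_right (h0 _ (hγX s hsI) y hyc))
  set f : Euc n → Euc n := fun y' => gradX b (γ s) y' with hf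
  have hfd : DifferentiableAt ℝ f y :=
    (contDiffAt_gradX_right (h0 _ (hγX s hsI) y hyc)).differentiableAt (by simp)
  set z := fderiv ℝ f y η with hz
  -- the curve through `y` with velocity `η` that is a segment as seen from `γ s`
  have hline : ContinuousAt (fun r : ℝ => f y + r • z) 0 := by fun_prop
  have hline0 : f y + (0 : ℝ) • z = f y := by simp
  have hG : ContDiffAt ℝ 3 (fun r : ℝ => g (f y + r • z)) 0 :=
    ContDiffAt.comp 0 (g := g) (f := fun r : ℝ => f y + r • z) (by rwa [hline0]) (by fun_prop)
  have hG0 : g (f y + (0 : ℝ) • z) = y := by rw [hline0, hgy]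
  have hGd : HasDerivAt (fun r : ℝ => g (f y + r • z)) η 0 := by
    have e1 : HasDerivAt (fun r : ℝ => f y + r • z) z 0 := by
      simpa using ((hasDerivAt_id (0 : ℝ)).smul_const z).const_add (f y)
    have e2 : HasFDerivAt g (fderiv ℝ g (f y)) (f y + (0 : ℝ) • z) := by
      rw [hline0]; exact (hg.differentiableAt (by simp)).hasFDerivAt
    have e3 := e2.comp_hasDerivAt (0 : ℝ) e1
    have e4 : fderiv ℝ g (f y) z = η := by
      have e5 : fderiv ℝ (g ∘ f) y = ContinuousLinearMap.id ℝ (Euc n) := by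
        have : g ∘ f =ᶠ[𝓝 y] id := hgl
        rw [this.fderiv_eq, fderiv_id]
      rw [fderiv_comp y (hg.differentiableAt (by simp)) hfd] at e5
      simpa using congrArg (fun L => L η) e5
    rwa [e4] at e3
  have hev : ∀ᶠ r in 𝓝 (0 : ℝ), (s + r ∈ Icc (0 : ℝ) 1 ∧ g (f y + r • z) ∈ Y) ∧
      f (g (f y + r • z)) = f y + r • z := by
    refine Eventually.and (Eventually.and ?_ ?_) ?_
    · have : ContinuousAt (fun r : ℝ => s + r) 0 := by fun_prop
      exact this.eventually_mem (by simpa using Icc_mem_nhds hs.1 hs.2)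
    · exact hG.continuousAt.eventually_mem (by rw [hG0]; exact hYo.mem_nhds hy)
    · have e1 : Tendsto (fun r : ℝ => f y + r • z) (𝓝 0) (𝓝 (f y + (0 : ℝ) • z)) := hline
      rw [hline0] at e1
      exact e1.eventually hgr
  obtain ⟨δ, hδ, hball⟩ := Metric.eventually_nhds_iff.1 hev
  -- (B3) wants parameters in `[-1, 1]`, so both curves are slowed down by the factor `ε`
  set ε := δ / 2 with hε
  have hεpos : 0 < ε := half_pos hδ
  have hsmall : ∀ t ∈ Icc (-1 : ℝ) 1, dist (ε * t) 0 < δ := by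
    intro t ht
    rw [dist_zero_right, Real.norm_eq_abs, abs_mul, abs_of_pos hεpos]
    have : |t| ≤ 1 := abs_le.2 ht
    nlinarith
  have hseg : IsSegmentPair X Y b (fun σ => γ (s + ε * σ)) (fun τ => g (f y + (ε * τ) • z)) := by
    refine ⟨fun t ht => ?_, p + s • w, ε • w, f y, ε • z, fun t ht => ?_⟩
    · have := hball (hsmall t ht)
      exact ⟨hγX _ this.1.1, subset_closure this.1.2⟩
    · have := hball (hsmall t ht)
      simp only [mul_zero, add_zero, hG0]
      refine ⟨?_, ?_⟩
      · rw [(hγ _ this.1.1).2]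
        rw [add_smul, mul_smul, smul_comm, add_assoc]
      · rw [← smul_assoc, smul_eq_mul, mul_comm t ε]
        exact this.2
  have hB3 := h3 _ _ hseg
  set Γ : ℝ → Euc n := fun τ => g (f y + (ε * τ) • z) with hΓ
  have hΓ0 : Γ 0 = y := by simp only [hΓ, mul_zero, hG0]
  have hΓc : ContDiffAt ℝ 3 Γ 0 := by
    refine ContDiffAt.comp (0 : ℝ) (g := fun r : ℝ => g (f y + r • z)) (f := fun τ => ε * τ) ?_
      (by fun_prop)
    simpa using hG
  have hΓd : deriv Γ 0 = ε • η := by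
    have e1 : HasDerivAt (fun τ : ℝ => ε * τ) ε 0 := by
      simpa using (hasDerivAt_id (0 : ℝ)).const_mul ε
    exact (HasDerivAt.scomp (0 : ℝ) (g₁ := fun r : ℝ => g (f y + r • z)) (h := fun τ => ε * τ)
      (by simpa using hGd) e1).deriv
  set h : ℝ → ℝ := fun t => hessY b η (γ t) y with hh
  have hhd : ContDiffAt ℝ 2 h s :=
    ContDiffAt.comp s (g := fun p : Euc n × Euc n => hessY b η p.1 p.2) (f := fun t => (γ t, y))
      (contDiffAt_hessY (h0 _ (hγX s hsI) y hyc) η)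
      (((hγd s hs).of_le (by norm_num)).prodMk contDiffAt_const)
  set a := inner ℝ (p + s • w) (deriv (deriv Γ) 0)
  set β := ε * inner ℝ w (deriv (deriv Γ) 0)
  have hinner : (fun σ => iteratedDeriv 2 (fun τ => b (γ (s + ε * σ)) (Γ τ)) 0) =ᶠ[𝓝 0]
      fun σ => ε ^ 2 * h (s + ε * σ) + (a + σ * β) := by
    have : ∀ᶠ σ in 𝓝 (0 : ℝ), ε * σ ∈ Metric.ball (0 : ℝ) δ := by
      have hc : ContinuousAt (fun σ : ℝ => ε * σ) 0 := by fun_prop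
      exact hc.eventually_mem (by simpa using Metric.ball_mem_nhds (0 : ℝ) hδ)
    filter_upwards [this] with σ hσ
    have hm := (hball hσ).1.1
    have hbd : ContDiffAt ℝ 4 (Function.uncurry b) (γ (s + ε * σ), Γ 0) := by
      rw [hΓ0]; exact h0 _ (hγX _ hm) y hyc
    rw [iteratedDeriv_two_along hbd hΓc, hΓd, hessY_smul, hΓ0, (hγ _ hm).2]
    simp only [h, a, β, inner_add_left, real_inner_smul_left]
    ring
  have hcc : crossCurvature b (fun σ => γ (s + ε * σ)) Γ = ε ^ 4 * iteratedDeriv 2 h s := by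
    have e1 : ContDiffAt ℝ 2 (fun σ => h (s + ε * σ)) 0 :=
      ContDiffAt.comp (0 : ℝ) (g := h) (f := fun σ => s + ε * σ) (by simpa using hhd) (by fun_prop)
    rw [crossCurvature, hinner.iteratedDeriv_eq, iteratedDeriv_fun_add
      (contDiffAt_const.mul e1) (by fun_prop), iteratedDeriv_two_affine,
      iteratedDeriv_const_mul_field, iteratedDeriv_two_comp_affine]
    simp only [mul_zero, add_zero]
    ring
  rw [hcc] at hB3
  exact nonneg_of_mul_nonneg_right hB3 (by positivity)

include hXo hYo h0 h1 h2 h3 in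
/-- `D²_{yy} b(x, y)` is a convex function of `D_y b(x, y)` for interior points, which leave room for
the two-sided segments of (B3). -/
theorem hessY_le_of_mem {x₀ x₁ xs y : Euc n} (hy : y ∈ Y) (hx₀ : x₀ ∈ X) (hx₁ : x₁ ∈ X)
    (hxs : xs ∈ X) {s : ℝ} (hs : s ∈ Icc (0 : ℝ) 1)
    (he : gradY b xs y = gradY b x₀ y + s • (gradY b x₁ y - gradY b x₀ y)) (η : Euc n) :
    hessY b η xs y ≤ (1 - s) * hessY b η x₀ y + s * hessY b η x₁ y := by
  have hyc := subset_closure hy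
  have hinj := (h1.2 y hyc).injOn
  obtain ⟨γ, hγ0, hγ1, hγ⟩ := exists_curve_of_convex_image (hinj.mono subset_closure)
    (h2.1 y hyc) hx₀ hx₁
  obtain ⟨hγc, hγd⟩ := (h1.2 y hyc).contDiffAt_of_segment hXo
    (fun z hz => contDiffAt_gradY_left (h0 z hz y hyc))
    fun t ht => ⟨subset_closure (hγ t ht).1, (hγ t ht).2⟩
  have hd : ∀ t ∈ Icc (0 : ℝ) 1,
      ContDiffAt ℝ 2 (fun p : Euc n × Euc n => hessY b η p.1 p.2) (γ t, y) := fun t ht =>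
    contDiffAt_hessY (h0 _ (subset_closure (hγ t ht).1) y hyc) η
  have hd2 : ∀ t ∈ Ioo (0 : ℝ) 1, ContDiffAt ℝ 2 (fun t => hessY b η (γ t) y) t := fun t ht =>
    ContDiffAt.comp t (g := fun p : Euc n × Euc n => hessY b η p.1 p.2) (f := fun t => (γ t, y))
      (hd t (Ioo_subset_Icc_self ht)) (((hγd t ht).of_le (by norm_num)).prodMk contDiffAt_const)
  have hconv : ConvexOn ℝ (Icc (0 : ℝ) 1) fun t => hessY b η (γ t) y := by
    refine convexOn_of_deriv2_nonneg (convex_Icc 0 1) ?_ ?_ ?_ ?_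
    · intro t ht
      exact (ContinuousAt.comp_continuousWithinAt (x := t)
        (g := fun p : Euc n × Euc n => hessY b η p.1 p.2)
        (f := fun t => (γ t, y)) (hd t ht).continuousAt
        ((hγc t ht).prodMk continuousWithinAt_const))
    · rw [interior_Icc]
      exact fun t ht => ((hd2 t ht).differentiableAt (by simp)).differentiableWithinAt
    · rw [interior_Icc]
      intro t ht
      have e1 : ContDiffAt ℝ 1 (fun r => fderiv ℝ (fun t => hessY b η (γ t) y) r 1) t :=
        ((hd2 t ht).fderiv_right (m := 1) (by norm_num)).clm_apply contDiffAt_const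
      simp only [fderiv_apply_one_eq_deriv] at e1
      exact (e1.differentiableAt one_ne_zero).differentiableWithinAt
    · rw [interior_Icc]
      intro t ht
      have := iteratedDeriv_two_hessY_nonneg hXo hYo h0 h1 h3 hy hγ η ht
      rwa [iteratedDeriv_two] at this
  have hxs' : γ s = xs :=
    hinj (subset_closure (hγ s hs).1) (subset_closure hxs) (by
      simp only
      rw [(hγ s hs).2, he])
  have := hconv.2 (left_mem_Icc.2 zero_le_one) (right_mem_Icc.2 zero_le_one)
    (sub_nonneg.2 hs.2) hs.1 (sub_add_cancel 1 s)
  simpa [hγ0, hγ1, hxs'] using this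

theorem tendsto_hessY {x y : Euc n} (h : ContDiffAt ℝ 4 (Function.uncurry b) (x, y)) (η : Euc n)
    {xs ys : ℕ → Euc n} (hl : Tendsto (fun k => (xs k, ys k)) atTop (𝓝 (x, y))) :
    Tendsto (fun k => hessY b η (xs k) (ys k)) atTop (𝓝 (hessY b η x y)) := by
  have h1 : ContinuousAt (fun p : Euc n × Euc n => hessY b η p.1 p.2) (x, y) :=
    (contDiffAt_hessY h η).continuousAt
  have h2 := Tendsto.comp (g := fun p : Euc n × Euc n => hessY b η p.1 p.2) h1.tendsto hl
  simpa only [Function.comp_def] using h2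

include hXo hYo h0 h1 h2 h3 in
/-- `D²_{yy} b(x, y)` is a convex function of `D_y b(x, y)`, up to the boundary. For boundary points
this follows by approximation, where (B2) provides the intermediate points `zs`. -/
theorem hessY_le (hX : IsCompact (closure X)) {x₀ x₁ xs y : Euc n} (hy : y ∈ closure Y)
    (hx₀ : x₀ ∈ closure X) (hx₁ : x₁ ∈ closure X)
    (hxs : xs ∈ closure X) {s : ℝ} (hs : s ∈ Icc (0 : ℝ) 1)
    (he : gradY b xs y = gradY b x₀ y + s • (gradY b x₁ y - gradY b x₀ y)) (η : Euc n) :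
    hessY b η xs y ≤ (1 - s) * hessY b η x₀ y + s * hessY b η x₁ y := by
  obtain ⟨ys, hys, hylim⟩ := mem_closure_iff_seq_limit.1 hy
  obtain ⟨x₀s, hx₀s, hx₀lim⟩ := mem_closure_iff_seq_limit.1 hx₀
  obtain ⟨x₁s, hx₁s, hx₁lim⟩ := mem_closure_iff_seq_limit.1 hx₁
  have hex : ∀ k, ∃ x ∈ X, gradY b x (ys k) =
      gradY b (x₀s k) (ys k) + s • (gradY b (x₁s k) (ys k) - gradY b (x₀s k) (ys k)) := fun k =>
    (h2.1 (ys k) (subset_closure (hys k))).add_smul_sub_mem ⟨_, hx₀s k, rfl⟩ ⟨_, hx₁s k, rfl⟩ hs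
  choose zs hzs hze using hex
  obtain ⟨z, hz, φ, hφ, hzlim⟩ := hX.tendsto_subseq fun k => subset_closure (hzs k)
  have hφt := hφ.tendsto_atTop
  have hl0 : Tendsto (fun k => (x₀s (φ k), ys (φ k))) atTop (𝓝 (x₀, y)) :=
    (hx₀lim.comp hφt).prodMk_nhds (hylim.comp hφt)
  have hl1 : Tendsto (fun k => (x₁s (φ k), ys (φ k))) atTop (𝓝 (x₁, y)) :=
    (hx₁lim.comp hφt).prodMk_nhds (hylim.comp hφt)
  have hlz : Tendsto (fun k => (zs (φ k), ys (φ k))) atTop (𝓝 (z, y)) :=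
    hzlim.prodMk_nhds (hylim.comp hφt)
  have hg : ∀ x ∈ closure X, ∀ xk : ℕ → Euc n,
      Tendsto (fun k => (xk k, ys (φ k))) atTop (𝓝 (x, y)) →
      Tendsto (fun k => gradY b (xk k) (ys (φ k))) atTop (𝓝 (gradY b x y)) := fun x hx xk hl =>
    (contDiffAt_gradY (h0 x hx y hy)).continuousAt.tendsto.comp hl
  have hH : ∀ x ∈ closure X, ∀ xk : ℕ → Euc n,
      Tendsto (fun k => (xk k, ys (φ k))) atTop (𝓝 (x, y)) →
      Tendsto (fun k => hessY b η (xk k) (ys (φ k))) atTop (𝓝 (hessY b η x y)) :=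
    fun x hx xk hl => tendsto_hessY (h0 x hx y hy) η hl
  have hzx : z = xs := by
    refine (h1.2 y hy).injOn hz hxs (Eq.trans ?_ he.symm)
    have e0 := hg x₀ hx₀ _ hl0
    have e1 := hg x₁ hx₁ _ hl1
    have e2 : ∀ k, gradY b (x₀s (φ k)) (ys (φ k)) + s • (gradY b (x₁s (φ k)) (ys (φ k)) -
        gradY b (x₀s (φ k)) (ys (φ k))) = gradY b (zs (φ k)) (ys (φ k)) := fun k =>
      (hze (φ k)).symm
    exact tendsto_nhds_unique (hg z hz _ hlz) ((e0.add ((e1.sub e0).const_smul s)).congr e2)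
  rw [← hzx]
  exact le_of_tendsto_of_tendsto (hH z hz _ hlz)
    (((hH x₀ hx₀ _ hl0).const_mul (1 - s)).add ((hH x₁ hx₁ _ hl1).const_mul s))
    (Eventually.of_forall fun k => hessY_le_of_mem hXo hYo h0 h1 h2 h3 (hys (φ k)) (hx₀s (φ k))
      (hx₁s (φ k)) (hzs (φ k)) hs (hze (φ k)) η)

end CrossCurvature

/-! ### Convexity of valuation differences along segments of marginal utilities -/

section ValuationDifferences

variable {n : ℕ} {X Y : Set (Euc n)} {b : Euc n → Euc n → ℝ}

variable (hXo : IsOpen X) (hYo : IsOpen Y) (hX : IsCompact (closure X)) (h0 : B0 X Y b)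
  (h1 : B1 X Y b) (h2 : B2 X Y b) (h3 : B3 X Y b)

include hXo hX h0 h1 h2 in
/-- From `x` in the direction of `x₀` there starts a smooth curve with affine `D_y b(·, y)`. If `x`
is a boundary point, the curve is in `closure X` only for positive times. -/
theorem exists_curve_toward {x x₀ y : Euc n} (hx : x ∈ closure X) (hx₀ : x₀ ∈ closure X)
    (hy : y ∈ closure Y) :
    ∃ ξ : ℝ → Euc n, ContDiffAt ℝ 3 ξ 0 ∧ ξ 0 = x ∧
      (∀ᶠ s in 𝓝 (0 : ℝ), gradY b (ξ s) y = gradY b x y + s • (gradY b x₀ y - gradY b x y)) ∧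
      ∀ᶠ s in 𝓝[>] (0 : ℝ), ξ s ∈ closure X := by
  set f : Euc n → Euc n := fun x' => gradY b x' y with hf
  have hdiff : IsDiffeoOntoRange f (closure X) := h1.2 y hy
  have hfc : ∀ z ∈ closure X, ContDiffAt ℝ 3 f z := fun z hz =>
    contDiffAt_gradY_left (h0 z hz y hy)
  obtain ⟨g, hg, hgx, hgl, hgr⟩ := hdiff.exists_local_inverse hXo hx (hfc x hx)
  obtain ⟨γ, hγ0, -, hγ⟩ := exists_curve_of_convex_image hdiff.injOn
    (convex_image_closure hX hdiff.continuousOn (h2.1 y hy)) hx hx₀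
  obtain ⟨hγc, -⟩ := hdiff.contDiffAt_of_segment hXo hfc hγ
  have hline0 : f x + (0 : ℝ) • (f x₀ - f x) = f x := by simp
  have hlin : Tendsto (fun s : ℝ => f x + s • (f x₀ - f x)) (𝓝 0) (𝓝 (f x)) := by
    have : ContinuousAt (fun s : ℝ => f x + s • (f x₀ - f x)) 0 := by fun_prop
    rw [ContinuousAt, hline0] at this
    exact this
  refine ⟨fun s => g (f x + s • (f x₀ - f x)), ?_, by simp only [hline0, hgx], hlin.eventually hgr,
    ?_⟩
  · exact ContDiffAt.comp (0 : ℝ) (g := g) (f := fun s : ℝ => f x + s • (f x₀ - f x))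
      (by rwa [hline0]) (by fun_prop)
  · have hIcc : Icc (0 : ℝ) 1 ∈ 𝓝[>] (0 : ℝ) := Icc_mem_nhdsGT one_pos
    have hγt : Tendsto γ (𝓝[>] (0 : ℝ)) (𝓝 x) := by
      have h4 : Tendsto γ (𝓝[Icc 0 1] (0 : ℝ)) (𝓝 (γ 0)) := hγc 0 (by simp)
      rw [hγ0] at h4
      exact h4.mono_left (nhdsWithin_le_of_mem hIcc)
    filter_upwards [hγt.eventually hgl, hIcc] with s hs hsI
    rw [← (hγ s hsI).2, hs]
    exact (hγ s hsI).1

section Curve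

variable {γ : ℝ → Euc n} {x q z : Euc n} (hx : x ∈ closure X)
  (hγ : ∀ t ∈ Icc (0 : ℝ) 1, γ t ∈ closure Y ∧ gradX b x (γ t) = q + t • z)
  {t : ℝ} (ht : t ∈ Ioo (0 : ℝ) 1)

include hYo h0 h1 hx hγ in
theorem contDiffAt_of_gradX_segment :
    ContinuousOn γ (Icc 0 1) ∧ ∀ t ∈ Ioo (0 : ℝ) 1, ContDiffAt ℝ 3 γ t :=
  (h1.1 x hx).contDiffAt_of_segment hYo
    (fun y hy => contDiffAt_gradX_right (h0 x hx y hy)) hγ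

include hYo h0 h1 hx hγ ht in
/-- The mixed derivative `∂_s ∂_t² b(ξ(s), γ(t))` vanishes at `s = 0`, where `γ` is a segment as seen
from `ξ(0)`: there `∂_s b(ξ(s), γ(t)) = D_x b(ξ(0), γ(t)) · ξ'(0)` is affine in `t`. -/
theorem hasDerivAt_iteratedDeriv_two_zero {ξ : ℝ → Euc n} (hξ : ContDiffAt ℝ 3 ξ 0)
    (hξ0 : ξ 0 = x) :
    HasDerivAt (fun s => iteratedDeriv 2 (fun t => b (ξ s) (γ t)) t) 0 0 := by
  have hγd := (contDiffAt_of_gradX_segment hYo h0 h1 hx hγ).2 t ht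
  have hΨ : ContDiffAt ℝ 3 (Function.uncurry fun s t => b (ξ s) (γ t)) (0, t) := by
    refine ContDiffAt.comp ((0 : ℝ), t) (g := Function.uncurry b)
      (f := fun p : ℝ × ℝ => (ξ p.1, γ p.2)) ?_ ?_
    · simp only [hξ0]
      exact (h0 x hx _ (hγ t (Ioo_subset_Icc_self ht)).1).of_le (by norm_num)
    · exact (ContDiffAt.comp ((0 : ℝ), t) (g := ξ) hξ contDiffAt_fst).prodMk
        (ContDiffAt.comp ((0 : ℝ), t) (g := γ) hγd contDiffAt_snd)
  have key := hasDerivAt_iteratedDeriv_two_swap hΨ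
  have hev : (fun t => deriv (fun s => b (ξ s) (γ t)) 0) =ᶠ[𝓝 t]
      fun t => inner ℝ q (deriv ξ 0) + t * inner ℝ z (deriv ξ 0) := by
    filter_upwards [Icc_mem_nhds ht.1 ht.2] with r hr
    have hbd : DifferentiableAt ℝ (Function.uncurry b) (ξ 0, γ r) := by
      rw [hξ0]; exact (h0 x hx _ (hγ r hr).1).differentiableAt (by simp)
    have e : HasDerivAt (fun s => (ξ s, γ r)) (deriv ξ 0, 0) 0 :=
      ((hξ.differentiableAt (by simp)).hasDerivAt).prodMk (hasDerivAt_const _ _)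
    have e2 : HasDerivAt (fun s => b (ξ s) (γ r))
        (fderiv ℝ (Function.uncurry b) (ξ 0, γ r) (deriv ξ 0, 0)) 0 :=
      HasFDerivAt.comp_hasDerivAt (0 : ℝ) (l := Function.uncurry b) hbd.hasFDerivAt e
    rw [e2.deriv, ← inner_gradX hbd, hξ0, (hγ r hr).2, inner_add_left, real_inner_smul_left]
  rwa [hev.iteratedDeriv_eq, iteratedDeriv_two_affine] at key

include hXo hYo hX h0 h1 h2 h3 hx hγ ht in
/-- `∂_t² b(x, γ(t))` is a convex function of `D_y b(x, γ(t))`. -/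
theorem iteratedDeriv_two_le {x₀ xs : Euc n} (hx₀ : x₀ ∈ closure X) (hxs : xs ∈ closure X) {s : ℝ}
    (hs : s ∈ Icc (0 : ℝ) 1)
    (he : gradY b xs (γ t) = gradY b x (γ t) + s • (gradY b x₀ (γ t) - gradY b x (γ t))) :
    iteratedDeriv 2 (fun t => b xs (γ t)) t ≤ iteratedDeriv 2 (fun t => b x (γ t)) t +
      s * (iteratedDeriv 2 (fun t => b x₀ (γ t)) t - iteratedDeriv 2 (fun t => b x (γ t)) t) := by
  have hγd := (contDiffAt_of_gradX_segment hYo h0 h1 hx hγ).2 t ht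
  have hy := (hγ t (Ioo_subset_Icc_self ht)).1
  rw [iteratedDeriv_two_along (h0 _ hxs _ hy) hγd, iteratedDeriv_two_along (h0 _ hx _ hy) hγd,
    iteratedDeriv_two_along (h0 _ hx₀ _ hy) hγd]
  have := hessY_le hXo hYo h0 h1 h2 h3 hX hy hx hx₀ hxs hs he (deriv γ t)
  have e : inner ℝ (gradY b xs (γ t)) (deriv (deriv γ) t) =
      inner ℝ (gradY b x (γ t)) (deriv (deriv γ) t) +
        s * (inner ℝ (gradY b x₀ (γ t)) (deriv (deriv γ) t) -
          inner ℝ (gradY b x (γ t)) (deriv (deriv γ) t)) := by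
    rw [he, inner_add_left, real_inner_smul_left, inner_sub_left]
  rw [e]
  linarith

include hXo hYo hX h0 h1 h2 h3 hx hγ ht in
/-- Second derivatives of `b(x₀, ·) - b(x, ·)` along segments as seen from `x` are non-negative:
`s ↦ ∂_t² b(ξ(s), γ(t))` is convex and has vanishing derivative at `s = 0`. -/
theorem iteratedDeriv_two_le_of_segment {x₀ : Euc n} (hx₀ : x₀ ∈ closure X) :
    iteratedDeriv 2 (fun t => b x (γ t)) t ≤ iteratedDeriv 2 (fun t => b x₀ (γ t)) t := by
  have hy := (hγ t (Ioo_subset_Icc_self ht)).1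
  obtain ⟨ξ, hξ, hξ0, hξe, hξX⟩ := exists_curve_toward hXo hX h0 h1 h2 hx hx₀ hy
  have hd := hasDerivAt_iteratedDeriv_two_zero hYo h0 h1 hx hγ ht hξ hξ0
  have hslope := (hasDerivAt_iff_tendsto_slope.1 hd).mono_left
    (nhdsWithin_mono (0 : ℝ) (fun s (hs : s ∈ Ioi (0 : ℝ)) => ne_of_gt hs))
  refine sub_nonneg.1 (le_of_tendsto hslope ?_)
  filter_upwards [hξX, nhdsWithin_le_nhds hξe, Ioc_mem_nhdsGT (one_pos (α := ℝ))] with s hs hse hsI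
  have := iteratedDeriv_two_le hXo hYo hX h0 h1 h2 h3 hx hγ ht hx₀ hs ⟨hsI.1.le, hsI.2⟩ hse
  rw [slope_def_field, hξ0, sub_zero, div_le_iff₀ hsI.1]
  linarith

include hXo hYo hX h0 h1 h2 h3 hγ ht in
/-- Under (B3u), the second derivative is positive. Here `x` has to be an interior point, but `γ` may
run along the boundary of `Y`. -/
theorem iteratedDeriv_two_lt_of_segment (h3u : B3u X Y b) (hxX : x ∈ X) (hz : z ≠ 0) {x₀ : Euc n}
    (hx₀ : x₀ ∈ closure X) (hne : x₀ ≠ x) :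
    iteratedDeriv 2 (fun t => b x (γ t)) t < iteratedDeriv 2 (fun t => b x₀ (γ t)) t := by
  have hx := subset_closure hxX
  have htI := Ioo_subset_Icc_self ht
  have hy := (hγ t htI).1
  have hγd := (contDiffAt_of_gradX_segment hYo h0 h1 hx hγ).2
  obtain ⟨ξ, hξ, hξ0, hξe, hξX⟩ := exists_curve_toward hXo hX h0 h1 h2 hx hx₀ hy
  set w := gradY b x₀ (γ t) - gradY b x (γ t) with hw
  have hw0 : w ≠ 0 := fun h => hne ((h1.2 _ hy).injOn hx₀ hx (sub_eq_zero.1 h))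
  have hd := hasDerivAt_iteratedDeriv_two_zero hYo h0 h1 hx hγ ht hξ hξ0
  set k : ℝ → ℝ := fun s => iteratedDeriv 2 (fun t => b (ξ s) (γ t)) t with hk
  -- neither curve is stationary
  have hξ' : deriv ξ 0 ≠ 0 := by
    intro h
    have e1 : HasDerivAt (fun s => gradY b (ξ s) (γ t))
        (fderiv ℝ (fun x' => gradY b x' (γ t)) (ξ 0) (deriv ξ 0)) 0 := by
      refine HasFDerivAt.comp_hasDerivAt (0 : ℝ) (l := fun x' => gradY b x' (γ t)) ?_
        (hξ.differentiableAt (by simp)).hasDerivAt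
      rw [hξ0]
      exact ((contDiffAt_gradY_left (h0 x hx _ hy)).differentiableAt (by simp)).hasFDerivAt
    have e2 : HasDerivAt (fun s : ℝ => gradY b x (γ t) + s • w) w 0 := by
      simpa using ((hasDerivAt_id (0 : ℝ)).smul_const w).const_add (gradY b x (γ t))
    rw [h, map_zero] at e1
    exact hw0 (e2.unique (e1.congr_of_eventuallyEq (EventuallyEq.symm hξe)))
  have hγ' : deriv γ t ≠ 0 := by
    intro h
    have e1 : HasDerivAt (fun s => gradX b x (γ s))
        (fderiv ℝ (fun y' => gradX b x y') (γ t) (deriv γ t)) t :=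
      HasFDerivAt.comp_hasDerivAt t (l := fun y' => gradX b x y')
        ((contDiffAt_gradX_right (h0 x hx _ hy)).differentiableAt (by simp)).hasFDerivAt
        ((hγd t ht).differentiableAt (by simp)).hasDerivAt
    have e2 : HasDerivAt (fun s : ℝ => q + s • z) z t := by
      simpa using ((hasDerivAt_id t).smul_const z).const_add q
    have e3 : (fun s : ℝ => q + s • z) =ᶠ[𝓝 t] fun s => gradX b x (γ s) := by
      filter_upwards [Icc_mem_nhds ht.1 ht.2] with s hs using (hγ s hs).2.symm
    rw [h, map_zero] at e1
    exact hz (e2.unique (e1.congr_of_eventuallyEq e3))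
  have hev : ∀ᶠ r in 𝓝 (0 : ℝ), (ξ r ∈ X ∧ t + r ∈ Icc (0 : ℝ) 1) ∧
      gradY b (ξ r) (γ t) = gradY b x (γ t) + r • w := by
    refine Eventually.and (Eventually.and ?_ ?_) hξe
    · exact hξ.continuousAt.eventually_mem (by rw [hξ0]; exact hXo.mem_nhds hxX)
    · have : ContinuousAt (fun r : ℝ => t + r) 0 := by fun_prop
      exact this.eventually_mem (by simpa using Icc_mem_nhds ht.1 ht.2)
  obtain ⟨δ, hδ, hball⟩ := Metric.eventually_nhds_iff.1 hev
  set ε := δ / 2 with hε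
  have hεpos : 0 < ε := half_pos hδ
  have hsmall : ∀ σ ∈ Icc (-1 : ℝ) 1, dist (ε * σ) 0 < δ := by
    intro σ hσ
    rw [dist_zero_right, Real.norm_eq_abs, abs_mul, abs_of_pos hεpos]
    have : |σ| ≤ 1 := abs_le.2 hσ
    nlinarith
  have hseg : IsSegmentPair X Y b (fun σ => ξ (0 + ε * σ)) (fun τ => γ (t + ε * τ)) := by
    refine ⟨fun σ hσ => ?_, gradY b x (γ t), ε • w, q + t • z, ε • z, fun σ hσ => ?_⟩
    · have := (hball (hsmall σ hσ)).1
      simp only [zero_add]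
      exact ⟨subset_closure this.1, (hγ _ this.2).1⟩
    · have := hball (hsmall σ hσ)
      simp only [mul_zero, add_zero, zero_add, hξ0]
      rw [this.2, (hγ _ this.1.2).2]
      constructor
      · rw [← smul_assoc, smul_eq_mul, mul_comm]
      · rw [add_smul, mul_smul, smul_comm, add_assoc]
  have hcomp : ∀ {f : ℝ → Euc n} {s : ℝ}, deriv f s ≠ 0 →
      deriv (fun σ => f (s + ε * σ)) 0 ≠ 0 := by
    intro f s hf
    rw [deriv_comp_mul_left ε (fun σ => f (s + σ)) 0, deriv_comp_const_add, mul_zero, add_zero]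
    exact smul_ne_zero hεpos.ne' hf
  have hpos := h3u _ _ hseg (hcomp hξ') (hcomp hγ')
  have hcc : crossCurvature b (fun σ => ξ (0 + ε * σ)) (fun τ => γ (t + ε * τ)) =
      ε ^ 4 * iteratedDeriv 2 k 0 := by
    have e1 : ∀ σ, iteratedDeriv 2 (fun τ => b (ξ (0 + ε * σ)) (γ (t + ε * τ))) 0 =
        ε ^ 2 * k (0 + ε * σ) := fun σ => by
      rw [iteratedDeriv_two_comp_affine (fun τ => b (ξ (0 + ε * σ)) (γ τ)), mul_zero, add_zero]
    rw [crossCurvature, funext e1, iteratedDeriv_const_mul_field, iteratedDeriv_two_comp_affine]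
    simp only [mul_zero, add_zero]
    ring
  rw [hcc] at hpos
  have hk2 : 0 < deriv (deriv k) 0 := by
    rw [← iteratedDeriv_two]
    exact pos_of_mul_pos_right hpos (by positivity)
  -- hence `k` is strictly increasing to the right of `0`
  have hsign : ∀ᶠ s in 𝓝 (0 : ℝ), SignType.sign (deriv k s) = SignType.sign (s - 0) :=
    eventually_nhdsWithin_sign_eq_of_deriv_pos hk2 hd.deriv
  obtain ⟨ρ, hρ, hρsign⟩ := Metric.eventually_nhds_iff.1 hsign
  have hdpos : ∀ s ∈ Ioo (0 : ℝ) ρ, 0 < deriv k s := by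
    intro s hs
    have h4 := hρsign (show dist s 0 < ρ by
      rw [dist_zero_right, Real.norm_eq_abs, abs_of_pos hs.1]; exact hs.2)
    rw [sub_zero, sign_pos hs.1] at h4
    exact sign_eq_one_iff.1 h4
  have hmono : StrictMonoOn k (Ico 0 ρ) := by
    refine strictMonoOn_of_deriv_pos (convex_Ico 0 ρ) ?_ ?_
    · intro s hs
      rcases hs.1.eq_or_lt with h | h
      · rw [← h]
        exact hd.continuousAt.continuousWithinAt
      · exact (differentiableAt_of_deriv_ne_zero
          (hdpos s ⟨h, hs.2⟩).ne').continuousAt.continuousWithinAt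
    · rw [interior_Ico]
      exact hdpos
  obtain ⟨s, ⟨⟨hs, hse⟩, hsI⟩, hsρ⟩ := (((hξX.and (nhdsWithin_le_nhds hξe)).and
    (Ioc_mem_nhdsGT (one_pos (α := ℝ)))).and (Ioo_mem_nhdsGT hρ)).exists
  have h5 := iteratedDeriv_two_le hXo hYo hX h0 h1 h2 h3 hx hγ ht hx₀ hs ⟨hsI.1.le, hsI.2⟩ hse
  have h6 : k 0 < k s := hmono ⟨le_rfl, hρ⟩ ⟨hsρ.1.le, hsρ.2⟩ hsρ.1
  simp only [hk, hξ0] at h6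
  have h7 : 0 < s * (iteratedDeriv 2 (fun t => b x₀ (γ t)) t -
      iteratedDeriv 2 (fun t => b x (γ t)) t) := by linarith
  linarith [pos_of_mul_pos_right h7 hsI.1.le]

end Curve

include hYo h0 h1 in
theorem diff_along_segment {γ : ℝ → Euc n} {x x₀ q z : Euc n} (hx : x ∈ closure X)
    (hx₀ : x₀ ∈ closure X)
    (hγ : ∀ t ∈ Icc (0 : ℝ) 1, γ t ∈ closure Y ∧ gradX b x (γ t) = q + t • z) :
    ContinuousOn (fun t => b x₀ (γ t) - b x (γ t)) (Icc 0 1) ∧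
    ∀ t ∈ Ioo (0 : ℝ) 1, ContDiffAt ℝ 2 (fun t => b x₀ (γ t) - b x (γ t)) t ∧
      iteratedDeriv 2 (fun t => b x₀ (γ t) - b x (γ t)) t =
        iteratedDeriv 2 (fun t => b x₀ (γ t)) t - iteratedDeriv 2 (fun t => b x (γ t)) t := by
  obtain ⟨hγc, hγd⟩ := contDiffAt_of_gradX_segment hYo h0 h1 hx hγ
  have hmaps : MapsTo γ (Icc (0 : ℝ) 1) (closure Y) := fun t ht => (hγ t ht).1
  refine ⟨((continuousOn_section_right h0.continuousOn hx₀).comp hγc hmaps).sub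
    ((continuousOn_section_right h0.continuousOn hx).comp hγc hmaps), fun t ht => ?_⟩
  have hd : ∀ x' ∈ closure X, ContDiffAt ℝ 2 (fun t => b x' (γ t)) t := fun x' hx' =>
    ContDiffAt.comp t (g := Function.uncurry b) (f := fun t => (x', γ t))
      ((h0 x' hx' _ (hγ t (Ioo_subset_Icc_self ht)).1).of_le (by norm_num))
      (contDiffAt_const.prodMk ((hγd t ht).of_le (by norm_num)))
  exact ⟨(hd x₀ hx₀).sub (hd x hx), iteratedDeriv_fun_sub (hd x₀ hx₀) (hd x hx)⟩

theorem segment_midpoint_eq {γ : ℝ → Euc n} {x y₀ y₁ m : Euc n}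
    (hinj : InjOn (fun y => gradX b x y) (closure Y)) (hm : m ∈ closure Y)
    (he : gradX b x m = (1 / 2 : ℝ) • gradX b x y₀ + (1 / 2 : ℝ) • gradX b x y₁)
    (hγ : ∀ t ∈ Icc (0 : ℝ) 1, γ t ∈ closure Y ∧
      gradX b x (γ t) = gradX b x y₀ + t • (gradX b x y₁ - gradX b x y₀)) :
    γ (1 / 2) = m := by
  have h12 : (1 / 2 : ℝ) ∈ Icc (0 : ℝ) 1 := by constructor <;> norm_num
  refine hinj (hγ _ h12).1 hm ?_
  simp only
  rw [he, (hγ _ h12).2]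
  module

include hXo hYo hX h0 h1 h2 h3 in
/-- Valuation differences `b(x₀, ·) - b(x, ·)` are convex functions of the marginal utility
`D_x b(x, ·)`. -/
theorem valuation_diff_midpoint_le (hY : IsCompact (closure Y)) {x x₀ y₀ y₁ m : Euc n}
    (hx : x ∈ closure X) (hx₀ : x₀ ∈ closure X) (hy₀ : y₀ ∈ closure Y) (hy₁ : y₁ ∈ closure Y)
    (hm : m ∈ closure Y)
    (he : gradX b x m = (1 / 2 : ℝ) • gradX b x y₀ + (1 / 2 : ℝ) • gradX b x y₁) :
    b x₀ m - b x m ≤ 1 / 2 * (b x₀ y₀ - b x y₀) + 1 / 2 * (b x₀ y₁ - b x y₁) := by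
  have hdiff := h1.1 x hx
  obtain ⟨γ, hγ0, hγ1, hγ⟩ := exists_curve_of_convex_image hdiff.injOn
    (convex_image_closure hY hdiff.continuousOn (h2.2 x hx)) hy₀ hy₁
  obtain ⟨hc, hd⟩ := diff_along_segment hYo h0 h1 hx hx₀ hγ
  have hconv : ConvexOn ℝ (Icc (0 : ℝ) 1) fun t => b x₀ (γ t) - b x (γ t) := by
    refine convexOn_of_deriv2_nonneg (convex_Icc 0 1) hc ?_ ?_ ?_
    · rw [interior_Icc]
      exact fun t ht => ((hd t ht).1.differentiableAt (by simp)).differentiableWithinAt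
    · rw [interior_Icc]
      intro t ht
      have e1 : ContDiffAt ℝ 1 (fun r => fderiv ℝ (fun t => b x₀ (γ t) - b x (γ t)) r 1) t :=
        ((hd t ht).1.fderiv_right (m := 1) (by norm_num)).clm_apply contDiffAt_const
      simp only [fderiv_apply_one_eq_deriv] at e1
      exact (e1.differentiableAt one_ne_zero).differentiableWithinAt
    · rw [interior_Icc]
      intro t ht
      have e1 := iteratedDeriv_two_le_of_segment hXo hYo hX h0 h1 h2 h3 hx hγ ht hx₀
      have e2 := (hd t ht).2
      rw [iteratedDeriv_two] at e2
      exact (sub_nonneg.2 e1).trans_eq e2.symm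
  have := hconv.2 (left_mem_Icc.2 zero_le_one) (right_mem_Icc.2 zero_le_one)
    (by norm_num : (0 : ℝ) ≤ 1 / 2) (by norm_num : (0 : ℝ) ≤ 1 / 2) (by norm_num)
  have hmid : (1 / 2 : ℝ) • (0 : ℝ) + (1 / 2 : ℝ) • (1 : ℝ) = 1 / 2 := by norm_num
  rw [hmid] at this
  simpa only [hγ0, hγ1, segment_midpoint_eq hdiff.injOn hm he hγ, smul_eq_mul] using this

include hXo hYo hX h0 h1 h2 h3 in
/-- Under (B3u), the convexity is strict for agents `x` in the interior. -/
theorem valuation_diff_midpoint_lt (hY : IsCompact (closure Y)) (h3u : B3u X Y b)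
    {x x₀ y₀ y₁ m : Euc n} (hxX : x ∈ X) (hx₀ : x₀ ∈ closure X) (hne : x₀ ≠ x)
    (hy₀ : y₀ ∈ closure Y) (hy₁ : y₁ ∈ closure Y) (hyne : y₀ ≠ y₁) (hm : m ∈ closure Y)
    (he : gradX b x m = (1 / 2 : ℝ) • gradX b x y₀ + (1 / 2 : ℝ) • gradX b x y₁) :
    b x₀ m - b x m < 1 / 2 * (b x₀ y₀ - b x y₀) + 1 / 2 * (b x₀ y₁ - b x y₁) := by
  have hx := subset_closure hxX
  have hdiff := h1.1 x hx
  obtain ⟨γ, hγ0, hγ1, hγ⟩ := exists_curve_of_convex_image hdiff.injOn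
    (convex_image_closure hY hdiff.continuousOn (h2.2 x hx)) hy₀ hy₁
  obtain ⟨hc, hd⟩ := diff_along_segment hYo h0 h1 hx hx₀ hγ
  have hz : gradX b x y₁ - gradX b x y₀ ≠ 0 := fun h =>
    hyne (hdiff.injOn hy₁ hy₀ (sub_eq_zero.1 h)).symm
  have hconv : StrictConvexOn ℝ (Icc (0 : ℝ) 1) fun t => b x₀ (γ t) - b x (γ t) := by
    refine strictConvexOn_of_deriv2_pos (convex_Icc 0 1) hc ?_
    rw [interior_Icc]
    intro t ht
    have e1 := iteratedDeriv_two_lt_of_segment hXo hYo hX h0 h1 h2 h3 hγ ht h3u hxX hz hx₀ hne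
    have e2 := (hd t ht).2
    rw [iteratedDeriv_two] at e2
    exact (sub_pos.2 e1).trans_eq e2.symm
  have := hconv.2 (left_mem_Icc.2 zero_le_one) (right_mem_Icc.2 zero_le_one) zero_ne_one
    (by norm_num : (0 : ℝ) < 1 / 2) (by norm_num : (0 : ℝ) < 1 / 2) (by norm_num)
  have hmid : (1 / 2 : ℝ) • (0 : ℝ) + (1 / 2 : ℝ) • (1 : ℝ) = 1 / 2 := by norm_num
  rw [hmid] at this
  simpa only [hγ0, hγ1, segment_midpoint_eq hdiff.injOn hm he hγ, smul_eq_mul] using this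

end ValuationDifferences

/-! ### Uniqueness of optimal strategies -/

section Uniqueness

variable {n : ℕ} {X Y : Set (Euc n)} {b : Euc n → Euc n → ℝ} {c u v : Euc n → ℝ}
  {μ : Measure (Euc n)} {y₀ : Euc n}

theorem UniquenessHypotheses.nonempty (h : UniquenessHypotheses X Y b c μ) : X.Nonempty := by
  have := h.prob
  obtain ⟨x, hx⟩ := (ae_mem_of_compl h.supp).exists
  exact ⟨x, hx⟩

theorem UniquenessHypotheses.cost_isConjugatePair (h : UniquenessHypotheses X Y b c μ)
    (hX : IsCompact (closure X)) (hY : IsCompact (closure Y)) (hYn : (closure Y).Nonempty) :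
    IsConjugatePair X Y b (bTransform Y b c) c :=
  h.cost.isConjugatePair hX hY h.b0.continuousOn h.nonempty.closure hYn

theorem UniquenessHypotheses.continuousOn_cost (h : UniquenessHypotheses X Y b c μ)
    (hX : IsCompact (closure X)) (hY : IsCompact (closure Y)) (hYn : (closure Y).Nonempty) :
    ContinuousOn c (closure Y) :=
  (h.cost_isConjugatePair hX hY hYn).continuousOn_right hX hY h.b0.continuousOn

/-- The participation constraint says that the null product is sold at most at its cost. -/
theorem mem_feasible_iff (hX : IsCompact (closure X)) (hY : IsCompact (closure Y))
    (hb : ContinuousOn (Function.uncurry b) (closure X ×ˢ closure Y)) (hXn : (closure X).Nonempty)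
    (hy₀ : y₀ ∈ closure Y) :
    u ∈ feasible X Y y₀ b c ↔ IsBConvex X Y b u ∧ bStarTransform X b u y₀ ≤ c y₀ := by
  refine and_congr_right fun hu => ?_
  have hcp := hu.isConjugatePair hX hY hb hXn ⟨y₀, hy₀⟩
  constructor
  · intro h
    obtain ⟨x, hx, e⟩ := hcp.right y₀ hy₀
    linarith [h x hx]
  · intro h x hx
    linarith [hcp.le x hx y₀ hy₀]

/-- A continuous function which at every point is supported from below by a translate of some
`b(·, y)` is `b`-convex. -/
theorem isConjugatePair_of_support (hX : IsCompact (closure X)) (hY : IsCompact (closure Y))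
    (hb : ContinuousOn (Function.uncurry b) (closure X ×ˢ closure Y)) (hXn : (closure X).Nonempty)
    (hu : ContinuousOn u (closure X))
    (hs : ∀ x ∈ closure X, ∃ y ∈ closure Y, ∀ x' ∈ closure X, b x' y - b x y ≤ u x' - u x) :
    IsConjugatePair X Y b u (bStarTransform X b u) := by
  have hb' := continuousOn_uncurry_flip hb
  have hle : ∀ x ∈ closure X, ∀ y ∈ closure Y, b x y ≤ u x + bStarTransform X b u y := by
    intro x hx y hy
    have : b x y - u x ≤ bStarTransform X b u y :=
      sub_le_bTransform hY hX hb' (hX.bddBelow_image hu) hy hx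
    linarith
  refine ⟨hle, fun x hx => ?_, fun y hy => ?_⟩
  · obtain ⟨y, hy, h⟩ := hs x hx
    refine ⟨y, hy, le_antisymm ?_ (hle x hx y hy)⟩
    have : bStarTransform X b u y ≤ b x y - u x :=
      bTransform_le (Y := X) (b := fun y x => b x y) hXn fun x' hx' => by
        linarith [h x' hx']
    linarith
  · obtain ⟨x, hx, e⟩ := exists_eq_bTransform hY hX hb' hXn hu hy
    exact ⟨x, hx, by rw [add_comm]; exact e⟩

theorem exists_gradX_midpoint (hY : IsCompact (closure Y)) (h1 : B1 X Y b) (h2 : B2 X Y b)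
    {x y y' : Euc n} (hx : x ∈ closure X) (hy : y ∈ closure Y) (hy' : y' ∈ closure Y) :
    ∃ m ∈ closure Y, gradX b x m = (1 / 2 : ℝ) • gradX b x y + (1 / 2 : ℝ) • gradX b x y' :=
  convex_image_closure hY (h1.1 x hx).continuousOn (h2.2 x hx) ⟨y, hy, rfl⟩ ⟨y', hy', rfl⟩
    (by norm_num) (by norm_num) (by norm_num)

/-- The midpoint `m` in marginal utility of best responses to `u` and `u'` supports the average of
`u` and `u'` at `x`. So averages of `b`-convex functions are `b`-convex. -/
theorem support_midpoint (hXo : IsOpen X) (hYo : IsOpen Y) (hX : IsCompact (closure X))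
    (hY : IsCompact (closure Y)) (h : UniquenessHypotheses X Y b c μ) {u' v' : Euc n → ℝ}
    (hu : IsConjugatePair X Y b u v) (hu' : IsConjugatePair X Y b u' v') {x y y' m : Euc n}
    (hx : x ∈ closure X) (hy : y ∈ closure Y) (hy' : y' ∈ closure Y) (hm : m ∈ closure Y)
    (he : u x + v y = b x y) (he' : u' x + v' y' = b x y')
    (hmid : gradX b x m = (1 / 2 : ℝ) • gradX b x y + (1 / 2 : ℝ) • gradX b x y') :
    ∀ x' ∈ closure X, b x' m - b x m ≤ 1 / 2 * (u x' + u' x') - 1 / 2 * (u x + u' x) := by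
  intro x' hx'
  have e := valuation_diff_midpoint_le hXo hYo hX h.b0 h.b1 h.b2 h.b3 hY hx hx' hy hy' hm hmid
  have e1 := hu.le x' hx' y hy
  have e2 := hu'.le x' hx' y' hy'
  linarith

/-- Production cost minus valuation is strictly convex in the marginal utility, provided that the
agent has only one best response to the menu that sells at production cost. -/
theorem UniquenessHypotheses.cost_midpoint_lt (hXo : IsOpen X) (hYo : IsOpen Y)
    (hX : IsCompact (closure X)) (hY : IsCompact (closure Y))
    (h : UniquenessHypotheses X Y b c μ) {x y y' m : Euc n} (hx : x ∈ X)
    (hy : y ∈ closure Y) (hy' : y' ∈ closure Y) (hne : y ≠ y') (hm : m ∈ closure Y)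
    (hmid : gradX b x m = (1 / 2 : ℝ) • gradX b x y + (1 / 2 : ℝ) • gradX b x y')
    (huniq : ∀ y ∈ closure Y, ∀ y' ∈ closure Y, bTransform Y b c x + c y = b x y →
      bTransform Y b c x + c y' = b x y' → y = y') :
    c m - b x m < 1 / 2 * (c y - b x y) + 1 / 2 * (c y' - b x y') := by
  have hxc := subset_closure hx
  have hcp := h.cost_isConjugatePair hX hY ⟨m, hm⟩
  -- `x'` produces the affine support of `c` at `m`
  obtain ⟨x', hx', e⟩ := hcp.right m hm
  have e1 := valuation_diff_midpoint_le hXo hYo hX h.b0 h.b1 h.b2 h.b3 hY hxc hx' hy hy' hm hmid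
  have e2 := hcp.le x' hx' y hy
  have e3 := hcp.le x' hx' y' hy'
  have hinj := (h.b1.1 x hxc).injOn
  have key : ∀ z : Euc n, (∀ y ∈ closure Y, ∀ y' ∈ closure Y,
      bTransform Y b c z + c y = b z y → bTransform Y b c z + c y' = b z y' → y = y') → x' = z →
      c m - b x m < 1 / 2 * (c y - b x y) + 1 / 2 * (c y' - b x y') := by
    rintro z hz rfl
    by_contra! hcon
    exact hne (hz y hy y' hy' (by linarith) (by linarith))
  rcases h.strict with hs | hs | hs
  · obtain ⟨-, r, -, hr⟩ := hs
    refine key x' (fun y hy y' hy' f f' => ?_) rfl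
    have g : y ∈ bestResponses Y b c x' := (hcp.mem_bestResponses hx').2 ⟨hy, f⟩
    have g' : y' ∈ bestResponses Y b c x' := (hcp.mem_bestResponses hx').2 ⟨hy', f'⟩
    rw [hr x' hx'] at g g'
    rw [mem_singleton_iff.1 g, mem_singleton_iff.1 g']
  · by_cases hxx : x' = x
    · exact key x huniq hxx
    · have := valuation_diff_midpoint_lt hXo hYo hX h.b0 h.b1 h.b2 h.b3 hY hs hx hx' hxx hy hy'
        hne hm hmid
      linarith
  · by_cases hxx : x' = x
    · exact key x huniq hxx
    · have := (hs x hxc x' hx' hxx).2 (mem_image_of_mem _ hy) (mem_image_of_mem _ hy')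
        (hinj.ne hy hy' hne) (by norm_num : (0 : ℝ) < 1 / 2) (by norm_num : (0 : ℝ) < 1 / 2)
        (by norm_num)
      simp only at this
      rw [← hmid, bExp_gradX hinj hm, bExp_gradX hinj hy, bExp_gradX hinj hy'] at this
      simp only [smul_eq_mul] at this
      linarith

theorem UniquenessHypotheses.ae_unique (h : UniquenessHypotheses X Y b c μ)
    (hμ : VanishesOnLipschitzHypersurfaces μ) (hu : IsConjugatePair X Y b u v) :
    ∀ᵐ x ∂μ, ∀ y ∈ closure Y, ∀ y' ∈ closure Y,
      u x + v y = b x y → u x + v y' = b x y' → y = y' := by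
  filter_upwards [ae_mem_of_compl h.supp, hu.ae_unique
    (fun x hx y hy => h.b0.contDiffAt_one (subset_closure hx) hy)
    (fun x hx => (h.b1.1 x (subset_closure hx)).injOn) hμ] with x hx hx' using hx' hx

/-- Two optimal strategies induce the same choices: otherwise their average, which is again
feasible, would be strictly better. -/
theorem UniquenessHypotheses.ae_agentChoice_eq (hXo : IsOpen X) (hYo : IsOpen Y)
    (hX : IsCompact (closure X)) (hY : IsCompact (closure Y)) (hy₀ : y₀ ∈ closure Y)
    (h : UniquenessHypotheses X Y b c μ) (hμ : VanishesOnLipschitzHypersurfaces μ)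
    {u' : Euc n → ℝ} (hu : IsOptimal X Y y₀ b c μ u) (hu' : IsOptimal X Y y₀ b c μ u') :
    ∀ᵐ x ∂μ, agentChoice X Y b c u x = agentChoice X Y b c u' x := by
  have := h.prob
  have hXn := h.nonempty.closure
  have hYn : (closure Y).Nonempty := ⟨y₀, hy₀⟩
  have hbc := h.b0.continuousOn
  have hc := h.continuousOn_cost hX hY hYn
  have hcp := hu.1.1.isConjugatePair hX hY hbc hXn hYn
  have hcp' := hu'.1.1.isConjugatePair hX hY hbc hXn hYn
  set w : Euc n → ℝ := fun x => 1 / 2 * (u x + u' x) with hw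
  have hwcp : IsConjugatePair X Y b w (bStarTransform X b w) := by
    refine isConjugatePair_of_support hX hY hbc hXn ?_ fun x hx => ?_
    · exact continuousOn_const.mul
        ((hcp.continuousOn_left hX hY hbc).add (hcp'.continuousOn_left hX hY hbc))
    · obtain ⟨y, hy, e⟩ := hcp.left x hx
      obtain ⟨y', hy', e'⟩ := hcp'.left x hx
      obtain ⟨m, hm, hmid⟩ := exists_gradX_midpoint hY h.b1 h.b2 hx hy hy'
      exact ⟨m, hm, support_midpoint hXo hYo hX hY h hcp hcp' hx hy hy' hm e e' hmid⟩
  have hwb := hwcp.isBConvex hX hY hbc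
  have hwf : w ∈ feasible X Y y₀ b c := by
    refine ⟨hwb, fun x hx => ?_⟩
    have e1 := hu.1.2 x hx
    have e2 := hu'.1.2 x hx
    simp only [hw]
    linarith
  have hint := (hu.1.1.integrable_profit h.supp hX hY hXn hYn h.b0 h.b1 hc).neg
  have hint' := (hu'.1.1.integrable_profit h.supp hX hY hXn hYn h.b0 h.b1 hc).neg
  have hintw := (hwb.integrable_profit h.supp hX hY hXn hYn h.b0 h.b1 hc).neg
  have hL := netLoss_eq h.supp hu.1.1 hX hY hXn hYn h.b0 h.b1 hc
  have hL' := netLoss_eq h.supp hu'.1.1 hX hY hXn hYn h.b0 h.b1 hc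
  have hLw := netLoss_eq h.supp hwb hX hY hXn hYn h.b0 h.b1 hc
  have hopt : netLoss X Y b c μ u ≤ netLoss X Y b c μ w := hu.2 hwf
  have hopt' : netLoss X Y b c μ u' ≤ netLoss X Y b c μ w := hu'.2 hwf
  set I : (Euc n → ℝ) → Euc n → ℝ := fun u x => c (agentChoice X Y b c u x) -
    bStarTransform X b u (agentChoice X Y b c u x) with hI
  have hneg : ∀ u, (-fun x => bStarTransform X b u (agentChoice X Y b c u x) -
      c (agentChoice X Y b c u x)) = I u := fun u => by
    ext x; simp [hI]
  rw [hneg] at hint hint' hintw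
  have hpt : ∀ᵐ x ∂μ, I w x ≤ 1 / 2 * I u x + 1 / 2 * I u' x ∧
      (agentChoice X Y b c u x ≠ agentChoice X Y b c u' x →
        I w x < 1 / 2 * I u x + 1 / 2 * I u' x) := by
    filter_upwards [ae_mem_of_compl h.supp,
      hu.1.1.ae_agentChoice h.supp hX hY hXn hYn h.b0 h.b1 hc,
      hu'.1.1.ae_agentChoice h.supp hX hY hXn hYn h.b0 h.b1 hc,
      hwb.ae_agentChoice h.supp hX hY hXn hYn h.b0 h.b1 hc,
      h.ae_unique hμ (h.cost_isConjugatePair hX hY hYn)] with x hxX hx hx' hxw huniq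
    have hxc := subset_closure hxX
    simp only [hI]
    set y := agentChoice X Y b c u x
    set y' := agentChoice X Y b c u' x
    obtain ⟨m, hm, hmid⟩ := exists_gradX_midpoint hY h.b1 h.b2 hxc hx.1 hx'.1
    have hsupp := support_midpoint hXo hYo hX hY h hcp hcp' hxc hx.1 hx'.1 hm hx.2.1 hx'.2.1 hmid
    -- `m` is a best response to the average
    have hmw : w x + bStarTransform X b w m = b x m := by
      obtain ⟨x', hx'c, e⟩ := hwcp.right m hm
      have e1 := hsupp x' hx'c
      have e2 := hwcp.le x hxc m hm
      simp only [hw] at *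
      linarith
    have hfav := hxw.2.2 m hm hmw
    have hwx : w x = 1 / 2 * (u x + u' x) := rfl
    have hlt : y ≠ y' → c m - b x m < 1 / 2 * (c y - b x y) + 1 / 2 * (c y' - b x y') := fun hne =>
      h.cost_midpoint_lt hXo hYo hX hY hxX hx.1 hx'.1 hne hm hmid huniq
    refine ⟨?_, fun hne => by linarith [hlt hne, hx.2.1, hx'.2.1]⟩
    by_cases hne : y = y'
    · have hmy : m = y := (h.b1.1 x hxc).injOn hm hx.1 (by
        rw [hmid, ← hne]
        module)
      have e3 : c y = c y' := by rw [hne]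
      have e4 : b x y = b x y' := by rw [hne]
      rw [hmy] at hfav hmw
      linarith [hx.2.1, hx'.2.1]
    · linarith [hlt hne, hx.2.1, hx'.2.1]
  have hint2 : Integrable (fun x => 1 / 2 * I u x + 1 / 2 * I u' x) μ :=
    (hint.const_mul _).add (hint'.const_mul _)
  have hzero : ∫ x, (1 / 2 * I u x + 1 / 2 * I u' x - I w x) ∂μ = 0 := by
    refine le_antisymm ?_ (integral_nonneg_of_ae ?_)
    · rw [integral_sub hint2 hintw, integral_add (hint.const_mul _) (hint'.const_mul _),
        integral_const_mul, integral_const_mul, ← hL, ← hL', ← hLw]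
      linarith
    · filter_upwards [hpt] with x hx using sub_nonneg.2 hx.1
  have hint3 : Integrable (fun x => 1 / 2 * I u x + 1 / 2 * I u' x - I w x) μ := hint2.sub hintw
  rw [integral_eq_zero_iff_of_nonneg_ae
    (by filter_upwards [hpt] with x hx using sub_nonneg.2 hx.1) hint3] at hzero
  filter_upwards [hzero, hpt] with x hx hx'
  by_contra hne
  have := hx'.2 hne
  simp only [Pi.zero_apply] at hx
  linarith

/-- If two optimal strategies induce the same choices, then the principal could as well charge the
higher one of the two prices for each product. Hence the prices of the chosen products agree. -/
theorem UniquenessHypotheses.ae_price_le (hX : IsCompact (closure X)) (hY : IsCompact (closure Y))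
    (hy₀ : y₀ ∈ closure Y) (h : UniquenessHypotheses X Y b c μ) {u' : Euc n → ℝ}
    (hu : IsOptimal X Y y₀ b c μ u) (hu' : IsOptimal X Y y₀ b c μ u')
    (hG : ∀ᵐ x ∂μ, agentChoice X Y b c u x = agentChoice X Y b c u' x) :
    ∀ᵐ x ∂μ, bStarTransform X b u' (agentChoice X Y b c u x) ≤
      bStarTransform X b u (agentChoice X Y b c u x) := by
  have := h.prob
  have hXn := h.nonempty.closure
  have hYn : (closure Y).Nonempty := ⟨y₀, hy₀⟩
  have hbc := h.b0.continuousOn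
  have hc := h.continuousOn_cost hX hY hYn
  have hcp := hu.1.1.isConjugatePair hX hY hbc hXn hYn
  have hcp' := hu'.1.1.isConjugatePair hX hY hbc hXn hYn
  set v := bStarTransform X b u with hv
  set v' := bStarTransform X b u' with hv'
  set p : Euc n → ℝ := fun y => max (v y) (v' y) with hp
  have hpc : ContinuousOn p (closure Y) :=
    ContinuousOn.sup (hcp.continuousOn_right hX hY hbc) (hcp'.continuousOn_right hX hY hbc)
  obtain ⟨hwcp, hwle, hweq⟩ := isConjugatePair_bTransform hX hY hbc hpc hXn hYn
  set w := bTransform Y b p with hw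
  have hwb := hwcp.isBConvex hX hY hbc
  have hwf : w ∈ feasible X Y y₀ b c := by
    refine (mem_feasible_iff hX hY hbc hXn hy₀).2 ⟨hwb, (hwle y₀ hy₀).trans (max_le ?_ ?_)⟩
    · exact ((mem_feasible_iff hX hY hbc hXn hy₀).1 hu.1).2
    · exact ((mem_feasible_iff hX hY hbc hXn hy₀).1 hu'.1).2
  have hint := (hu.1.1.integrable_profit h.supp hX hY hXn hYn h.b0 h.b1 hc)
  have hintw := (hwb.integrable_profit h.supp hX hY hXn hYn h.b0 h.b1 hc)
  have hL := netLoss_eq h.supp hu.1.1 hX hY hXn hYn h.b0 h.b1 hc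
  have hLw := netLoss_eq h.supp hwb hX hY hXn hYn h.b0 h.b1 hc
  have hopt : netLoss X Y b c μ u ≤ netLoss X Y b c μ w := hu.2 hwf
  set P : (Euc n → ℝ) → Euc n → ℝ := fun u x => bStarTransform X b u (agentChoice X Y b c u x) -
    c (agentChoice X Y b c u x) with hP
  have hneg : ∀ u, ∫ x, (c (agentChoice X Y b c u x) -
      bStarTransform X b u (agentChoice X Y b c u x)) ∂μ = -∫ x, P u x ∂μ := fun u => by
    rw [← integral_neg]; simp [hP]
  rw [hL, hLw, hneg, hneg] at hopt
  have hpt : ∀ᵐ x ∂μ, p (agentChoice X Y b c u x) - v (agentChoice X Y b c u x) ≤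
      P w x - P u x := by
    filter_upwards [hG, ae_mem_of_compl h.supp,
      hu.1.1.ae_agentChoice h.supp hX hY hXn hYn h.b0 h.b1 hc,
      hu'.1.1.ae_agentChoice h.supp hX hY hXn hYn h.b0 h.b1 hc,
      hwb.ae_agentChoice h.supp hX hY hXn hYn h.b0 h.b1 hc] with x hGx hxX hx hx' hxw
    have hxc := subset_closure hxX
    rw [← hGx] at hx'
    simp only [hP]
    set y := agentChoice X Y b c u x
    have hwx : w x + p y = b x y := by
      refine le_antisymm ?_ ?_
      · have e1 : w x ≤ u x := bTransform_le hYn fun z hz => by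
          have := le_max_left (v z) (v' z)
          linarith [hcp.le x hxc z hz]
        have e2 : w x ≤ u' x := bTransform_le hYn fun z hz => by
          have := le_max_right (v z) (v' z)
          linarith [hcp'.le x hxc z hz]
        rcases max_choice (v y) (v' y) with e | e
        · simp only [hp, e]; linarith [hx.2.1]
        · simp only [hp, e]; linarith [hx'.2.1]
      · linarith [sub_le_bTransform hX hY hbc (hY.bddBelow_image hpc) hxc hx.1]
    have e3 := hweq x hxc y hx.1 hwx
    have e4 := hxw.2.2 y hx.1 (by rw [e3]; exact hwx)
    linarith
  have hnn : ∀ᵐ x ∂μ, 0 ≤ P w x - P u x := by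
    filter_upwards [hpt] with x hx
    exact (sub_nonneg.2 (le_max_left _ _)).trans hx
  have hzero : ∫ x, (P w x - P u x) ∂μ = 0 := by
    refine le_antisymm ?_ (integral_nonneg_of_ae hnn)
    rw [integral_sub hintw hint]
    linarith
  have hint2 : Integrable (fun x => P w x - P u x) μ := hintw.sub hint
  rw [integral_eq_zero_iff_of_nonneg_ae hnn hint2] at hzero
  filter_upwards [hzero, hpt] with x hx hx'
  simp only [Pi.zero_apply] at hx
  have := le_max_right (v (agentChoice X Y b c u x)) (v' (agentChoice X Y b c u x))
  simp only [hp] at hx'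
  linarith

/-- Optimal strategies are unique almost everywhere. -/
theorem UniquenessHypotheses.ae_eq (hXo : IsOpen X) (hYo : IsOpen Y)
    (hX : IsCompact (closure X)) (hY : IsCompact (closure Y)) (hy₀ : y₀ ∈ closure Y)
    (h : UniquenessHypotheses X Y b c μ) (hμ : VanishesOnLipschitzHypersurfaces μ)
    {u' : Euc n → ℝ} (hu : IsOptimal X Y y₀ b c μ u) (hu' : IsOptimal X Y y₀ b c μ u') :
    ∀ᵐ x ∂μ, u x = u' x := by
  have hXn := h.nonempty.closure
  have hYn : (closure Y).Nonempty := ⟨y₀, hy₀⟩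
  have hc := h.continuousOn_cost hX hY hYn
  have hG := h.ae_agentChoice_eq hXo hYo hX hY hy₀ hμ hu hu'
  have hG' := h.ae_agentChoice_eq hXo hYo hX hY hy₀ hμ hu' hu
  filter_upwards [hG, h.ae_price_le hX hY hy₀ hu hu' hG, h.ae_price_le hX hY hy₀ hu' hu hG',
    hu.1.1.ae_agentChoice h.supp hX hY hXn hYn h.b0 h.b1 hc,
    hu'.1.1.ae_agentChoice h.supp hX hY hXn hYn h.b0 h.b1 hc] with x e h1 h2 hx hx'
  rw [← e] at h2 hx'
  linarith [hx.2.1, hx'.2.1]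

end Uniqueness

/-! ### Compactness of optimal strategies -/

section Compactness

variable {n : ℕ} {X Y : Set (Euc n)} {b : Euc n → Euc n → ℝ} {c u v : Euc n → ℝ}
  {μ : Measure (Euc n)} {y₀ : Euc n}

/-- An a priori bound: an optimal strategy is not worse than selling only the null product, and its
oscillation is bounded by that of `b`. -/
theorem IsOptimal.abs_utility_le (hX : IsCompact (closure X)) (hY : IsCompact (closure Y))
    (hy₀ : y₀ ∈ closure Y) (h : UniquenessHypotheses X Y b c μ) (hu : IsOptimal X Y y₀ b c μ u)
    {A : ℝ} (hA : ∀ x ∈ closure X, ∀ y ∈ closure Y, |b x y| + |c y| ≤ A) {x : Euc n}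
    (hx : x ∈ closure X) : |u x| ≤ 5 * A := by
  have := h.prob
  have hXn := h.nonempty.closure
  have hYn : (closure Y).Nonempty := ⟨y₀, hy₀⟩
  have hbc := h.b0.continuousOn
  have hc := h.continuousOn_cost hX hY hYn
  have hcp := hu.1.1.isConjugatePair hX hY hbc hXn hYn
  have hb1 : ∀ x ∈ closure X, ∀ y ∈ closure Y, |b x y| ≤ A := fun x hx y hy => by
    linarith [hA x hx y hy, abs_nonneg (c y)]
  have hA0 : 0 ≤ A := (abs_nonneg _).trans (hb1 x hx y₀ hy₀)
  set w : Euc n → ℝ := fun x => b x y₀ - c y₀ with hw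
  have hwcp : IsConjugatePair X Y b w (bStarTransform X b w) :=
    isConjugatePair_of_support hX hY hbc hXn
      ((continuousOn_section_left hbc hy₀).sub continuousOn_const)
      fun x hx => ⟨y₀, hy₀, fun x' hx' => by simp only [hw]; linarith⟩
  have hwb := hwcp.isBConvex hX hY hbc
  have hopt : netLoss X Y b c μ u ≤ netLoss X Y b c μ w := hu.2 ⟨hwb, fun x _ => le_rfl⟩
  rw [netLoss_eq h.supp hu.1.1 hX hY hXn hYn h.b0 h.b1 hc,
    netLoss_eq h.supp hwb hX hY hXn hYn h.b0 h.b1 hc] at hopt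
  have hint := (hu.1.1.integrable_profit h.supp hX hY hXn hYn h.b0 h.b1 hc).neg
  have hintw := (hwb.integrable_profit h.supp hX hY hXn hYn h.b0 h.b1 hc).neg
  have hlow : ∀ z ∈ closure X, -A ≤ u z := fun z hz => by
    have h1 := hu.1.2 z hz
    have h2 := abs_le.1 (hA z hz y₀ hy₀ |>.trans' (abs_sub (b z y₀) (c y₀)))
    linarith [h2.1]
  have hosc : ∀ z ∈ closure X, u x ≤ u z + 2 * A := fun z hz => hcp.le_add hx hz fun y hy => by
    have h1 := abs_le.1 (hb1 x hx y hy)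
    have h2 := abs_le.1 (hb1 z hz y hy)
    rw [abs_le]
    constructor <;> linarith
  -- the loss `u z + c y - b z y` from an agent `z` is at least `u z - A`, and `u x - 2 * A ≤ u z`
  have hup : u x - 3 * A ≤ ∫ x, (c (agentChoice X Y b c u x) -
      bStarTransform X b u (agentChoice X Y b c u x)) ∂μ := by
    have h1 : ∫ _, (u x - 3 * A) ∂μ = u x - 3 * A := by simp
    rw [← h1]
    refine integral_mono_ae (integrable_const _) (hint.congr (ae_of_all _ fun x => by simp)) ?_
    filter_upwards [ae_mem_of_compl h.supp,
      hu.1.1.ae_agentChoice h.supp hX hY hXn hYn h.b0 h.b1 hc] with z hz hzr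
    have h2 := hosc z (subset_closure hz)
    have h3 := abs_le.1 (hA z (subset_closure hz) _ hzr.1 |>.trans'
      (abs_sub (b z (agentChoice X Y b c u z)) (c (agentChoice X Y b c u z))))
    linarith [hzr.2.1]
  have hdown : ∫ x, (c (agentChoice X Y b c w x) -
      bStarTransform X b w (agentChoice X Y b c w x)) ∂μ ≤ 2 * A := by
    have h1 : ∫ _ : Euc n, 2 * A ∂μ = 2 * A := by simp
    rw [← h1]
    refine integral_mono_ae (hintw.congr (ae_of_all _ fun x => by simp)) (integrable_const _) ?_
    filter_upwards [ae_mem_of_compl h.supp,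
      hwb.ae_agentChoice h.supp hX hY hXn hYn h.b0 h.b1 hc] with z hz hzr
    have h3 := abs_le.1 (hA z (subset_closure hz) _ hzr.1 |>.trans'
      (abs_sub (b z (agentChoice X Y b c w z)) (c (agentChoice X Y b c w z))))
    have h4 := abs_le.1 (hA z (subset_closure hz) y₀ hy₀ |>.trans' (abs_sub (b z y₀) (c y₀)))
    have h5 : w z = b z y₀ - c y₀ := rfl
    linarith [hzr.2.1]
  rw [abs_le]
  constructor <;> linarith [hlow x hx]

/-- Transforms with respect to the same kernel are equicontinuous, so Arzelà–Ascoli applies. -/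
theorem exists_subseq_bTransform (hX : IsCompact (closure X)) (hY : IsCompact (closure Y))
    (hb : ContinuousOn (Function.uncurry b) (closure X ×ˢ closure Y)) (hYn : (closure Y).Nonempty)
    {vs : ℕ → Euc n → ℝ} (hv : ∀ i, BddBelow (vs i '' closure Y)) {C : ℝ}
    (hC : ∀ i, ∀ x ∈ closure X, |bTransform Y b (vs i) x| ≤ C) :
    ∃ φ : ℕ → ℕ, StrictMono φ ∧ ∃ U : Euc n → ℝ,
      TendstoUniformlyOn (fun k => bTransform Y b (vs (φ k))) U atTop (closure X) := by
  classical
  have : CompactSpace (closure X) := isCompact_iff_compactSpace.1 hX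
  let F : ℕ → BoundedContinuousFunction (closure X) ℝ := fun i =>
    BoundedContinuousFunction.mkOfCompact ⟨(closure X).domRestrict (bTransform Y b (vs i)),
      (continuousOn_bTransform hX hY hb hYn (hv i)).domRestrict⟩
  have hF : ∀ i x, F i x = bTransform Y b (vs i) x := fun i x => rfl
  have hcomp : IsCompact (closure (range F)) := by
    refine BoundedContinuousFunction.arzela_ascoli (Icc (-C) C) isCompact_Icc _ ?_ ?_
    · rintro _ x ⟨i, rfl⟩
      rw [hF]
      exact abs_le.1 (hC i x x.2)
    · intro x
      rw [Metric.equicontinuousAt_iff]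
      intro ε hε
      obtain ⟨δ, hδ, hd⟩ := exists_modulus hX hY hb (half_pos hε)
      refine ⟨δ, hδ, fun z hz => ?_⟩
      rintro ⟨_, i, rfl⟩
      have key : ∀ z z' : closure X, dist z z' < δ →
          bTransform Y b (vs i) z ≤ bTransform Y b (vs i) z' + ε / 2 := fun z z' hzz =>
        bTransform_le_add hX hY hb hYn (hv i) z'.2 fun y hy => by
          have := (abs_lt.1 (hd z z.2 z' z'.2 hzz y hy)).2
          linarith
      change dist (bTransform Y b (vs i) x) (bTransform Y b (vs i) z) < ε
      rw [Real.dist_eq, abs_lt]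
      have h1 := key z x hz
      have h2 := key x z (by rwa [dist_comm])
      constructor <;> linarith
  obtain ⟨f, -, φ, hφ, hlim⟩ := hcomp.tendsto_subseq fun i => subset_closure (mem_range_self i)
  rw [BoundedContinuousFunction.tendsto_iff_tendstoUniformly, Metric.tendstoUniformly_iff] at hlim
  refine ⟨φ, hφ, fun x => if hx : x ∈ closure X then f ⟨x, hx⟩ else 0, ?_⟩
  rw [Metric.tendstoUniformlyOn_iff]
  intro ε hε
  filter_upwards [hlim ε hε] with k hk x hx
  rw [dif_pos hx]
  exact hk ⟨x, hx⟩

/-- Transforms depend continuously on the kernel and the transformed function. -/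
theorem tendstoUniformlyOn_bTransform (hX : IsCompact (closure X)) (hY : IsCompact (closure Y))
    (hYn : (closure Y).Nonempty) {bs : ℕ → Euc n → Euc n → ℝ} {vs : ℕ → Euc n → ℝ}
    (hb : ContinuousOn (Function.uncurry b) (closure X ×ˢ closure Y))
    (hbs : ∀ i, ContinuousOn (Function.uncurry (bs i)) (closure X ×ˢ closure Y))
    (hv : BddBelow (v '' closure Y)) (hvs : ∀ i, BddBelow (vs i '' closure Y))
    (hbl : TendstoUniformlyOn (fun i => Function.uncurry (bs i)) (Function.uncurry b) atTop
      (closure X ×ˢ closure Y)) (hvl : TendstoUniformlyOn vs v atTop (closure Y)) :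
    TendstoUniformlyOn (fun i => bTransform Y (bs i) (vs i)) (bTransform Y b v) atTop
      (closure X) := by
  rw [Metric.tendstoUniformlyOn_iff] at hbl hvl ⊢
  intro ε hε
  have hε' : 0 < ε / 3 := by positivity
  filter_upwards [hbl _ hε', hvl _ hε'] with i hi hi' x hx
  have key : ∀ y ∈ closure Y, |b x y - v y - (bs i x y - vs i y)| ≤ 2 * (ε / 3) := fun y hy => by
    have h1 := abs_lt.1 (by simpa [Real.dist_eq] using hi (x, y) ⟨hx, hy⟩)
    have h2 := abs_lt.1 (by simpa [Real.dist_eq] using hi' y hy)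
    rw [abs_le]
    constructor <;> linarith
  have h1 : bTransform Y b v x ≤ bTransform Y (bs i) (vs i) x + 2 * (ε / 3) :=
    bTransform_le_add hX hY (hbs i) hYn (hvs i) hx fun y hy => by
      have := (abs_le.1 (key y hy)).2
      linarith
  have h2 : bTransform Y (bs i) (vs i) x ≤ bTransform Y b v x + 2 * (ε / 3) :=
    bTransform_le_add hX hY hb hYn hv hx fun y hy => by
      have := (abs_le.1 (key y hy)).1
      linarith
  rw [Real.dist_eq, abs_lt]
  constructor <;> linarith

/-- Data that satisfy the uniqueness hypotheses and converge to data with the same property, where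
the limit of the distributions of agents vanishes on Lipschitz hypersurfaces. Uniform convergence
of the preferences suffices for all limits taken here. -/
structure ConvergentData {n : ℕ} (X Y : Set (Euc n)) (bs : ℕ → Euc n → Euc n → ℝ)
    (cs : ℕ → Euc n → ℝ) (μs : ℕ → Measure (Euc n)) (b : Euc n → Euc n → ℝ) (c : Euc n → ℝ)
    (μ : Measure (Euc n)) : Prop where
  data : ∀ i, UniquenessHypotheses X Y (bs i) (cs i) (μs i)
  limit : UniquenessHypotheses X Y b c μ
  tendsto_b : TendstoUniformlyOn (fun i => Function.uncurry (bs i)) (Function.uncurry b) atTop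
    (closure X ×ˢ closure Y)
  tendsto_c : TendstoUniformlyOn cs c atTop (closure Y)
  tendsto_μ : WeakStarTendsto (closure X) μs μ
  vanishes : VanishesOnLipschitzHypersurfaces μ

theorem tendstoUniformlyOn_subseq {α : Type*} {F : ℕ → α → ℝ} {f : α → ℝ} {s : Set α}
    (h : TendstoUniformlyOn F f atTop s) {ns : ℕ → ℕ} (hns : Tendsto ns atTop atTop) :
    TendstoUniformlyOn (fun k => F (ns k)) f atTop s :=
  fun U hU => hns.eventually (h U hU)

variable {bs : ℕ → Euc n → Euc n → ℝ} {cs us : ℕ → Euc n → ℝ} {μs : ℕ → Measure (Euc n)}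

theorem ConvergentData.subseq (D : ConvergentData X Y bs cs μs b c μ) {ns : ℕ → ℕ}
    (hns : Tendsto ns atTop atTop) :
    ConvergentData X Y (fun k => bs (ns k)) (fun k => cs (ns k)) (fun k => μs (ns k)) b c μ :=
  ⟨fun k => D.data (ns k), D.limit, tendstoUniformlyOn_subseq D.tendsto_b hns,
    tendstoUniformlyOn_subseq D.tendsto_c hns, fun g hg => (D.tendsto_μ g hg).comp hns, D.vanishes⟩

section Limits

variable (hX : IsCompact (closure X)) (hY : IsCompact (closure Y)) (hy₀ : y₀ ∈ closure Y)
  (D : ConvergentData X Y bs cs μs b c μ)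

include hX hY D in
theorem ConvergentData.tendsto_bStarTransform (hus : ∀ i, IsBConvex X Y (bs i) (us i))
    (hu : IsBConvex X Y b u) (hl : TendstoUniformlyOn us u atTop (closure X)) :
    TendstoUniformlyOn (fun i => bStarTransform X (bs i) (us i)) (bStarTransform X b u) atTop
      (closure Y) := by
  refine tendstoUniformlyOn_bTransform (X := Y) (Y := X) (b := fun y x => b x y)
    (bs := fun i y x => bs i x y) hY hX D.limit.nonempty.closure
    (continuousOn_uncurry_flip D.limit.b0.continuousOn)
    (fun i => continuousOn_uncurry_flip (D.data i).b0.continuousOn) hu.1 (fun i => (hus i).1) ?_ hl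
  have h := D.tendsto_b
  rw [Metric.tendstoUniformlyOn_iff] at h ⊢
  intro ε hε
  filter_upwards [h ε hε] with i hi p hp
  exact hi (p.2, p.1) ⟨hp.2, hp.1⟩

include hX hY hy₀ D in
/-- The net losses depend continuously on the data and the strategy. -/
theorem ConvergentData.tendsto_netLoss (hus : ∀ i, IsBConvex X Y (bs i) (us i))
    (hu : IsBConvex X Y b u) (hl : TendstoUniformlyOn us u atTop (closure X)) :
    Tendsto (fun i => netLoss X Y (bs i) (cs i) (μs i) (us i)) atTop
      (𝓝 (netLoss X Y b c μ u)) := by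
  have hYn : (closure Y).Nonempty := ⟨y₀, hy₀⟩
  have hXn := D.limit.nonempty.closure
  have hbc := D.limit.b0.continuousOn
  have hc := D.limit.continuousOn_cost hX hY hYn
  have hcs := fun i => (D.data i).continuousOn_cost hX hY hYn
  have hcp := hu.isConjugatePair hX hY hbc hXn hYn
  have := D.limit.prob
  have := fun i => (D.data i).prob
  have hvs := D.tendsto_bStarTransform hX hY hus hu hl
  rw [netLoss_eq D.limit.supp hu hX hY hXn hYn D.limit.b0 D.limit.b1 hc]
  simp_rw [fun i => netLoss_eq (D.data i).supp (hus i) hX hY hXn hYn (D.data i).b0 (D.data i).b1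
    (hcs i)]
  refine hcp.tendsto_integral (f := fun y => c y - bStarTransform X b u y)
    (fs := fun i y => cs i y - bStarTransform X (bs i) (us i) y)
    (G := agentChoice X Y b c u) (Gs := fun i => agentChoice X Y (bs i) (cs i) (us i)) hX hY hbc
    (hc.sub (hcp.continuousOn_right hX hY hbc)) D.limit.supp (fun i => (D.data i).supp) D.tendsto_μ
    D.tendsto_b hl hvs (D.tendsto_c.sub hvs) (fun i => ?_) (fun i => ?_) ?_
  · filter_upwards [(hus i).ae_agentChoice (D.data i).supp hX hY hXn hYn (D.data i).b0
      (D.data i).b1 (hcs i)] with x hx using ⟨hx.1, hx.2.1⟩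
  · exact ((hus i).integrable_profit (D.data i).supp hX hY hXn hYn (D.data i).b0
      (D.data i).b1 (hcs i)).neg.congr (ae_of_all _ fun x => by simp)
  · filter_upwards [hu.ae_agentChoice D.limit.supp hX hY hXn hYn D.limit.b0 D.limit.b1 hc,
      D.limit.ae_unique D.vanishes hcp] with x hx hx'
    exact ⟨hx.1, hx.2.1, fun y hy e => hx' y hy _ hx.1 e hx.2.1⟩

include hX hY hy₀ D in
theorem ConvergentData.mem_feasible_of_tendsto (hus : ∀ i, us i ∈ feasible X Y y₀ (bs i) (cs i))
    (hl : TendstoUniformlyOn us u atTop (closure X)) : u ∈ feasible X Y y₀ b c := by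
  have hYn : (closure Y).Nonempty := ⟨y₀, hy₀⟩
  have hXn := D.limit.nonempty.closure
  have hbc := D.limit.b0.continuousOn
  have hcps := fun i => (hus i).1.isConjugatePair hX hY (D.data i).b0.continuousOn hXn hYn
  have huc : ContinuousOn u (closure X) := hl.continuousOn (Frequently.of_forall fun i =>
    (hcps i).continuousOn_left hX hY (D.data i).b0.continuousOn)
  have hub : BddBelow (u '' closure X) := hX.bddBelow_image huc
  have hb' := continuousOn_uncurry_flip hbc
  have hvc : ContinuousOn (bStarTransform X b u) (closure Y) :=
    continuousOn_bTransform hY hX hb' hXn hub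
  have hbs' : TendstoUniformlyOn (fun i => Function.uncurry fun y x => bs i x y)
      (Function.uncurry fun y x => b x y) atTop (closure Y ×ˢ closure X) := by
    have h := D.tendsto_b
    rw [Metric.tendstoUniformlyOn_iff] at h ⊢
    intro ε hε
    filter_upwards [h ε hε] with i hi p hp
    exact hi (p.2, p.1) ⟨hp.2, hp.1⟩
  have hvs : TendstoUniformlyOn (fun i => bStarTransform X (bs i) (us i)) (bStarTransform X b u)
      atTop (closure Y) :=
    tendstoUniformlyOn_bTransform (X := Y) (Y := X) (b := fun y x => b x y)
      (bs := fun i y x => bs i x y) hY hX hXn hb'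
      (fun i => continuousOn_uncurry_flip (D.data i).b0.continuousOn) hub (fun i => (hus i).1.1)
      hbs' hl
  have hus' := tendstoUniformlyOn_bTransform hX hY hYn hbc (fun i => (D.data i).b0.continuousOn)
    (hY.bddBelow_image hvc) (fun i => hY.bddBelow_image
      ((hcps i).continuousOn_right hX hY (D.data i).b0.continuousOn)) D.tendsto_b hvs
  refine ⟨⟨hub, fun x hx => ?_⟩, fun x hx => ?_⟩
  · refine tendsto_nhds_unique (hl.tendsto_at hx) ((hus'.tendsto_at hx).congr fun i => ?_)
    exact ((hus i).1.2 x hx).symm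
  · exact le_of_tendsto_of_tendsto
      ((D.tendsto_b.tendsto_at (x := (x, y₀)) ⟨hx, hy₀⟩).sub (D.tendsto_c.tendsto_at hy₀))
      (hl.tendsto_at hx) (Eventually.of_forall fun i => (hus i).2 x hx)

include hX hY hy₀ D in
/-- Every feasible strategy for the limit data is a uniform limit of feasible strategies: the price
menu is kept, up to a discount that makes the null product affordable. -/
theorem ConvergentData.exists_recovery (hu : u ∈ feasible X Y y₀ b c) :
    ∃ ws : ℕ → Euc n → ℝ, (∀ i, ws i ∈ feasible X Y y₀ (bs i) (cs i)) ∧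
      TendstoUniformlyOn ws u atTop (closure X) := by
  have hYn : (closure Y).Nonempty := ⟨y₀, hy₀⟩
  have hXn := D.limit.nonempty.closure
  have hbc := D.limit.b0.continuousOn
  have hcp := hu.1.isConjugatePair hX hY hbc hXn hYn
  have hv := hcp.continuousOn_right hX hY hbc
  set v := bStarTransform X b u with hvdef
  set ps : ℕ → Euc n → ℝ := fun i y => v y - |cs i y₀ - c y₀| with hps
  have hpc : ∀ i, ContinuousOn (ps i) (closure Y) := fun i => hv.sub continuousOn_const
  have hpl : TendstoUniformlyOn ps v atTop (closure Y) := by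
    rw [Metric.tendstoUniformlyOn_iff]
    intro ε hε
    filter_upwards [Metric.tendstoUniformlyOn_iff.1 D.tendsto_c ε hε] with i hi y _
    have := hi y₀ hy₀
    rw [Real.dist_eq, abs_sub_comm] at this
    simpa [hps, Real.dist_eq] using this
  refine ⟨fun i => bTransform Y (bs i) (ps i), fun i => ?_, ?_⟩
  · have hbi := (D.data i).b0.continuousOn
    obtain ⟨h1, h2, -⟩ := isConjugatePair_bTransform hX hY hbi (hpc i) hXn hYn
    refine (mem_feasible_iff hX hY hbi hXn hy₀).2 ⟨h1.isBConvex hX hY hbi, (h2 y₀ hy₀).trans ?_⟩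
    have h3 := ((mem_feasible_iff hX hY hbc hXn hy₀).1 hu).2
    have h4 := neg_abs_le (cs i y₀ - c y₀)
    simp only [hps]
    linarith
  · have h := tendstoUniformlyOn_bTransform hX hY hYn hbc
      (fun i => (D.data i).b0.continuousOn) (hY.bddBelow_image hv)
      (fun i => hY.bddBelow_image (hpc i)) D.tendsto_b hpl
    exact h.congr_right fun x hx => (hu.1.2 x hx).symm

include hX hY hy₀ D in
theorem ConvergentData.isOptimal_of_tendsto
    (hus : ∀ i, IsOptimal X Y y₀ (bs i) (cs i) (μs i) (us i))
    (hl : TendstoUniformlyOn us u atTop (closure X)) : IsOptimal X Y y₀ b c μ u := by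
  have hu := D.mem_feasible_of_tendsto hX hY hy₀ (fun i => (hus i).1) hl
  refine ⟨hu, fun w hw => ?_⟩
  obtain ⟨ws, hws, hwl⟩ := D.exists_recovery hX hY hy₀ hw
  exact le_of_tendsto_of_tendsto
    (D.tendsto_netLoss hX hY hy₀ (fun i => (hus i).1.1) hu.1 hl)
    (D.tendsto_netLoss hX hY hy₀ (fun i => (hws i).1) hw.1 hwl)
    (Eventually.of_forall fun i => (hus i).2 (hws i))

include hX hY hy₀ D in
/-- Optimal strategies for convergent data converge along a subsequence to an optimal strategy. -/
theorem ConvergentData.exists_subseq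
    (hus : ∀ i, IsOptimal X Y y₀ (bs i) (cs i) (μs i) (us i)) :
    ∃ φ : ℕ → ℕ, Tendsto φ atTop atTop ∧ ∃ U : Euc n → ℝ, IsOptimal X Y y₀ b c μ U ∧
      TendstoUniformlyOn (fun k => us (φ k)) U atTop (closure X) := by
  have hYn : (closure Y).Nonempty := ⟨y₀, hy₀⟩
  have hXn := D.limit.nonempty.closure
  have hbc := D.limit.b0.continuousOn
  have hc := D.limit.continuousOn_cost hX hY hYn
  obtain ⟨M, -, hM⟩ := exists_abs_le hX hY hbc
  obtain ⟨C, hC⟩ := hY.exists_bound_of_continuousOn hc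
  have hcps := fun i => (hus i).1.1.isConjugatePair hX hY (D.data i).b0.continuousOn hXn hYn
  have hvb := fun i => hY.bddBelow_image
    ((hcps i).continuousOn_right hX hY (D.data i).b0.continuousOn)
  -- the same prices generate equicontinuous utilities with respect to the limit preferences
  have hclose : ∀ ε > 0, ∀ᶠ i in atTop, ∀ x ∈ closure X,
      |us i x - bTransform Y b (bStarTransform X (bs i) (us i)) x| ≤ ε := by
    intro ε hε
    filter_upwards [Metric.tendstoUniformlyOn_iff.1 D.tendsto_b ε hε] with i hi x hx
    have hbi := (D.data i).b0.continuousOn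
    have key : ∀ y ∈ closure Y, |b x y - bs i x y| ≤ ε := fun y hy => by
      simpa [Real.dist_eq] using (hi (x, y) ⟨hx, hy⟩).le
    have h1 : bTransform Y (bs i) (bStarTransform X (bs i) (us i)) x ≤
        bTransform Y b (bStarTransform X (bs i) (us i)) x + ε :=
      bTransform_le_add hX hY hbc hYn (hvb i) hx fun y hy => by
        have := (abs_le.1 (key y hy)).1
        linarith
    have h2 : bTransform Y b (bStarTransform X (bs i) (us i)) x ≤
        bTransform Y (bs i) (bStarTransform X (bs i) (us i)) x + ε :=
      bTransform_le_add hX hY hbi hYn (hvb i) hx fun y hy => by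
        have := (abs_le.1 (key y hy)).2
        linarith
    rw [(hus i).1.1.2 x hx, abs_le]
    constructor <;> linarith
  have hbound : ∀ᶠ i in atTop, ∀ x ∈ closure X,
      |bTransform Y b (bStarTransform X (bs i) (us i)) x| ≤ 5 * (M + C + 2) + 1 := by
    filter_upwards [hclose 1 one_pos, Metric.tendstoUniformlyOn_iff.1 D.tendsto_b 1 one_pos,
      Metric.tendstoUniformlyOn_iff.1 D.tendsto_c 1 one_pos] with i h1 h2 h3 x hx
    have h4 : |us i x| ≤ 5 * (M + C + 2) := by
      refine (hus i).abs_utility_le hX hY hy₀ (D.data i) (fun x hx y hy => ?_) hx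
      have e1 : |bs i x y| ≤ M + 1 := by
        have := h2 (x, y) ⟨hx, hy⟩
        rw [Real.dist_eq] at this
        have e := abs_sub_abs_le_abs_sub (bs i x y) (b x y)
        rw [abs_sub_comm] at e
        have e' := hM x hx y hy
        simp only [Function.uncurry] at this
        linarith
      have e2 : |cs i y| ≤ C + 1 := by
        have := h3 y hy
        rw [Real.dist_eq] at this
        have e := abs_sub_abs_le_abs_sub (cs i y) (c y)
        rw [abs_sub_comm] at e
        have e' := hC y hy
        rw [Real.norm_eq_abs] at e'
        linarith
      linarith
    have h5 := abs_le.1 (h1 x hx)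
    have h6 := abs_le.1 h4
    rw [abs_le]
    constructor <;> linarith
  obtain ⟨N, hN⟩ := eventually_atTop.1 hbound
  obtain ⟨φ, hφ, U, hU⟩ := exists_subseq_bTransform hX hY hbc hYn
    (vs := fun i => bStarTransform X (bs (i + N)) (us (i + N))) (fun i => hvb (i + N))
    (fun i => hN (i + N) (Nat.le_add_left N i))
  have hφN : Tendsto (fun k => φ k + N) atTop atTop :=
    tendsto_atTop_mono (fun k => Nat.le_add_right (φ k) N) hφ.tendsto_atTop
  have hl : TendstoUniformlyOn (fun k => us (φ k + N)) U atTop (closure X) := by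
    rw [Metric.tendstoUniformlyOn_iff] at hU ⊢
    intro ε hε
    filter_upwards [hU _ (half_pos hε), hφN.eventually (hclose (ε / 3) (by positivity))]
      with k h1 h2 x hx
    have e1 := abs_lt.1 (by simpa only [Real.dist_eq] using h1 x hx)
    have e2 := abs_le.1 (h2 x hx)
    rw [Real.dist_eq, abs_lt]
    constructor <;> linarith
  exact ⟨_, hφN, U,
    (D.subseq hφN).isOptimal_of_tendsto hX hY hy₀ (fun k => hus (φ k + N)) hl, hl⟩

end Limits

end Compactness

/-! ### Products selected through gradients -/

section Selection

variable {n : ℕ} {X Y : Set (Euc n)} {b : Euc n → Euc n → ℝ} {c u : Euc n → ℝ}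
  {μ ν : Measure (Euc n)} {y₀ : Euc n} {D G : Euc n → Euc n}

/-- An admissible version of `Du` for the distribution `μ` points to best responses for almost every
agent, even with respect to another distribution `ν` that vanishes on Lipschitz hypersurfaces if `μ`
does. -/
theorem IsGradientSelection.ae_bExp (h : IsGradientSelection X Y b c μ u D) (hXo : IsOpen X)
    (hX : IsCompact (closure X)) (hY : IsCompact (closure Y)) (hXn : (closure X).Nonempty)
    (hYn : (closure Y).Nonempty) (h0 : B0 X Y b) (h1 : B1 X Y b) (hu : IsBConvex X Y b u)
    (hν : ν Xᶜ = 0)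
    (hμν : VanishesOnLipschitzHypersurfaces μ → VanishesOnLipschitzHypersurfaces ν) :
    ∀ᵐ x ∂ν, D x = gradX b x (bExp Y b x (D x)) ∧ bExp Y b x (D x) ∈ closure Y ∧
      u x + bStarTransform X b u (bExp Y b x (D x)) = b x (bExp Y b x (D x)) := by
  have hcp := hu.isConjugatePair hX hY h0.continuousOn hXn hYn
  have hinj : ∀ x ∈ X, InjOn (fun y => gradX b x y) (closure Y) := fun x hx =>
    (h1.1 x (subset_closure hx)).injOn
  have key : ∀ᵐ x ∂ν, x ∈ X ∧ ∃ y ∈ closure Y, D x = gradX b x y ∧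
      u x + bStarTransform X b u y = b x y := by
    by_cases hμ : VanishesOnLipschitzHypersurfaces μ
    · filter_upwards [ae_mem_of_compl hν, hcp.ae_unique (fun x hx y hy =>
        h0.contDiffAt_one (subset_closure hx) hy) hinj (hμν hμ)] with x hx huniq
      obtain ⟨y, hy, e⟩ := hcp.left x (subset_closure hx)
      have hg := hcp.hasGradientAt hXo hX hY h0.continuousOn hx
        (h0.contDiffAt_one (subset_closure hx) hy) hy e
        fun y' hy' e' => huniq hx y' hy' y hy e' e
      exact ⟨hx, y, hy, by rw [h.eq_gradient x hx hg.differentiableAt, hg.gradient], e⟩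
    · filter_upwards [ae_mem_of_compl hν] with x hx
      obtain ⟨-, y, hy, e⟩ := h.tie_breaking hμ x hx
      have := (hcp.mem_bestResponses (subset_closure hx)).1 hy.1
      exact ⟨hx, y, this.1, e, this.2⟩
  filter_upwards [key] with x hx
  obtain ⟨hxX, y, hy, e, he⟩ := hx
  rw [e, bExp_gradX (hinj x hxX) hy]
  exact ⟨rfl, hy, he⟩

/-- The inverse of a continuous injection of a compact set is continuous. -/
theorem continuousOn_bExp (hX : IsCompact (closure X)) (hY : IsCompact (closure Y))
    (h0 : B0 X Y b) (h1 : B1 X Y b) :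
    ContinuousOn (fun p : Euc n × Euc n => bExp Y b p.1 p.2)
      ((fun p : Euc n × Euc n => (p.1, gradX b p.1 p.2)) '' (closure X ×ˢ closure Y)) := by
  have hφ : ContinuousOn (fun p : Euc n × Euc n => (p.1, gradX b p.1 p.2))
      (closure X ×ˢ closure Y) := continuousOn_fst.prodMk fun p hp =>
    (contDiffAt_gradX (h0 p.1 hp.1 p.2 hp.2)).continuousAt.continuousWithinAt
  rw [continuousOn_iff_isClosed]
  intro A hA
  refine ⟨(fun p : Euc n × Euc n => (p.1, gradX b p.1 p.2)) ''
    ((closure X ×ˢ closure Y) ∩ Prod.snd ⁻¹' A),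
    (((hX.prod hY).inter_right (hA.preimage continuous_snd)).image_of_continuousOn
      (hφ.mono inter_subset_left)).isClosed, ?_⟩
  ext q
  constructor
  · rintro ⟨hq, p, hp, rfl⟩
    simp only [mem_preimage, bExp_gradX (h1.1 p.1 hp.1).injOn hp.2] at hq
    exact ⟨⟨p, ⟨hp, hq⟩, rfl⟩, p, hp, rfl⟩
  · rintro ⟨⟨p, ⟨hp, hq⟩, rfl⟩, -⟩
    refine ⟨?_, p, hp, rfl⟩
    simpa only [mem_preimage, bExp_gradX (h1.1 p.1 hp.1).injOn hp.2] using hq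

theorem aemeasurable_bExp (hX : IsCompact (closure X)) (hY : IsCompact (closure Y))
    (h0 : B0 X Y b) (h1 : B1 X Y b) (hμ : μ Xᶜ = 0) (hD : AEMeasurable D μ)
    (h : ∀ᵐ x ∂μ, D x = gradX b x (bExp Y b x (D x)) ∧ bExp Y b x (D x) ∈ closure Y) :
    AEMeasurable (fun x => bExp Y b x (D x)) μ := by
  classical
  set K := (fun p : Euc n × Euc n => (p.1, gradX b p.1 p.2)) '' (closure X ×ˢ closure Y) with hK
  have hKc : IsCompact K := (hX.prod hY).image_of_continuousOn
    (continuousOn_fst.prodMk fun p hp =>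
      (contDiffAt_gradX (h0 p.1 hp.1 p.2 hp.2)).continuousAt.continuousWithinAt)
  have hm : Measurable (K.piecewise (fun p : Euc n × Euc n => bExp Y b p.1 p.2) fun _ => 0) :=
    (continuousOn_bExp hX hY h0 h1).measurable_piecewise continuousOn_const hKc.measurableSet
  refine (hm.comp_aemeasurable (aemeasurable_id.prodMk hD)).congr ?_
  filter_upwards [h, ae_mem_of_compl hμ] with x hx hxX
  have : (x, D x) ∈ K := ⟨(x, bExp Y b x (D x)), ⟨subset_closure hxX, hx.2⟩,
    Prod.ext rfl hx.1.symm⟩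
  exact piecewise_eq_of_mem _ _ _ this

theorem map_restrict_eq (hG : AEMeasurable G μ) (h : ∀ᵐ x ∂μ, G x ∈ closure Y) :
    (μ.map G).restrict (closure Y) = μ.map G :=
  Measure.restrict_eq_self_of_ae_mem
    ((ae_map_iff hG isClosed_closure.measurableSet).2 h)

theorem integral_map_closure {g : Euc n → ℝ} (hg : ContinuousOn g (closure Y))
    (hG : AEMeasurable G μ) (h : ∀ᵐ x ∂μ, G x ∈ closure Y) :
    ∫ y in closure Y, g y ∂(μ.map G) = ∫ x, g (G x) ∂μ := by
  have hgm := hg.aestronglyMeasurable (μ := μ.map G) isClosed_closure.measurableSet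
  rw [map_restrict_eq hG h] at hgm ⊢
  exact integral_map hG hgm

theorem integrable_comp_closure [IsFiniteMeasure μ] (hY : IsCompact (closure Y)) {g : Euc n → ℝ}
    (hg : ContinuousOn g (closure Y)) (hG : AEMeasurable G μ) (h : ∀ᵐ x ∂μ, G x ∈ closure Y) :
    Integrable (fun x => g (G x)) μ := by
  have hgm := hg.aestronglyMeasurable (μ := μ.map G) isClosed_closure.measurableSet
  rw [map_restrict_eq hG h] at hgm
  obtain ⟨C, hC⟩ := hY.exists_bound_of_continuousOn hg
  exact Integrable.of_bound (hgm.comp_aemeasurable hG) C (h.mono fun x hx => hC _ hx)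

end Selection

/-! ### Stability of optimal strategies -/

section Stability

variable {n : ℕ} {X Y : Set (Euc n)} {bs : ℕ → Euc n → Euc n → ℝ} {b : Euc n → Euc n → ℝ}
  {cs us : ℕ → Euc n → ℝ} {c u : Euc n → ℝ} {μs : ℕ → Measure (Euc n)} {μ : Measure (Euc n)}
  {y₀ : Euc n} {Gs : ℕ → Euc n → Euc n} {G : Euc n → Euc n}

/-- Almost every agent has the same best response to all optimal price menus. -/
theorem UniquenessHypotheses.ae_response (hXo : IsOpen X) (hYo : IsOpen Y)
    (hX : IsCompact (closure X)) (hY : IsCompact (closure Y)) (hy₀ : y₀ ∈ closure Y)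
    (h : UniquenessHypotheses X Y b c μ) (hμ : VanishesOnLipschitzHypersurfaces μ)
    {U : Euc n → ℝ} (hu : IsOptimal X Y y₀ b c μ u) (hU : IsOptimal X Y y₀ b c μ U)
    (hG : ∀ᵐ x ∂μ, G x ∈ closure Y ∧ u x + bStarTransform X b u (G x) = b x (G x)) :
    ∀ᵐ x ∂μ, G x ∈ closure Y ∧ U x + bStarTransform X b U (G x) = b x (G x) ∧
      ∀ y ∈ closure Y, U x + bStarTransform X b U y = b x y → y = G x := by
  have hXn := h.nonempty.closure
  have hYn : (closure Y).Nonempty := ⟨y₀, hy₀⟩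
  have hc := h.continuousOn_cost hX hY hYn
  have hcp := hu.1.1.isConjugatePair hX hY h.b0.continuousOn hXn hYn
  have hcP := hU.1.1.isConjugatePair hX hY h.b0.continuousOn hXn hYn
  filter_upwards [h.ae_agentChoice_eq hXo hYo hX hY hy₀ hμ hu hU, h.ae_unique hμ hcp,
    h.ae_unique hμ hcP, hu.1.1.ae_agentChoice h.supp hX hY hXn hYn h.b0 h.b1 hc,
    hU.1.1.ae_agentChoice h.supp hX hY hXn hYn h.b0 h.b1 hc, hG] with x e h1 h2 h3 h4 h5
  have hGx : G x = agentChoice X Y b c U x := by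
    rw [← e]
    exact h1 _ h5.1 _ h3.1 h5.2 h3.2.1
  rw [hGx]
  exact ⟨h4.1, h4.2.1, fun y hy ey => h2 y hy _ h4.1 ey h4.2.1⟩

/-- Optimal strategies are continuous, so they agree simultaneously outside a null set. -/
theorem UniquenessHypotheses.ae_forall_eq (hXo : IsOpen X) (hYo : IsOpen Y)
    (hX : IsCompact (closure X)) (hY : IsCompact (closure Y)) (hy₀ : y₀ ∈ closure Y)
    (h : UniquenessHypotheses X Y b c μ) (hμ : VanishesOnLipschitzHypersurfaces μ)
    (hu : IsOptimal X Y y₀ b c μ u) :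
    ∀ᵐ x ∂μ, ∀ U, IsOptimal X Y y₀ b c μ U → U x = u x := by
  have hXn := h.nonempty.closure
  have hYn : (closure Y).Nonempty := ⟨y₀, hy₀⟩
  have hcont : ∀ U, IsOptimal X Y y₀ b c μ U → ∀ x ∈ X, ContinuousAt U x := fun U hU x hx =>
    ((hU.1.1.isConjugatePair hX hY h.b0.continuousOn hXn hYn).continuousOn_left hX hY
      h.b0.continuousOn).continuousAt (mem_of_superset (hXo.mem_nhds hx) subset_closure)
  have hnull : μ {x | x ∈ X ∧ ∃ U, IsOptimal X Y y₀ b c μ U ∧ U x ≠ u x} = 0 := by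
    refine measure_null_of_locally_null _ fun x hx => ?_
    obtain ⟨hxX, U, hU, hne⟩ := hx
    exact ⟨{z | U z ≠ u z}, mem_nhdsWithin_of_mem_nhds
      ((((hcont U hU x hxX).sub (hcont u hu x hxX)).eventually_ne (sub_ne_zero.2 hne)).mono
        fun z hz => sub_ne_zero.1 hz),
      h.ae_eq hXo hYo hX hY hy₀ hμ hU hu⟩
  filter_upwards [ae_mem_of_compl h.supp, measure_eq_zero_iff_ae_notMem.1 hnull] with x hx hn U hU
  by_contra hne
  exact hn ⟨hx, U, hU, hne⟩

variable (hXo : IsOpen X) (hYo : IsOpen Y) (hX : IsCompact (closure X)) (hY : IsCompact (closure Y))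
  (hy₀ : y₀ ∈ closure Y) (D : ConvergentData X Y bs cs μs b c μ)
  (hus : ∀ i, IsOptimal X Y y₀ (bs i) (cs i) (μs i) (us i)) (hu : IsOptimal X Y y₀ b c μ u)
  (hG : ∀ᵐ x ∂μ, G x ∈ closure Y ∧ u x + bStarTransform X b u (G x) = b x (G x))

include hXo hYo hX hY hy₀ D hus hu hG

theorem ConvergentData.tendsto_integral_response {g : Euc n → ℝ} (hg : ContinuousOn g (closure Y))
    (hGs : ∀ i, ∀ᵐ x ∂μs i, Gs i x ∈ closure Y ∧
      us i x + bStarTransform X (bs i) (us i) (Gs i x) = bs i x (Gs i x))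
    (hint : ∀ i, Integrable (fun x => g (Gs i x)) (μs i)) :
    Tendsto (fun i => ∫ x, g (Gs i x) ∂μs i) atTop (𝓝 (∫ x, g (G x) ∂μ)) := by
  refine tendsto_of_subseq_tendsto fun ns hns => ?_
  have D' := D.subseq hns
  obtain ⟨φ, hφ, U, hU, hl⟩ := D'.exists_subseq hX hY hy₀ fun k => hus (ns k)
  have D'' := D'.subseq hφ
  have := D.limit.prob
  have := fun k => (D''.data k).prob
  have hbc := D.limit.b0.continuousOn
  refine ⟨φ, (hU.1.1.isConjugatePair hX hY hbc D.limit.nonempty.closure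
    ⟨y₀, hy₀⟩).tendsto_integral (f := g) (fs := fun _ => g) (Gs := fun k => Gs (ns (φ k)))
    hX hY hbc hg D.limit.supp (fun k => (D''.data k).supp) D''.tendsto_μ D''.tendsto_b hl
    (D''.tendsto_bStarTransform hX hY (fun k => (hus (ns (φ k))).1.1) hU.1.1 hl) ?_
    (fun k => hGs _) (fun k => hint _) (D.limit.ae_response hXo hYo hX hY hy₀ D.vanishes hu hU hG)⟩
  exact Metric.tendstoUniformlyOn_iff.2 fun ε hε => Eventually.of_forall fun _ x _ => by simpa

omit hG in
theorem ConvergentData.tendsto_eLpNorm :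
    Tendsto (fun i => eLpNorm (fun x => us i x - u x) ∞ μ) atTop (𝓝 0) := by
  refine tendsto_of_subseq_tendsto fun ns hns => ?_
  obtain ⟨φ, hφ, U, hU, hl⟩ := (D.subseq hns).exists_subseq hX hY hy₀ fun k => hus (ns k)
  refine ⟨φ, ?_⟩
  rw [ENNReal.tendsto_nhds_zero]
  intro ε hε
  rcases eq_or_ne ε ∞ with rfl | hε'
  · simp
  filter_upwards [Metric.tendstoUniformlyOn_iff.1 hl ε.toReal (ENNReal.toReal_pos hε.ne' hε')]
    with k hk
  rw [eLpNorm_exponent_top, ← ENNReal.ofReal_toReal hε']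
  refine eLpNormEssSup_le_of_ae_bound ?_
  filter_upwards [ae_mem_of_compl D.limit.supp,
    D.limit.ae_eq hXo hYo hX hY hy₀ D.vanishes hu hU] with x hx e
  rw [e, ← dist_eq_norm, dist_comm]
  exact (hk x (subset_closure hx)).le

/-- The best responses to all optimal price menus form a `b`-monotone relation, because the optimal
strategies agree almost everywhere. So for almost every agent `x` the relation contains no product
but `G x`, and every limit point of `Gs i x` belongs to it. -/
theorem ConvergentData.ae_tendsto_response (hGs : ∀ᵐ x ∂μ, ∀ i, Gs i x ∈ closure Y ∧
      us i x + bStarTransform X (bs i) (us i) (Gs i x) = bs i x (Gs i x)) :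
    ∀ᵐ x ∂μ, Tendsto (fun i => Gs i x) atTop (𝓝 (G x)) := by
  have hXn := D.limit.nonempty.closure
  have hYn : (closure Y).Nonempty := ⟨y₀, hy₀⟩
  have hbc := D.limit.b0.continuousOn
  set R : Set (Euc n × Euc n) := {p | p.1 ∈ X ∧ p.2 ∈ closure Y ∧
    (∀ U, IsOptimal X Y y₀ b c μ U → U p.1 = u p.1) ∧
    ∃ U, IsOptimal X Y y₀ b c μ U ∧ U p.1 + bStarTransform X b U p.2 = b p.1 p.2} with hR
  have hmono : ∀ p ∈ R, ∀ p' ∈ R, b p.1 p'.2 + b p'.1 p.2 ≤ b p.1 p.2 + b p'.1 p'.2 := by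
    rintro ⟨x, y⟩ ⟨hx, hy, hS, U, hU, e⟩ ⟨x', y'⟩ ⟨hx', hy', hS', U', hU', e'⟩
    have h1 := (hU.1.1.isConjugatePair hX hY hbc hXn hYn).le x' (subset_closure hx') y hy
    have h2 := (hU'.1.1.isConjugatePair hX hY hbc hXn hYn).le x (subset_closure hx) y' hy'
    have e1 := hS U hU
    have e2 := hS U' hU'
    have e3 := hS' U hU
    have e4 := hS' U' hU'
    simp only at *
    linarith
  filter_upwards [measure_nonunique_eq_zero (R := R)
    (fun x hx y hy => D.limit.b0.contDiffAt_one (subset_closure hx) hy)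
    (fun x hx => (D.limit.b1.1 x (subset_closure hx)).injOn) (fun p hp => ⟨hp.1, hp.2.1⟩) hmono
    D.vanishes, D.limit.ae_forall_eq hXo hYo hX hY hy₀ D.vanishes hu,
    ae_mem_of_compl D.limit.supp, hG, hGs] with x huniq hS hx hGx hGsx
  have hxc := subset_closure hx
  refine tendsto_of_subseq_tendsto fun ns hns => ?_
  have D' := D.subseq hns
  obtain ⟨φ, hφ, U, hU, hl⟩ := D'.exists_subseq hX hY hy₀ fun k => hus (ns k)
  have D'' := D'.subseq hφ
  have hcp := hU.1.1.isConjugatePair hX hY hbc hXn hYn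
  have hvl := D''.tendsto_bStarTransform hX hY (fun k => (hus (ns (φ k))).1.1) hU.1.1 hl
  obtain ⟨y, hy, ψ, hψ, hlim⟩ := hY.tendsto_subseq fun k => (hGsx (ns (φ k))).1
  refine ⟨fun k => φ (ψ k), ?_⟩
  have hlim' : Tendsto (fun k => Gs (ns (φ (ψ k))) x) atTop (𝓝[closure Y] y) :=
    tendsto_nhdsWithin_iff.2 ⟨hlim, Eventually.of_forall fun k => (hGsx _).1⟩
  have t1 : Tendsto (fun k => us (ns (φ (ψ k))) x) atTop (𝓝 (U x)) :=
    (hl.tendsto_at hxc).comp hψ.tendsto_atTop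
  have t2 := (tendstoUniformlyOn_subseq hvl hψ.tendsto_atTop).tendsto_comp
    (hcp.continuousOn_right hX hY hbc y hy) hlim'
  have hlim'' : Tendsto (fun k => (x, Gs (ns (φ (ψ k))) x)) atTop
      (𝓝[closure X ×ˢ closure Y] (x, y)) :=
    tendsto_nhdsWithin_iff.2 ⟨tendsto_const_nhds.prodMk_nhds hlim,
      Eventually.of_forall fun k => ⟨hxc, (hGsx _).1⟩⟩
  have t3 := (tendstoUniformlyOn_subseq D''.tendsto_b hψ.tendsto_atTop).tendsto_comp
    (hbc (x, y) ⟨hxc, hy⟩) hlim''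
  have e : U x + bStarTransform X b U y = b x y :=
    tendsto_nhds_unique (t1.add t2) (t3.congr fun k => (hGsx (ns (φ (ψ k)))).2.symm)
  rw [huniq (G x) y ⟨hx, hGx.1, hS, u, hu, hGx.2⟩ ⟨hx, hy, hS, U, hU, e⟩]
  exact hlim

end Stability

theorem TendstoC2.tendstoUniformlyOn {n : ℕ} {X Y : Set (Euc n)} {bs : ℕ → Euc n → Euc n → ℝ}
    {b : Euc n → Euc n → ℝ} (h : TendstoC2 X Y bs b) :
    TendstoUniformlyOn (fun i => Function.uncurry (bs i)) (Function.uncurry b) atTop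
      (closure X ×ˢ closure Y) := by
  have h0 := h 0 (Nat.zero_le _)
  rw [Metric.tendstoUniformlyOn_iff] at h0 ⊢
  intro ε hε
  filter_upwards [h0 ε hε] with i hi p hp
  refine lt_of_le_of_lt ?_ (hi p hp)
  rw [dist_eq_norm, dist_eq_norm]
  have := (iteratedFDeriv ℝ 0 (Function.uncurry b) p -
    iteratedFDeriv ℝ 0 (Function.uncurry (bs i)) p).le_opNorm 0
  simpa using this

end PrincipalAgent

theorem corollary4p5 {n : ℕ} (X Y : Set (PrincipalAgent.Euc n))
    (hXo : IsOpen X) (hXb : Bornology.IsBounded X) (hYo : IsOpen Y) (hYb : Bornology.IsBounded Y)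
    (y₀ : PrincipalAgent.Euc n) (hy₀ : y₀ ∈ closure Y)
    (b : ℕ∞ → PrincipalAgent.Euc n → PrincipalAgent.Euc n → ℝ)
    (c : ℕ∞ → PrincipalAgent.Euc n → ℝ)
    (μ : ℕ∞ → Measure (PrincipalAgent.Euc n))
    (hdata : ∀ i, PrincipalAgent.UniquenessHypotheses X Y (b i) (c i) (μ i))
    (hb : PrincipalAgent.TendstoC2 X Y (fun i : ℕ => b i) (b ⊤))
    (hc : TendstoUniformlyOn (fun i : ℕ => c i) (c ⊤) atTop (closure Y))
    (hμ : PrincipalAgent.WeakStarTendsto (closure X) (fun i : ℕ => μ i) (μ ⊤))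
    (hμ_top : PrincipalAgent.VanishesOnLipschitzHypersurfaces (μ ⊤))
    -- optimal strategies `u i`, their gradients `Du i` and the products `G i` selected by the agents
    (u : ℕ∞ → PrincipalAgent.Euc n → ℝ)
    (hu : ∀ i, PrincipalAgent.IsOptimal X Y y₀ (b i) (c i) (μ i) (u i))
    (Du : ℕ∞ → PrincipalAgent.Euc n → PrincipalAgent.Euc n)
    (hDu : ∀ i, PrincipalAgent.IsGradientSelection X Y (b i) (c i) (μ i) (u i) (Du i))
    (G : ℕ∞ → PrincipalAgent.Euc n → PrincipalAgent.Euc n)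
    (hG : ∀ i, ∀ x ∈ X, G i x = PrincipalAgent.bExp Y (b i) x (Du i x)) :
    (∀ᵐ x ∂(μ ⊤), Tendsto (fun i : ℕ => G i x) atTop (𝓝 (G ⊤ x))) ∧
    ((∀ i, AEMeasurable (G i) (μ i)) ∧
      PrincipalAgent.WeakStarTendsto (closure Y) (fun i : ℕ => (μ i).map (G i)) ((μ ⊤).map (G ⊤))) ∧
    Tendsto (fun i : ℕ => eLpNorm (fun x => u i x - u ⊤ x) ∞ (μ ⊤)) atTop (𝓝 0) := by
  have hX : IsCompact (closure X) := hXb.isCompact_closure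
  have hY : IsCompact (closure Y) := hYb.isCompact_closure
  have hYn : (closure Y).Nonempty := ⟨y₀, hy₀⟩
  have hXn := (hdata ⊤).nonempty.closure
  have D : PrincipalAgent.ConvergentData X Y (fun i : ℕ => b i) (fun i : ℕ => c i)
      (fun i : ℕ => μ i) (b ⊤) (c ⊤) (μ ⊤) :=
    ⟨fun i => hdata i, hdata ⊤, hb.tendstoUniformlyOn, hc, hμ, hμ_top⟩
  have hres : ∀ i, ∀ ν : Measure (PrincipalAgent.Euc n), ν Xᶜ = 0 →
      (PrincipalAgent.VanishesOnLipschitzHypersurfaces (μ i) →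
        PrincipalAgent.VanishesOnLipschitzHypersurfaces ν) →
      ∀ᵐ x ∂ν, G i x ∈ closure Y ∧
        u i x + PrincipalAgent.bStarTransform X (b i) (u i) (G i x) = b i x (G i x) := by
    intro i ν hν hv
    filter_upwards [PrincipalAgent.ae_mem_of_compl hν, (hDu i).ae_bExp hXo hX hY hXn hYn
      (hdata i).b0 (hdata i).b1 (hu i).1.1 hν hv] with x hx h
    rw [hG i x hx]
    exact h.2
  have hresμ := fun i => hres i (μ i) (hdata i).supp id
  have hmeas : ∀ i, AEMeasurable (G i) (μ i) := fun i => by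
    have h := (hDu i).ae_bExp hXo hX hY hXn hYn (hdata i).b0 (hdata i).b1 (hu i).1.1
      (hdata i).supp id
    refine (PrincipalAgent.aemeasurable_bExp hX hY (hdata i).b0 (hdata i).b1 (hdata i).supp
      (hDu i).aemeasurable (h.mono fun x hx => ⟨hx.1, hx.2.1⟩)).congr ?_
    filter_upwards [PrincipalAgent.ae_mem_of_compl (hdata i).supp] with x hx
    exact (hG i x hx).symm
  refine ⟨?_, ⟨hmeas, fun g hg => ?_⟩, ?_⟩
  · exact D.ae_tendsto_response (Gs := fun i : ℕ => G i) hXo hYo hX hY hy₀ (fun i => hu i) (hu ⊤)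
      (hresμ ⊤) (ae_all_iff.2 fun i => hres i _ (hdata ⊤).supp fun _ => hμ_top)
  · have := fun i => (hdata i).prob
    simp_rw [fun i => PrincipalAgent.integral_map_closure hg (hmeas i)
      ((hresμ i).mono fun x hx => hx.1)]
    exact D.tendsto_integral_response (Gs := fun i : ℕ => G i) hXo hYo hX hY hy₀ (fun i => hu i)
      (hu ⊤) (hresμ ⊤) hg (fun i => hresμ i) fun i =>
      PrincipalAgent.integrable_comp_closure hY hg (hmeas i) ((hresμ i).mono fun x hx => hx.1)
  · exact D.tendsto_eLpNorm hXo hYo hX hY hy₀ (fun i => hu i) (hu ⊤)
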